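/- **Theorem 3.1 (bound on the percolation probability).** Let $d\ge 1$ and let $(J_{x,y})$, indexed by unordered pairs of sites of $\mathbb Z^d$, be coupling constants which are translation invariant ($J_{x,y}=J_{0,y-x}$), ferromagnetic ($J_{x,y}\ge 0$), summable ($\sum_{x}J_{0,x}<\infty$), and aperiodic (every $x\in\mathbb Z^d$ can be reached from $0$ by a finite path $0=x_0,\dots,x_m=x$ with $J_{x_i,x_{i+1}}>0$ for all $i$). Let $\beta\ge 0$ and $\Lambda_L=[-L,L]^d\cap\mathbb Z^d$. *Spins.* For $\Lambda\subset\mathbb Z^d$ finite, $\langle\cdot\rangle^0_{\Lambda,\beta}$ is the expectation with respect to the probability on $\{-1,1\}^\Lambda$ proportional to $\exp\big(\beta\sum_{\{x,y\}\subset\Lambda,\,x\ne y}J_{x,y}\sigma_x\sigma_y\big)$. Put $\langle\sigma_x\sigma_y\rangle^0_\beta=\lim_{L\to\infty}\langle\sigma_x\sigma_y\rangle^0_{\Lambda_L,\beta}$, and let $\widetilde M_{LRO}(\beta)\ge 0$ be given by $$\widetilde M_{LRO}(\beta)^2=\inf_{\emptyset\ne B\subset\mathbb Z^d,\ |B|<\infty}\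 \frac1{|B|^2}\sum_{x,y\in B}\langle\sigma_x\sigma_y\rangle^0_\beta .$$ *Currents.* A current on a vertex set $V$ is a function $\mathbf n$ from the pairs of distinct vertices of $V$ to $\{0,1,2,\dots\}$, and $\partial\mathbf n$ is the set of $x\in V$ with $\sum_{y\neq x}\mathbf n_{x,y}$ odd. On a finite $V$, give probability proportional to $w_\beta(\mathbf n)=\prod_{\{x,y\}}(\beta J_{x,y})^{\mathbf n_{x,y}}/\mathbf n_{x,y}!$ to each $\mathbf n$ with $\partial\mathbf n=\emptyset$, and $0$ to the others. Let $\mathrm P^0_{\Lambda,\beta}$ be this law for $V=\Lambda$, and $\mathrm P^+_{\Lambda,\beta}$ this law for $V=\Lambda\cup\{\delta\}$, with an additional site $\delta$ and $J_{x,\delta}=\sum_{y\notin\Lambda}J_{x,y}$; both are regarded as laws of currents on $\mathbb Z^d$, by keeping the values on the pairs contained in $\Lambda$ and setting all the others to $0$. Let $\mathrm P^0_\beta$ and $\mathrm P^+_\beta$ be the probability measures on currents on $\mathbb Z^d$ to which $\mathrm P^0_{\Lambda_L,\beta}$ and $\mathrm P^+_{\Lambda_L,\beta}$ converge, as $L\to\infty$,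 on every event that depends on finitely many pairs. Let $\mathbb P_\beta$ be the law of the bond percolation configuration on $\mathbb Z^d$ in which the bond $\{x,y\}$ is open if and only if $(\mathbf n_1+\mathbf n_2)_{x,y}>0$, where $\mathbf n_1,\mathbf n_2$ are independent with laws $\mathrm P^0_\beta$ and $\mathrm P^+_\beta$. Write $x\leftrightarrow y$ if $x$ and $y$ are joined by a path of open bonds, and $0\leftrightarrow\infty$ if infinitely many sites $y$ satisfy $0\leftrightarrow y$. Then the limits which define $\langle\sigma_x\sigma_y\rangle^0_\beta$, $\mathrm P^0_\beta$ and $\mathrm P^+_\beta$ exist, and $$\mathbb P_\beta[x\leftrightarrow y]\ \le\ \langle\sigma_x\sigma_y\rangle^0_\beta\quad\text{for all }x,y\in\mathbb Z^d,\qquad\qquad \mathbb P_\beta[0\leftrightarrow\infty]^2\ \le\ \widetilde M_{LRO}(\beta)^2 .$$ In particular, if $\widetilde M_{LRO}(\beta)=0$ then $\mathbb P_\beta[0\leftrightarrow\infty]=0$. -/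

import Mathlib

open MeasureTheory Filter Topology

noncomputable section

namespace IsingCurrent

/-! ### The lattice, bonds, and finite-volume Gibbs states -/

/-- The sites of the lattice `ℤ^d`. -/
abbrev Site (d : ℕ) : Type := Fin d → ℤ

/-- The box `[-L, L]^d`. -/
def box (d L : ℕ) : Finset (Site d) := Finset.Icc (fun _ => -(L : ℤ)) (fun _ => (L : ℤ))

/-- The bonds on a vertex set `V`: unordered pairs of distinct vertices. -/
abbrev Bond (V : Type*) : Type _ := {e : Sym2 V // ¬ e.IsDiag}

/-- The bond map induced by an injection of vertex sets. -/
def Bond.map {V W : Type*} (f : V ↪ W) (b : Bond V) : Bond W :=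
  ⟨b.1.map f, fun h => b.2 ((Sym2.isDiag_map f.injective).1 h)⟩

/-- Coupling constants on a finite set `Λ` of sites (restriction to pairs of sites of `Λ`). -/
def freeCoupling {d : ℕ} (J : Sym2 (Site d) → ℝ) (Λ : Finset (Site d)) : Sym2 Λ → ℝ :=
  fun e => J (e.map Subtype.val)

/-- The Hamiltonian of the Ising model on a finite vertex set, at zero magnetic field:
`H(σ) = - ∑_{x,y} J_{x,y} σ_x σ_y`, the sum over unordered pairs of distinct vertices. -/
def hamiltonian {V : Type*} [Fintype V] [DecidableEq V] (J : Sym2 V → ℝ) (σ : V → ℤˣ) : ℝ :=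
  -∑ b : Bond V, J b.1 * (((b.1.map σ).mul : ℤˣ) : ℤ)

/-- The Gibbs expectation value of `f` at inverse temperature `β`. -/
def gibbs {V : Type*} [Fintype V] [DecidableEq V] (J : Sym2 V → ℝ) (β : ℝ)
    (f : (V → ℤˣ) → ℝ) : ℝ :=
  (∑ σ : V → ℤˣ, f σ * Real.exp (-β * hamiltonian J σ)) /
    ∑ σ : V → ℤˣ, Real.exp (-β * hamiltonian J σ)

/-- The spin at a site of `ℤ^d` with free boundary conditions (`0` outside of `Λ`). -/
def spin {d : ℕ} {Λ : Finset (Site d)} (σ : Λ → ℤˣ) (x : Site d) : ℝ :=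
  if h : x ∈ Λ then (((σ ⟨x, h⟩ : ℤˣ) : ℤ) : ℝ) else 0

/-- The two-point function `⟨σ_x σ_y⟩⁰_{Λ,β}` with free boundary conditions in finite volume. -/
def freeCorrIn {d : ℕ} (J : Sym2 (Site d) → ℝ) (β : ℝ) (Λ : Finset (Site d))
    (x y : Site d) : ℝ :=
  gibbs (freeCoupling J Λ) β (fun σ => spin σ x * spin σ y)

/-- The infinite-volume two-point function `⟨σ_x σ_y⟩⁰_β`: the limit along the boxes. -/
def freeCorr {d : ℕ} (J : Sym2 (Site d) → ℝ) (β : ℝ) (x y : Site d) : ℝ :=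
  limUnder atTop (fun L : ℕ => freeCorrIn J β (box d L) x y)

/-- The long range order parameter `M̃_LRO(β) ≥ 0`, whose square is the infimum over the
non-empty finite sets `B` of sites of `|B|⁻² ∑_{x,y ∈ B} ⟨σ_x σ_y⟩⁰_β`. -/
def MtildeLRO {d : ℕ} (J : Sym2 (Site d) → ℝ) (β : ℝ) : ℝ :=
  Real.sqrt (⨅ B : {B : Finset (Site d) // B.Nonempty},
    (∑ x ∈ B.1, ∑ y ∈ B.1, freeCorr J β x y) / (B.1.card : ℝ) ^ 2)

/-! ### Random currents in finite volume -/

/-- Current configurations on the vertex set `V`. -/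
abbrev Current (V : Type*) : Type _ := Bond V → ℕ

/-- The sources of a current: the vertices of odd total flux. -/
def sources {V : Type*} [Fintype V] [DecidableEq V] (n : Current V) : Set V :=
  {x | Odd (∑ b : Bond V with x ∈ b.1, n b)}

/-- The weight `w_β(n) = ∏ (β J_{x,y})^{n_{x,y}} / n_{x,y}!`. -/
def weight {V : Type*} [Fintype V] [DecidableEq V] (J : Sym2 V → ℝ) (β : ℝ)
    (n : Current V) : ℝ :=
  ∏ b : Bond V, (β * J b.1) ^ n b / (Nat.factorial (n b) : ℝ)

open Classical in
/-- The weight of a current, restricted to the currents without sources. -/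
def sourcelessWeight {V : Type*} [Fintype V] [DecidableEq V] (J : Sym2 V → ℝ) (β : ℝ)
    (n : Current V) : ℝ :=
  if sources n = ∅ then weight J β n else 0

/-- The law of the sourceless random current on a finite vertex set: a current `n` has probability
`w_β(n) 1[∂n = ∅] / ∑_{∂m = ∅} w_β(m)`. -/
def currentLaw {V : Type*} [Fintype V] [DecidableEq V] (J : Sym2 V → ℝ) (β : ℝ) :
    Measure (Current V) :=
  Measure.sum fun n : Current V =>
    ENNReal.ofReal (sourcelessWeight J β n / ∑' m : Current V, sourcelessWeight J β m) •
      Measure.dirac n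

/-- Coupling constants on `Λ ∪ {δ}`, where the ghost site `δ` is `none`:
`J_{x,δ} = ∑_{y ∉ Λ} J_{x,y}`. -/
def plusCoupling {d : ℕ} (J : Sym2 (Site d) → ℝ) (Λ : Finset (Site d)) :
    Sym2 (Option Λ) → ℝ :=
  Sym2.lift ⟨fun u v => match u, v with
    | some x, some y => J s(x.1, y.1)
    | some x, none => ∑' y : {y : Site d // y ∉ Λ}, J s(x.1, y.1)
    | none, some x => ∑' y : {y : Site d // y ∉ Λ}, J s(x.1, y.1)
    | none, none => 0, by
      rintro (_ | x) (_ | y) <;> simp [Sym2.eq_swap]⟩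

/-- A current on `Λ`, viewed as a current on `ℤ^d` that vanishes on all other pairs. -/
def extendCurrent {d : ℕ} (Λ : Finset (Site d)) (n : Current Λ) : Current (Site d) :=
  Function.extend (Bond.map (Function.Embedding.subtype (· ∈ Λ))) n 0

/-- The law of the random current on `Λ` with free boundary conditions, on currents on `ℤ^d`. -/
def freeLawIn {d : ℕ} (J : Sym2 (Site d) → ℝ) (β : ℝ) (Λ : Finset (Site d)) :
    Measure (Current (Site d)) :=
  (currentLaw (freeCoupling J Λ) β).map (extendCurrent Λ)

/-- The law of the random current on `Λ ∪ {δ}` (plus boundary conditions), seen on the bonds of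
`ℤ^d`. The flux into the ghost site is automatically even when every site of `Λ` has even flux,
so that requiring `∂n = ∅` on `Λ ∪ {δ}` is the same as requiring it on `Λ` only. -/
def plusLawIn {d : ℕ} (J : Sym2 (Site d) → ℝ) (β : ℝ) (Λ : Finset (Site d)) :
    Measure (Current (Site d)) :=
  (currentLaw (plusCoupling J Λ) β).map
    fun n => extendCurrent Λ fun b => n (Bond.map Function.Embedding.some b)

/-! ### Infinite volume -/

/-- `μ` is a probability measure, and `μ_L(A) → μ(A)` for every event `A` that depends on finitely
many bonds. -/
def IsLocalLimit {d : ℕ} (μL : ℕ → Measure (Current (Site d)))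
    (μ : Measure (Current (Site d))) : Prop :=
  IsProbabilityMeasure μ ∧
    ∀ (E : Finset (Bond (Site d))) (A : Set (E → ℕ)),
      Tendsto (fun L => μL L (cylinder E A)) atTop (𝓝 (μ (cylinder E A)))

/-- A local limit is unique. -/
theorem IsLocalLimit.unique {d : ℕ} {μL : ℕ → Measure (Current (Site d))}
    {μ ν : Measure (Current (Site d))} (hμ : IsLocalLimit μL μ) (hν : IsLocalLimit μL ν) :
    μ = ν := by
  have := hμ.1
  have := hν.1
  refine IsProjectiveLimit.unique (P := fun E => μ.map E.restrict) (fun E => rfl) (fun E => ?_)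
  ext A hA
  rw [Measure.map_apply (by fun_prop) hA, Measure.map_apply (by fun_prop) hA]
  exact tendsto_nhds_unique (hν.2 E A) (hμ.2 E A)

open Classical in
/-- The local limit of a sequence of laws (the zero measure if there is none). -/
def localLimit {d : ℕ} (μL : ℕ → Measure (Current (Site d))) : Measure (Current (Site d)) :=
  if h : ∃ μ, IsLocalLimit μL μ then h.choose else 0

/-- The law `P⁰_β` of the infinite-volume random current with free boundary conditions. -/
def freeLaw {d : ℕ} (J : Sym2 (Site d) → ℝ) (β : ℝ) : Measure (Current (Site d)) :=
  localLimit fun L => freeLawIn J β (box d L)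

/-- The law `P⁺_β` of the infinite-volume random current with plus boundary conditions. -/
def plusLaw {d : ℕ} (J : Sym2 (Site d) → ℝ) (β : ℝ) : Measure (Current (Site d)) :=
  localLimit fun L => plusLawIn J β (box d L)

/-! ### Percolation -/

/-- Bond percolation configurations on `ℤ^d`; the bond `b` is open if `ω b = true`. -/
abbrev Config (d : ℕ) : Type := Bond (Site d) → Bool

/-- The percolation configuration of a current: `b` is open if `n_b > 0`. -/
def trace {d : ℕ} (n : Current (Site d)) : Config d := fun b => decide (0 < n b)

/-- The law `ℙ_β` of the percolation configuration of `n₁ + n₂`, for independent `n₁`, `n₂` of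
laws `P⁰_β` and `P⁺_β`. -/
def percLaw {d : ℕ} (J : Sym2 (Site d) → ℝ) (β : ℝ) : Measure (Config d) :=
  ((freeLaw J β).prod (plusLaw J β)).map fun n => trace (n.1 + n.2)

/-- The graph of the open bonds. -/
def openGraph {d : ℕ} (ω : Config d) : SimpleGraph (Site d) :=
  SimpleGraph.fromEdgeSet {e | ∃ b : Bond (Site d), b.1 = e ∧ ω b = true}

/-- The event `x ↔ y`. -/
def connEvent {d : ℕ} (x y : Site d) : Set (Config d) :=
  {ω | (openGraph ω).Reachable x y}

/-- The event `x ↔ ∞` that the cluster of `x` is infinite. -/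
def connInfEvent {d : ℕ} (x : Site d) : Set (Config d) :=
  {ω | {y | (openGraph ω).Reachable x y}.Infinite}

end IsingCurrent

end

open IsingCurrent

open MeasureTheory Filter Topology

noncomputable section

set_option linter.unusedSectionVars false

/-! Everything rests on Griffiths' inequalities for characters of finite groups of `±1` spins. The
average over spins of `∏ σ_b ^ n_b` is the indicator of `∂n = ∅`, so a sum over sourceless currents
becomes a spin sum that factorises over bonds. Hence the probability that a current takes the values
`k` on finitely many bonds is the Gibbs expectation of the local function `∏ x_b ^ k_b * exp (-x_b)
/ k_b!`, where `x_b = β J_b σ_b` (`currentLaw_marginal`). By Griffiths, free correlations increase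
and plus correlations decrease with the volume; expectations of local functions therefore converge
to translation invariant limits. A summable bound on the marginals gives tightness, and with it the
infinite-volume currents (`exists_isCurrentState`).

Two-point bound (`sum_ev_mul_ev_le`, `percLaw_connEvent_le`). Let `σ`, `τ` be the spins attached to
the two independent currents. The law of `n₁ + n₂` on a finite set of bonds is the expectation of
the same weights with parameters `β J_b (σ_b + τ_b)`, and these vanish if `m_b > 0` and `σ_b ≠ τ_b`.
If `m` joins `x` to `y`, then `σ_x σ_y = τ_x τ_y` wherever the weight is nonzero, so a factor `σ_x
σ_y τ_x τ_y` may be inserted. With that factor the term of every `m` is nonnegative by Griffiths, so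
the sum may be extended to all `m`; its value is `⟨σ_x σ_y⟩⁰ ⟨τ_x τ_y⟩⁺ ≤ ⟨σ_x σ_y⟩⁰`.

Infinite cluster (`IsTolerant.ae_connEvent`). Uniqueness follows Burton and Keane. The percolation
law is translation invariant, its bond densities are summable, and a bond with `β J > 0` can be
opened at a finite cost by adding `2` to a current, which preserves parities. Three infinite
clusters could be glued into a trifurcation; but disjoint trifurcations in a box are at most as many
as its outer boundary vertices, whose expected number is `o(volume)`. Two infinite clusters are
excluded without ergodicity: having at least two is an invariant event, so it almost surely persists
when finitely many bonds are opened; if these bonds join two infinite clusters, there must have been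
three.

Conclusion (`IsTolerant.sq_connInfEvent_le`). With `θ` the probability that `0` lies in an infinite
cluster and `N` the number of sites of `B` that do, `(|B| θ)² ≤ E[N²]` because the variance is
nonnegative, and `E[N²] ≤ ∑ P[x ↔ y]` by uniqueness; the two-point bound finishes. -/

namespace IsingCurrent

/-! ### Griffiths inequalities on finite groups of spins -/

section Griffiths

variable {G : Type*} [CommGroup G]

/-- A `±1`-valued character, as a real function. -/
def charVal (χ : G →* ℤˣ) (g : G) : ℝ := ((χ g : ℤˣ) : ℤ)

theorem charVal_one : charVal (1 : G →* ℤˣ) = 1 := by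
  ext g; simp [charVal]

theorem charVal_mul (χ ψ : G →* ℤˣ) : charVal (χ * ψ) = charVal χ * charVal ψ := by
  ext g; simp [charVal]

theorem charVal_map_mul (χ : G →* ℤˣ) (g h : G) :
    charVal χ (g * h) = charVal χ g * charVal χ h := by
  simp [charVal]

theorem charVal_comp {H : Type*} [CommGroup H] (χ : G →* ℤˣ) (φ : H →* G) (h : H) :
    charVal (χ.comp φ) h = charVal χ (φ h) := rfl

theorem charVal_eq_or (χ : G →* ℤˣ) (g : G) : charVal χ g = 1 ∨ charVal χ g = -1 := by
  rcases Int.units_eq_one_or (χ g) with h | h <;> simp [charVal, h]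

theorem abs_charVal (χ : G →* ℤˣ) (g : G) : |charVal χ g| = 1 := by
  rcases charVal_eq_or χ g with h | h <;> simp [h]

theorem charVal_le_one (χ : G →* ℤˣ) (g : G) : charVal χ g ≤ 1 :=
  (le_abs_self _).trans (abs_charVal χ g).le

theorem neg_one_le_charVal (χ : G →* ℤˣ) (g : G) : -1 ≤ charVal χ g :=
  (abs_le.1 (abs_charVal χ g).le).1

theorem charVal_mul_self (χ : G →* ℤˣ) (g : G) : charVal χ g * charVal χ g = 1 := by
  rcases charVal_eq_or χ g with h | h <;> simp [h]

/-- A character takes only the values `±1`, so its exponential is affine in it. This keeps `posCone`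
closed under exponentials and makes Gibbs factors local polynomials. -/
theorem exp_mul_charVal (c : ℝ) (χ : G →* ℤˣ) (g : G) :
    Real.exp (c * charVal χ g) = Real.cosh c + Real.sinh c * charVal χ g := by
  rcases charVal_eq_or χ g with h | h <;> rw [h]
  · simp [Real.cosh_add_sinh]
  · rw [mul_neg_one, mul_neg_one, ← sub_eq_add_neg, Real.cosh_sub_sinh]

theorem sum_charVal_one [Fintype G] : ∑ g, charVal (1 : G →* ℤˣ) g = Fintype.card G := by
  simp [charVal]

theorem sum_charVal_eq_zero [Fintype G] {χ : G →* ℤˣ} (h : χ ≠ 1) : ∑ g, charVal χ g = 0 := by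
  obtain ⟨a, ha⟩ : ∃ a, χ a ≠ 1 := by
    by_contra! h'
    exact h (MonoidHom.ext h')
  have ha' : charVal χ a = -1 := by
    simp [charVal, (Int.units_eq_one_or (χ a)).resolve_left ha]
  have : ∑ g, charVal χ g = ∑ g, charVal χ (a * g) :=
    (Equiv.sum_comp (Equiv.mulLeft a) (charVal χ)).symm
  simp only [charVal_map_mul, ha', ← Finset.mul_sum] at this
  linarith

variable (G) in
/-- The cone of nonnegative combinations of characters. -/
def posCone : AddSubmonoid (G → ℝ) :=
  AddSubmonoid.closure {f | ∃ c : ℝ, 0 ≤ c ∧ ∃ χ : G →* ℤˣ, f = c • charVal χ}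

theorem smul_charVal_mem {c : ℝ} (hc : 0 ≤ c) (χ : G →* ℤˣ) : c • charVal χ ∈ posCone G :=
  AddSubmonoid.subset_closure ⟨c, hc, χ, rfl⟩

theorem charVal_mem (χ : G →* ℤˣ) : charVal χ ∈ posCone G := by
  simpa using smul_charVal_mem zero_le_one χ

theorem one_mem_posCone : (1 : G → ℝ) ∈ posCone G := by
  rw [← charVal_one]; exact charVal_mem 1

theorem smul_mem_posCone {c : ℝ} (hc : 0 ≤ c) {f : G → ℝ} (hf : f ∈ posCone G) :
    c • f ∈ posCone G := by
  induction hf using AddSubmonoid.closure_induction with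
  | mem f hf =>
    obtain ⟨a, ha, χ, rfl⟩ := hf
    rw [smul_smul]
    exact smul_charVal_mem (mul_nonneg hc ha) χ
  | zero => simp [zero_mem]
  | add f g _ _ hf hg => rw [smul_add]; exact add_mem hf hg

theorem mul_mem_posCone {f g : G → ℝ} (hf : f ∈ posCone G) (hg : g ∈ posCone G) :
    f * g ∈ posCone G := by
  induction hf using AddSubmonoid.closure_induction with
  | mem f hf =>
    obtain ⟨a, ha, χ, rfl⟩ := hf
    rw [smul_mul_assoc]
    refine smul_mem_posCone ha ?_
    induction hg using AddSubmonoid.closure_induction with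
    | mem g hg =>
      obtain ⟨b, hb, ψ, rfl⟩ := hg
      rw [mul_smul_comm, ← charVal_mul]
      exact smul_charVal_mem hb _
    | zero => simp [zero_mem]
    | add f g _ _ hf hg => rw [mul_add]; exact add_mem hf hg
  | zero => simp [zero_mem]
  | add f g _ _ hf hg => rw [add_mul]; exact add_mem hf hg

theorem pow_mem_posCone {f : G → ℝ} (hf : f ∈ posCone G) (n : ℕ) : f ^ n ∈ posCone G := by
  induction n with
  | zero => simpa using one_mem_posCone
  | succ n ih => rw [pow_succ]; exact mul_mem_posCone ih hf

theorem prod_mem_posCone {ι : Type*} (s : Finset ι) {f : ι → G → ℝ}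
    (hf : ∀ i ∈ s, f i ∈ posCone G) : ∏ i ∈ s, f i ∈ posCone G := by
  classical
  induction s using Finset.induction_on with
  | empty => simpa using one_mem_posCone
  | insert a s ha ih =>
    rw [Finset.prod_insert ha]
    exact mul_mem_posCone (hf _ (by simp)) (ih fun i hi => hf i (by simp [hi]))

theorem exp_mem_posCone {U : G → ℝ} (hU : U ∈ posCone G) :
    (fun g => Real.exp (U g)) ∈ posCone G := by
  induction hU using AddSubmonoid.closure_induction with
  | mem f hf =>
    obtain ⟨a, ha, χ, rfl⟩ := hf
    have : (fun g => Real.exp ((a • charVal χ) g)) =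
        Real.cosh a • (1 : G → ℝ) + Real.sinh a • charVal χ := by
      ext g; simp [exp_mul_charVal]
    rw [this]
    exact add_mem (smul_mem_posCone (Real.cosh_pos a).le one_mem_posCone)
      (smul_charVal_mem (Real.sinh_nonneg_iff.2 ha) χ)
  | zero => simpa using! one_mem_posCone
  | add f g _ _ hf hg =>
    have : (fun x => Real.exp ((f + g) x)) =
        (fun x => Real.exp (f x)) * fun x => Real.exp (g x) := by
      ext x; simp [Real.exp_add]
    rw [this]; exact mul_mem_posCone hf hg

theorem comp_mem_posCone {H : Type*} [CommGroup H] (φ : H →* G) {f : G → ℝ}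
    (hf : f ∈ posCone G) : f ∘ φ ∈ posCone H := by
  induction hf using AddSubmonoid.closure_induction with
  | mem f hf =>
    obtain ⟨a, ha, χ, rfl⟩ := hf
    exact smul_charVal_mem ha (χ.comp φ)
  | zero => exact zero_mem _
  | add f g _ _ hf hg => exact add_mem hf hg

/-- Translation by `t` multiplies a character by `χ t ≤ 1`, so the difference keeps a nonnegative
coefficient. With the analogous sum below, this is what the duplication of variables needs. -/
theorem sub_translate_mem_posCone (t : G) {f : G → ℝ} (hf : f ∈ posCone G) :
    (fun g => f g - f (g * t)) ∈ posCone G := by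
  induction hf using AddSubmonoid.closure_induction with
  | mem f hf =>
    obtain ⟨a, ha, χ, rfl⟩ := hf
    have : (fun g => (a • charVal χ) g - (a • charVal χ) (g * t)) =
        (a * (1 - charVal χ t)) • charVal χ := by
      ext g; simp [charVal_map_mul]; ring
    rw [this]
    exact smul_charVal_mem (mul_nonneg ha (sub_nonneg.2 (charVal_le_one χ t))) χ
  | zero => simp only [Pi.zero_apply, sub_zero]; exact zero_mem (posCone G)
  | add f g _ _ hf hg =>
    convert add_mem hf hg using 1
    ext x; simp; ring

theorem add_translate_mem_posCone (t : G) {f : G → ℝ} (hf : f ∈ posCone G) :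
    (fun g => f g + f (g * t)) ∈ posCone G := by
  induction hf using AddSubmonoid.closure_induction with
  | mem f hf =>
    obtain ⟨a, ha, χ, rfl⟩ := hf
    have : (fun g => (a • charVal χ) g + (a • charVal χ) (g * t)) =
        (a * (1 + charVal χ t)) • charVal χ := by
      ext g; simp [charVal_map_mul]; ring
    rw [this]
    exact smul_charVal_mem (mul_nonneg ha (by linarith [neg_one_le_charVal χ t])) χ
  | zero => simp only [Pi.zero_apply, add_zero]; exact zero_mem (posCone G)
  | add f g _ _ hf hg =>
    convert add_mem hf hg using 1
    ext x; simp; ring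

variable [Fintype G]

/-- The first Griffiths inequality. -/
theorem sum_nonneg_of_mem_posCone {f : G → ℝ} (hf : f ∈ posCone G) : 0 ≤ ∑ g, f g := by
  induction hf using AddSubmonoid.closure_induction with
  | mem f hf =>
    obtain ⟨a, ha, χ, rfl⟩ := hf
    simp only [Pi.smul_apply, smul_eq_mul, ← Finset.mul_sum]
    refine mul_nonneg ha ?_
    by_cases h : χ = 1
    · rw [h, sum_charVal_one]; positivity
    · rw [sum_charVal_eq_zero h]
  | zero => simp
  | add f g _ _ hf hg => simp only [Pi.add_apply, Finset.sum_add_distrib]; exact add_nonneg hf hg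

/-- The second Griffiths inequality, by Ginibre's duplication of variables. -/
theorem sum_mul_sum_le_of_mem_posCone {f F U : G → ℝ} (hf : f ∈ posCone G) (hF : F ∈ posCone G)
    (hU : U ∈ posCone G) :
    (∑ g, f g * Real.exp (U g)) * (∑ g, F g * Real.exp (U g)) ≤
      (∑ g, f g * F g * Real.exp (U g)) * ∑ g, Real.exp (U g) := by
  rw [← sub_nonneg]
  -- The second copy of the variable is written as `g * t`. For each relative variable `t` the sum
  -- over `g` then falls under the first Griffiths inequality.
  have key : (∑ g, f g * F g * Real.exp (U g)) * (∑ g, Real.exp (U g)) -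
      (∑ g, f g * Real.exp (U g)) * (∑ g, F g * Real.exp (U g)) =
      ∑ t : G, ∑ g, f g * ((F g - F (g * t)) * Real.exp (U g + U (g * t))) := by
    rw [Finset.sum_comm, Finset.sum_mul_sum, Finset.sum_mul_sum, ← Finset.sum_sub_distrib]
    refine Finset.sum_congr rfl fun g _ => ?_
    rw [← Finset.sum_sub_distrib, ← Equiv.sum_comp (Equiv.mulLeft g)]
    refine Finset.sum_congr rfl fun t _ => ?_
    simp only [Equiv.coe_mulLeft, Real.exp_add]
    ring
  rw [key]
  refine Finset.sum_nonneg fun t _ => sum_nonneg_of_mem_posCone ?_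
  exact mul_mem_posCone hf (mul_mem_posCone (sub_translate_mem_posCone t hF)
    (exp_mem_posCone (add_translate_mem_posCone t hU)))

/-- The expectation of `f` with respect to the weights `exp U`. -/
def ev (U f : G → ℝ) : ℝ := (∑ g, f g * Real.exp (U g)) / ∑ g, Real.exp (U g)

theorem sum_exp_pos (U : G → ℝ) : 0 < ∑ g, Real.exp (U g) :=
  Finset.sum_pos (fun _ _ => Real.exp_pos _) Finset.univ_nonempty

theorem ev_add (U f g : G → ℝ) : ev U (f + g) = ev U f + ev U g := by
  simp [ev, add_mul, Finset.sum_add_distrib, add_div]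

theorem ev_smul (U : G → ℝ) (c : ℝ) (f : G → ℝ) : ev U (c • f) = c * ev U f := by
  simp [ev, mul_assoc, ← Finset.mul_sum, mul_div_assoc]

theorem ev_zero (U : G → ℝ) : ev U 0 = 0 := by simp [ev]

theorem ev_mono (U : G → ℝ) {f g : G → ℝ} (h : ∀ x, f x ≤ g x) : ev U f ≤ ev U g := by
  unfold ev
  have := (sum_exp_pos U).le
  gcongr
  exact h _

theorem ev_const (U : G → ℝ) (c : ℝ) : ev U (fun _ => c) = c := by
  rw [ev, ← Finset.mul_sum, mul_div_cancel_right₀ _ (sum_exp_pos U).ne']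

theorem ev_nonneg {U f : G → ℝ} (hf : f ∈ posCone G) (hU : U ∈ posCone G) : 0 ≤ ev U f :=
  div_nonneg (sum_nonneg_of_mem_posCone (mul_mem_posCone hf (exp_mem_posCone hU)))
    (sum_exp_pos U).le

theorem ev_charVal_le_one (U : G → ℝ) (χ : G →* ℤˣ) : ev U (charVal χ) ≤ 1 :=
  (ev_mono U (charVal_le_one χ)).trans_eq (ev_const U 1)

/-- The right side is the expectation for the tilted weights `F * exp U`. Taking `F = exp W` gives
monotonicity in the couplings, and `F` an indicator gives monotonicity under conditioning. -/
theorem ev_le_div {U f F : G → ℝ} (hf : f ∈ posCone G) (hF : F ∈ posCone G)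
    (hU : U ∈ posCone G) (hpos : 0 < ∑ g, F g * Real.exp (U g)) :
    ev U f ≤ (∑ g, f g * F g * Real.exp (U g)) / ∑ g, F g * Real.exp (U g) := by
  rw [ev, div_le_div_iff₀ (sum_exp_pos U) hpos]
  exact sum_mul_sum_le_of_mem_posCone hf hF hU

/-- Correlations are increasing in the couplings. -/
theorem ev_le_ev_add {U W f : G → ℝ} (hf : f ∈ posCone G) (hU : U ∈ posCone G)
    (hW : W ∈ posCone G) : ev U f ≤ ev (U + W) f := by
  have e1 : ∀ g, Real.exp ((U + W) g) = Real.exp (W g) * Real.exp (U g) := fun g => by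
    rw [← Real.exp_add, add_comm]; rfl
  refine (ev_le_div hf (exp_mem_posCone hW) hU
    (Finset.sum_pos (fun _ _ => by positivity) Finset.univ_nonempty)).trans_eq ?_
  simp only [ev, e1, mul_assoc]

/-- All fibres are cosets of the kernel, so `c` is the size of the kernel. Spins that neither the
energy nor the observable sees can thus be summed out. -/
theorem sum_comp_of_surjective {H : Type*} [CommGroup H] [Fintype H] (φ : H →* G)
    (hφ : Function.Surjective φ) :
    ∃ c : ℝ, 0 < c ∧ ∀ f : G → ℝ, ∑ h, f (φ h) = c * ∑ g, f g := by
  classical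
  refine ⟨(Finset.univ.filter fun h => φ h = 1).card, ?_, fun f => ?_⟩
  · exact_mod_cast Finset.card_pos.2 ⟨1, by simp⟩
  · rw [← Finset.sum_fiberwise Finset.univ φ, Finset.mul_sum]
    refine Finset.sum_congr rfl fun g _ => ?_
    rw [Finset.sum_congr rfl (g := fun _ => f g) (fun h hh => by rw [(Finset.mem_filter.1 hh).2]),
      Finset.sum_const, nsmul_eq_mul,
      MonoidHom.card_fiber_eq_of_mem_range φ (x := g) (y := 1) (hφ g) ⟨1, map_one φ⟩]

theorem ev_comp_of_surjective {H : Type*} [CommGroup H] [Fintype H] (φ : H →* G)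
    (hφ : Function.Surjective φ) (U f : G → ℝ) : ev (U ∘ φ) (f ∘ φ) = ev U f := by
  obtain ⟨c, hc, h⟩ := sum_comp_of_surjective φ hφ
  simp only [ev, Function.comp_apply]
  rw [h fun g => f g * Real.exp (U g), h fun g => Real.exp (U g), mul_div_mul_left _ _ hc.ne']

theorem ev_add_const (U f : G → ℝ) (c : ℝ) : ev (fun g => U g + c) f = ev U f := by
  simp only [ev, Real.exp_add, ← mul_assoc, ← Finset.sum_mul]
  rw [mul_div_mul_right _ _ (Real.exp_pos c).ne']

/-- Restricting to the subgroup on which some characters are `1` increases correlations. -/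
theorem ev_le_ev_comp {H : Type*} [CommGroup H] [Fintype H] (φ : H →* G)
    (hφ : Function.Injective φ) {ι : Type*} [Fintype ι] (ψ : ι → G →* ℤˣ)
    (hψ : ∀ g, g ∈ φ.range ↔ ∀ i, ψ i g = 1) {U f : G → ℝ} (hf : f ∈ posCone G)
    (hU : U ∈ posCone G) : ev U f ≤ ev (U ∘ φ) (f ∘ φ) := by
  classical
  -- Each factor `(1 + ψ i) / 2` is the indicator of `ψ i = 1`. The product is the indicator of the
  -- subgroup, and it lies in the cone.
  set F : G → ℝ := ∏ i, ((1 / 2 : ℝ) • (1 + charVal (ψ i))) with hF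
  have hFval : ∀ g, F g = if g ∈ φ.range then 1 else 0 := by
    intro g
    rw [hF, Finset.prod_apply]
    split_ifs with h
    · refine Finset.prod_eq_one fun i _ => ?_
      simp [charVal, (hψ g).1 h i]; norm_num
    · rw [hψ] at h
      push Not at h
      obtain ⟨i, hi⟩ := h
      refine Finset.prod_eq_zero (Finset.mem_univ i) ?_
      simp [charVal, (Int.units_eq_one_or (ψ i g)).resolve_left hi]
  have hsum : ∀ k : G → ℝ, ∑ g, F g * k g = ∑ h, k (φ h) := by
    intro k
    simp only [hFval, ite_mul, one_mul, zero_mul, ← Finset.sum_filter]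
    symm
    refine Finset.sum_bij (fun h _ => φ h) (by simp) (fun a _ b _ h => hφ h) ?_ (by simp)
    intro g hg
    obtain ⟨h, rfl⟩ := (Finset.mem_filter.1 hg).2
    exact ⟨h, by simp, rfl⟩
  have hFc : F ∈ posCone G := prod_mem_posCone _ fun i _ =>
    smul_mem_posCone (by norm_num) (add_mem one_mem_posCone (charVal_mem _))
  refine (ev_le_div hf hFc hU ?_).trans_eq ?_
  · rw [hsum fun g => Real.exp (U g)]; exact sum_exp_pos (U ∘ φ)
  · have : ∑ g, f g * F g * Real.exp (U g) = ∑ g, F g * (f g * Real.exp (U g)) :=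
      Finset.sum_congr rfl fun g _ => by ring
    rw [this, hsum, hsum fun g => Real.exp (U g)]
    rfl

end Griffiths

/-! ### Currents on finite vertex sets -/

section BondChar

variable {V W : Type*}

/-- The product of the two spins at the ends of a bond, as a character of the spin group. -/
def bondChar (b : Bond V) : (V → ℤˣ) →* ℤˣ where
  toFun σ := (b.1.map σ).mul
  map_one' := by
    obtain ⟨e, he⟩ := b
    induction e with | h x y => simp
  map_mul' σ τ := by
    obtain ⟨e, he⟩ := b
    induction e with | h x y => simp [mul_mul_mul_comm]

theorem bondChar_mk (x y : V) (h : ¬ s(x, y).IsDiag) (σ : V → ℤˣ) :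
    bondChar ⟨s(x, y), h⟩ σ = σ x * σ y := rfl

theorem bondChar_map (f : V ↪ W) (b : Bond V) (σ : W → ℤˣ) :
    bondChar (b.map f) σ = bondChar b (σ ∘ f) := by
  obtain ⟨e, he⟩ := b
  induction e with | h x y => rfl

theorem Bond.map_injective (f : V ↪ W) : Function.Injective (Bond.map f) := by
  intro a b h
  exact Subtype.ext (Sym2.map.injective f.injective (congrArg Subtype.val h))

theorem bondChar_congr (b : Bond V) {σ τ : V → ℤˣ} (h : ∀ x ∈ b.1, σ x = τ x) :
    bondChar b σ = bondChar b τ := by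
  obtain ⟨e, he⟩ := b
  induction e with | h x y =>
  rw [bondChar_mk, bondChar_mk, h x (by simp), h y (by simp)]

theorem bondChar_mulSingle [DecidableEq V] (b : Bond V) (x : V) (u : ℤˣ) :
    bondChar b (Pi.mulSingle x u) = if x ∈ b.1 then u else 1 := by
  obtain ⟨e, he⟩ := b
  induction e with | h y z =>
  rw [bondChar_mk]
  have hyz : y ≠ z := by simpa using he
  by_cases hy : x = y
  · subst hy
    simp [hyz.symm]
  · by_cases hz : x = z
    · subst hz
      simp [hyz]
    · simp [hy, hz, Ne.symm hy, Ne.symm hz]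

end BondChar

/-! ### Sourceless currents as spin sums -/

section FiniteVolume

variable {V : Type*} [Fintype V] [DecidableEq V]

/-- Minus `β` times the Hamiltonian. -/
def energy (J : Sym2 V → ℝ) (β : ℝ) (σ : V → ℤˣ) : ℝ :=
  ∑ b : Bond V, β * J b.1 * charVal (bondChar b) σ

theorem neg_mul_hamiltonian (J : Sym2 V → ℝ) (β : ℝ) (σ : V → ℤˣ) :
    -β * hamiltonian J σ = energy J β σ := by
  rw [hamiltonian, neg_mul_neg, energy, Finset.mul_sum]
  refine Finset.sum_congr rfl fun b _ => ?_
  rw [mul_assoc]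
  rfl

theorem gibbs_eq_ev (J : Sym2 V → ℝ) (β : ℝ) (f : (V → ℤˣ) → ℝ) :
    gibbs J β f = ev (energy J β) f := by
  simp only [gibbs, ev, neg_mul_hamiltonian]

theorem energy_mem_posCone {J : Sym2 V → ℝ} {β : ℝ} (hJ : ∀ b : Bond V, 0 ≤ J b.1)
    (hβ : 0 ≤ β) : energy J β ∈ posCone (V → ℤˣ) := by
  have : energy J β = ∑ b : Bond V, (β * J b.1) • charVal (bondChar b) := by
    ext σ; simp [energy]
  rw [this]
  exact sum_mem fun b _ => smul_charVal_mem (mul_nonneg hβ (hJ b)) _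

/-- The character `σ ↦ ∏_b σ_b^{n_b}` of a current. -/
def fluxChar (n : Current V) : (V → ℤˣ) →* ℤˣ := ∏ b, bondChar b ^ n b

theorem charVal_fluxChar (n : Current V) (σ : V → ℤˣ) :
    charVal (fluxChar n) σ = ∏ b, charVal (bondChar b) σ ^ n b := by
  simp [charVal, fluxChar]

theorem fluxChar_mulSingle (n : Current V) (x : V) (u : ℤˣ) :
    fluxChar n (Pi.mulSingle x u) = u ^ (∑ b : Bond V with x ∈ b.1, n b) := by
  simp only [fluxChar, MonoidHom.finsetProd_apply, MonoidHom.pow_apply, bondChar_mulSingle,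
    ite_pow, one_pow, ← Finset.prod_filter]
  rw [Finset.prod_pow_eq_pow_sum]

/-- A character of the spin group is determined by its values at single spin flips, and at the flip
of `x` the value is `-1` to the power of the flux through `x`. -/
theorem fluxChar_eq_one_iff (n : Current V) : fluxChar n = 1 ↔ sources n = ∅ := by
  constructor
  · intro h
    refine Set.eq_empty_iff_forall_notMem.2 fun x hx => ?_
    have := fluxChar_mulSingle n x (-1)
    rw [h, MonoidHom.one_apply, Odd.neg_one_pow hx] at this
    exact absurd this (by decide)
  · intro h
    apply MonoidHom.pi_ext
    intro x u
    have hx : ¬ Odd (∑ b : Bond V with x ∈ b.1, n b) := fun hx => by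
      have : x ∈ sources n := hx
      simp [h] at this
    rw [fluxChar_mulSingle, MonoidHom.one_apply]
    obtain ⟨k, hk⟩ := Nat.not_odd_iff_even.1 hx
    rw [hk, ← two_mul, pow_mul, Int.units_sq, one_pow]

/-- Orthogonality of characters: averaging `fluxChar n` over the spins leaves the indicator of `∂n =
∅`. The parity constraint is traded for a spin sum whose terms factorise over bonds. -/
theorem sourcelessWeight_eq (J : Sym2 V → ℝ) (β : ℝ) (n : Current V) :
    sourcelessWeight J β n = (Fintype.card (V → ℤˣ) : ℝ)⁻¹ * ∑ σ : V → ℤˣ,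
      ∏ b : Bond V, (β * J b.1 * charVal (bondChar b) σ) ^ n b / (n b).factorial := by
  have h : ∀ σ : V → ℤˣ, ∏ b : Bond V,
      (β * J b.1 * charVal (bondChar b) σ) ^ n b / ((n b).factorial : ℝ) =
      weight J β n * charVal (fluxChar n) σ := by
    intro σ
    rw [charVal_fluxChar, weight, ← Finset.prod_mul_distrib]
    refine Finset.prod_congr rfl fun b _ => ?_
    rw [mul_pow]; ring
  simp only [h, ← Finset.mul_sum, sourcelessWeight, ← fluxChar_eq_one_iff]
  have hc : (Fintype.card (V → ℤˣ) : ℝ) ≠ 0 := by positivity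
  split_ifs with h1
  · rw [h1, sum_charVal_one]; field_simp
  · rw [sum_charVal_eq_zero h1]; simp

theorem sourcelessWeight_nonneg {J : Sym2 V → ℝ} {β : ℝ} (hJ : ∀ b : Bond V, 0 ≤ J b.1)
    (hβ : 0 ≤ β) (n : Current V) : 0 ≤ sourcelessWeight J β n := by
  unfold sourcelessWeight
  split_ifs
  · exact Finset.prod_nonneg fun b _ =>
      div_nonneg (pow_nonneg (mul_nonneg hβ (hJ b)) _) (by positivity)
  · exact le_rfl

/-- Fubini for the counting measure on `ι → ℕ`, which is the product of the counting measures on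
`ℕ`. -/
theorem hasSum_prod_pi {ι : Type*} [Fintype ι] (f : ι → ℕ → ℝ) (hf : ∀ i, Summable (f i)) :
    HasSum (fun n : ι → ℕ => ∏ i, f i (n i)) (∏ i, ∑' k, f i k) := by
  have hpi : Measure.pi (fun _ : ι => (Measure.count : Measure ℕ)) = Measure.count := by
    refine Measure.ext_of_singleton fun n => ?_
    rw [Measure.pi_singleton]
    simp
  have hint : ∀ i, Integrable (f i) Measure.count := fun i =>
    integrable_count_iff.2 (hf i).norm
  have h1 := Integrable.fintype_prod (μ := fun _ : ι => (Measure.count : Measure ℕ)) hint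
  have h2 := integral_fintype_prod_eq_prod (𝕜 := ℝ) f
    (μ := fun _ : ι => (Measure.count : Measure ℕ))
  rw [hpi] at h1 h2
  rw [integral_countable h1] at h2
  have h3 : ∀ i, ∫ x, f i x ∂Measure.count = ∑' k, f i k := fun i => by
    rw [integral_countable (hint i)]; simp [measureReal_def]
  simp only [h3, measureReal_def, Measure.count_singleton, ENNReal.toReal_one, one_smul] at h2
  rw [← h2]
  exact (integrable_count_iff.1 h1).of_norm.hasSum

/-- The local weight of the current values `k` on a bond with coupling `x`. -/
def localWeight (x : ℝ) (k : ℕ) : ℝ := x ^ k / k.factorial * Real.exp (-x)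

/-- For fixed spins the bonds decouple. A free bond sums to the exponential of its energy and a
prescribed one gives a single term; the factor `exp (-x)` in `localWeight` compensates for writing
the full Gibbs weight. -/
theorem hasSum_sourcelessWeight_marginal (J : Sym2 V → ℝ) (β : ℝ) {I : Type*} [Fintype I]
    {j : I → Bond V} (hj : Function.Injective j) (k : I → ℕ) :
    HasSum ({n : Current V | ∀ i, n (j i) = k i}.indicator (sourcelessWeight J β))
      ((Fintype.card (V → ℤˣ) : ℝ)⁻¹ * ∑ σ : V → ℤˣ,
        (∏ i, localWeight (β * J (j i).1 * charVal (bondChar (j i)) σ) (k i)) *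
          Real.exp (energy J β σ)) := by
  classical
  set g : (V → ℤˣ) → Bond V → ℕ → ℝ := fun σ b m =>
    if ∃ i, j i = b ∧ m ≠ k i then 0
    else (β * J b.1 * charVal (bondChar b) σ) ^ m / m.factorial with hg
  have hgs : ∀ σ b, Summable (g σ b) := by
    intro σ b
    refine Summable.of_norm_bounded
      (Real.summable_pow_div_factorial (β * J b.1 * charVal (bondChar b) σ)).norm fun m => ?_
    simp only [hg]
    split_ifs
    · rw [norm_zero]; exact norm_nonneg _
    · exact le_rfl
  have h1 : ∀ σ, ∏ b, ∑' m, g σ b m =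
      (∏ i, localWeight (β * J (j i).1 * charVal (bondChar (j i)) σ) (k i)) *
        Real.exp (energy J β σ) := by
    intro σ
    have hexp : ∀ b, ∑' m, g σ b m = (∑' m, g σ b m) *
        Real.exp (-(β * J b.1 * charVal (bondChar b) σ)) *
        Real.exp (β * J b.1 * charVal (bondChar b) σ) := fun b => by
      rw [mul_assoc, ← Real.exp_add, neg_add_cancel, Real.exp_zero, mul_one]
    rw [Finset.prod_congr rfl fun b _ => hexp b, Finset.prod_mul_distrib, ← Real.exp_sum]
    congr 1
    symm
    refine Fintype.prod_of_injective j hj _ _ (fun b hb => ?_) fun i => ?_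
    · have : g σ b = fun m => (β * J b.1 * charVal (bondChar b) σ) ^ m / (m.factorial : ℝ) := by
        ext m
        simp only [hg]
        rw [if_neg]
        rintro ⟨i, rfl, -⟩
        exact hb ⟨i, rfl⟩
      rw [this, ← congrFun NormedSpace.exp_eq_tsum_div, ← congrFun Real.exp_eq_exp_ℝ,
        ← Real.exp_add, add_neg_cancel, Real.exp_zero]
    · rw [localWeight]
      congr 1
      rw [tsum_eq_single (k i)]
      · simp only [hg]
        rw [if_neg]
        rintro ⟨i', hi', h⟩
        exact h (by rw [hj hi'])
      · intro m hm
        simp only [hg]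
        rw [if_pos ⟨i, rfl, hm⟩]
  have h2 := (hasSum_sum (s := Finset.univ) fun (σ : V → ℤˣ) _ =>
    hasSum_prod_pi (g σ) (hgs σ)).mul_left (Fintype.card (V → ℤˣ) : ℝ)⁻¹
  simp only [h1] at h2
  have h3 : ∀ n, (Fintype.card (V → ℤˣ) : ℝ)⁻¹ * ∑ σ : V → ℤˣ, ∏ b, g σ b (n b) =
      {n : Current V | ∀ i, n (j i) = k i}.indicator (sourcelessWeight J β) n := fun n => ?_
  · exact (funext h3 : _ = _) ▸ h2
  by_cases hn : ∀ i, n (j i) = k i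
  · rw [Set.indicator_of_mem (by exact hn), sourcelessWeight_eq]
    congr 1
    refine Finset.sum_congr rfl fun σ _ => Finset.prod_congr rfl fun b _ => ?_
    simp only [hg]
    rw [if_neg]
    rintro ⟨i, rfl, h⟩
    exact h (hn i)
  · rw [Set.indicator_of_notMem (by exact hn)]
    push Not at hn
    obtain ⟨i, hi⟩ := hn
    rw [Finset.sum_eq_zero, mul_zero]
    intro σ _
    refine Finset.prod_eq_zero (Finset.mem_univ (j i)) ?_
    simp only [hg]
    rw [if_pos ⟨i, rfl, hi⟩]

theorem hasSum_sourcelessWeight (J : Sym2 V → ℝ) (β : ℝ) :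
    HasSum (sourcelessWeight J β)
      ((Fintype.card (V → ℤˣ) : ℝ)⁻¹ * ∑ σ : V → ℤˣ, Real.exp (energy J β σ)) := by
  simpa using! hasSum_sourcelessWeight_marginal J β (I := Empty) (j := Empty.elim)
    (Function.injective_of_subsingleton _) Empty.elim

theorem currentLaw_apply {J : Sym2 V → ℝ} {β : ℝ} (hJ : ∀ b : Bond V, 0 ≤ J b.1) (hβ : 0 ≤ β)
    {S : Set (Current V)} {a : ℝ} (ha : HasSum (S.indicator (sourcelessWeight J β)) a) :
    currentLaw J β S = ENNReal.ofReal (a / ∑' m, sourcelessWeight J β m) := by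
  have hZ : 0 ≤ ∑' m, sourcelessWeight J β m := tsum_nonneg (sourcelessWeight_nonneg hJ hβ)
  have h0 : ∀ n, 0 ≤ S.indicator (sourcelessWeight J β) n := fun n =>
    Set.indicator_nonneg (fun n _ => sourcelessWeight_nonneg hJ hβ n) n
  have hS : MeasurableSet S := S.to_countable.measurableSet
  rw [currentLaw, Measure.sum_apply _ hS, ← (ha.div_const _).tsum_eq,
    ENNReal.ofReal_tsum_of_nonneg (fun n => div_nonneg (h0 n) hZ) (ha.div_const _).summable]
  refine tsum_congr fun n => ?_
  rw [Measure.smul_apply, Measure.dirac_apply' _ hS, smul_eq_mul]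
  by_cases hn : n ∈ S <;> simp [hn]

theorem tsum_sourcelessWeight (J : Sym2 V → ℝ) (β : ℝ) : ∑' n, sourcelessWeight J β n =
    (Fintype.card (V → ℤˣ) : ℝ)⁻¹ * ∑ σ : V → ℤˣ, Real.exp (energy J β σ) :=
  (hasSum_sourcelessWeight J β).tsum_eq

theorem isProbabilityMeasure_currentLaw {J : Sym2 V → ℝ} {β : ℝ} (hJ : ∀ b : Bond V, 0 ≤ J b.1)
    (hβ : 0 ≤ β) : IsProbabilityMeasure (currentLaw J β) := by
  refine ⟨?_⟩
  rw [currentLaw_apply hJ hβ (S := Set.univ) (by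
    simpa only [Set.indicator_univ] using hasSum_sourcelessWeight J β), tsum_sourcelessWeight,
    div_self, ENNReal.ofReal_one]
  have := sum_exp_pos (energy J β)
  positivity

/-- The finite-dimensional distributions of the random current are Gibbs expectations. -/
theorem currentLaw_marginal {J : Sym2 V → ℝ} {β : ℝ} (hJ : ∀ b : Bond V, 0 ≤ J b.1) (hβ : 0 ≤ β)
    {I : Type*} [Fintype I] {j : I → Bond V} (hj : Function.Injective j) (k : I → ℕ) :
    (currentLaw J β).real {n | ∀ i, n (j i) = k i} = ev (energy J β) fun σ =>
      ∏ i, localWeight (β * J (j i).1 * charVal (bondChar (j i)) σ) (k i) := by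
  have h := hasSum_sourcelessWeight_marginal J β hj k
  rw [measureReal_def, currentLaw_apply hJ hβ h, ENNReal.toReal_ofReal, tsum_sourcelessWeight,
    mul_div_mul_left]
  · rfl
  · positivity
  · refine div_nonneg (h.nonneg fun n => ?_) (tsum_nonneg (sourcelessWeight_nonneg hJ hβ))
    exact Set.indicator_nonneg (fun n _ => sourcelessWeight_nonneg hJ hβ n) n

end FiniteVolume

/-! ### Comparison of volumes -/

section Pull

variable {V W : Type*}

/-- The restriction of spin configurations along a map of vertex sets. -/
def pullSpins (f : V → W) : (W → ℤˣ) →* (V → ℤˣ) where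
  toFun σ := σ ∘ f
  map_one' := rfl
  map_mul' _ _ := rfl

theorem pullSpins_surjective (f : V ↪ W) : Function.Surjective (pullSpins f) := fun σ =>
  ⟨Function.extend f σ 1, funext fun x => f.injective.extend_apply σ 1 x⟩

end Pull

/-! ### Energies under embeddings of vertex sets -/

section Embedding

variable {V W : Type*} [Fintype V] [DecidableEq V] [Fintype W] [DecidableEq W]

/-- The bonds not coming from `V` are kept apart as an explicit combination of characters; in the
ferromagnetic case it lies in the cone, so a larger volume only adds to the couplings. -/
theorem energy_embedding (f : V ↪ W) (J : Sym2 W → ℝ) (β : ℝ) :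
    energy J β = energy (fun e => J (e.map f)) β ∘ pullSpins f +
      ∑ b ∈ (Finset.univ.map ⟨Bond.map f, Bond.map_injective f⟩)ᶜ,
        (β * J b.1) • charVal (bondChar b) := by
  ext σ
  rw [energy, ← Finset.sum_add_sum_compl (Finset.univ.map ⟨Bond.map f, Bond.map_injective f⟩),
    Finset.sum_map]
  simp only [Pi.add_apply, Finset.sum_apply, Pi.smul_apply, smul_eq_mul, Function.comp_apply,
    energy]
  congr 1
  refine Finset.sum_congr rfl fun b _ => ?_
  simp only [Function.Embedding.coeFn_mk, charVal, bondChar_map]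
  rfl

theorem energy_equiv (f : V ≃ W) (J : Sym2 W → ℝ) (β : ℝ) :
    energy J β = energy (fun e => J (e.map f)) β ∘ pullSpins f := by
  have := energy_embedding f.toEmbedding J β
  rw [Finset.sum_eq_zero, add_zero] at this
  · exact this
  · intro b hb
    refine absurd ?_ (Finset.mem_compl.1 hb)
    refine Finset.mem_map.2 ⟨Bond.map f.symm.toEmbedding b, Finset.mem_univ _, Subtype.ext ?_⟩
    obtain ⟨e, he⟩ := b
    induction e with | h x y => simp [Bond.map]

theorem two_mul_sum_bond (g : Sym2 V → ℝ) :
    2 * ∑ b : Bond V, g b.1 = ∑ x, ∑ y, if x ≠ y then g s(x, y) else 0 := by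
  have h1 : ∑ b : Bond V, g b.1 = ∑ e : Sym2 V with ¬ e.IsDiag, g e :=
    (Finset.sum_subtype _ (by simp) g).symm
  have h2 : ∑ x, ∑ y, (if x ≠ y then g s(x, y) else 0) =
      ∑ p ∈ (Finset.univ : Finset V).offDiag, g (Sym2.mk.uncurry p) := by
    rw [← Finset.sum_product', ← Finset.sum_filter]
    refine Finset.sum_congr ?_ fun _ _ => rfl
    ext ⟨x, y⟩; simp
  rw [h1, h2, ← Finset.sum_fiberwise_of_maps_to (g := Sym2.mk.uncurry)
    (t := Finset.univ.filter fun e : Sym2 V => ¬ e.IsDiag), Finset.mul_sum]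
  · refine Finset.sum_congr rfl fun e he => ?_
    induction e with | h a b =>
    have hab : a ≠ b := by simpa using he
    have : {z ∈ (Finset.univ : Finset V).offDiag | Sym2.mk.uncurry z = s(a, b)} =
        {(a, b), (b, a)} := by
      ext ⟨x, y⟩
      simp
      grind
    rw [this, Finset.sum_pair (by simp [hab])]
    simp [Function.uncurry, Sym2.eq_swap, two_mul]
  · rintro ⟨x, y⟩ h
    simpa using h

end Embedding

/-! ### Monotonicity of free and plus correlations in the volume -/

section Volumes

variable {d : ℕ}

/-- Extension of a spin configuration by `1`. -/
def extFree (Λ : Finset (Site d)) : (Λ → ℤˣ) →* (Site d → ℤˣ) where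
  toFun σ x := if h : x ∈ Λ then σ ⟨x, h⟩ else 1
  map_one' := by ext x; simp
  map_mul' σ τ := by
    ext x
    by_cases h : x ∈ Λ <;> simp [h]

/-- Extension of a spin configuration by the ghost spin. -/
def extPlus (Λ : Finset (Site d)) : (Option Λ → ℤˣ) →* (Site d → ℤˣ) where
  toFun σ x := if h : x ∈ Λ then σ (some ⟨x, h⟩) else σ none
  map_one' := by ext x; simp
  map_mul' σ τ := by
    ext x
    by_cases h : x ∈ Λ <;> simp [h]

theorem extFree_apply_of_mem {Λ : Finset (Site d)} {x : Site d} (h : x ∈ Λ) (σ : Λ → ℤˣ) :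
    extFree Λ σ x = σ ⟨x, h⟩ := dif_pos h

theorem extPlus_apply_of_mem {Λ : Finset (Site d)} {x : Site d} (h : x ∈ Λ)
    (σ : Option Λ → ℤˣ) : extPlus Λ σ x = σ (some ⟨x, h⟩) := dif_pos h

theorem extPlus_apply_of_notMem {Λ : Finset (Site d)} {x : Site d} (h : x ∉ Λ)
    (σ : Option Λ → ℤˣ) : extPlus Λ σ x = σ none := dif_neg h

/-- Finite-volume expectation with free boundary conditions of a function of infinite
spin configurations. -/
def freeEv (J : Sym2 (Site d) → ℝ) (β : ℝ) (Λ : Finset (Site d)) (f : (Site d → ℤˣ) → ℝ) : ℝ :=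
  ev (energy (freeCoupling J Λ) β) (f ∘ extFree Λ)

/-- Finite-volume expectation with plus boundary conditions (up to a global flip). -/
def plusEv (J : Sym2 (Site d) → ℝ) (β : ℝ) (Λ : Finset (Site d)) (f : (Site d → ℤˣ) → ℝ) : ℝ :=
  ev (energy (plusCoupling J Λ) β) (f ∘ extPlus Λ)

/-- The character `χ` depends on the spins in `A` only. -/
def IsLocalChar (A : Finset (Site d)) (χ : (Site d → ℤˣ) →* ℤˣ) : Prop :=
  ∀ s s' : Site d → ℤˣ, (∀ x ∈ A, s x = s' x) → χ s = χ s'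

variable {J : Sym2 (Site d) → ℝ} {β : ℝ}

theorem freeCoupling_nonneg (hJ : ∀ x y : Site d, 0 ≤ J s(x, y)) (Λ : Finset (Site d))
    (e : Sym2 Λ) : 0 ≤ freeCoupling J Λ e := by
  induction e with | h x y => exact hJ _ _

theorem plusCoupling_nonneg (hJ : ∀ x y : Site d, 0 ≤ J s(x, y)) (Λ : Finset (Site d))
    (e : Sym2 (Option Λ)) : 0 ≤ plusCoupling J Λ e := by
  induction e with | h x y =>
  rcases x with _ | x <;> rcases y with _ | y
  · exact le_rfl
  · exact tsum_nonneg fun _ => hJ _ _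
  · exact tsum_nonneg fun _ => hJ _ _
  · exact hJ _ _

theorem charVal_comp_mem_posCone {G H : Type*} [CommGroup G] [CommGroup H] (χ : G →* ℤˣ)
    (φ : H →* G) : charVal χ ∘ φ ∈ posCone H := charVal_mem (χ.comp φ)

theorem freeEv_nonneg (hJ : ∀ x y : Site d, 0 ≤ J s(x, y)) (hβ : 0 ≤ β) (Λ : Finset (Site d))
    (χ : (Site d → ℤˣ) →* ℤˣ) : 0 ≤ freeEv J β Λ (charVal χ) :=
  ev_nonneg (charVal_comp_mem_posCone _ _)
    (energy_mem_posCone (fun b => freeCoupling_nonneg hJ Λ b.1) hβ)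

theorem plusEv_nonneg (hJ : ∀ x y : Site d, 0 ≤ J s(x, y)) (hβ : 0 ≤ β) (Λ : Finset (Site d))
    (χ : (Site d → ℤˣ) →* ℤˣ) : 0 ≤ plusEv J β Λ (charVal χ) :=
  ev_nonneg (charVal_comp_mem_posCone _ _)
    (energy_mem_posCone (fun b => plusCoupling_nonneg hJ Λ b.1) hβ)

theorem freeEv_le_one (Λ : Finset (Site d)) (χ : (Site d → ℤˣ) →* ℤˣ) :
    freeEv J β Λ (charVal χ) ≤ 1 := ev_charVal_le_one _ (χ.comp (extFree Λ))

theorem plusEv_le_one (Λ : Finset (Site d)) (χ : (Site d → ℤˣ) →* ℤˣ) :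
    plusEv J β Λ (charVal χ) ≤ 1 := ev_charVal_le_one _ (χ.comp (extPlus Λ))

/-- Free correlations are increasing in the volume. -/
theorem freeEv_mono (hJ : ∀ x y : Site d, 0 ≤ J s(x, y)) (hβ : 0 ≤ β) {Λ Λ' : Finset (Site d)}
    (h : Λ ⊆ Λ') {χ : (Site d → ℤˣ) →* ℤˣ} (hχ : IsLocalChar Λ χ) :
    freeEv J β Λ (charVal χ) ≤ freeEv J β Λ' (charVal χ) := by
  let f : Λ ↪ Λ' := ⟨Set.inclusion h, Set.inclusion_injective h⟩
  have hc : (fun e => freeCoupling J Λ' (e.map f)) = freeCoupling J Λ := by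
    ext e
    simp only [freeCoupling, Sym2.map_map]
    rfl
  have hχ' : charVal χ ∘ extFree Λ' = (charVal χ ∘ extFree Λ) ∘ pullSpins f := by
    ext σ
    simp only [Function.comp_apply, charVal]
    -- On `Λ' \ Λ` one extension is `1` while the other carries spins of `Λ'`; only a character that
    -- depends on `Λ` alone cannot tell them apart.
    rw [hχ (extFree Λ' σ) (extFree Λ (pullSpins f σ)) fun x hx => ?_]
    rw [extFree_apply_of_mem (h hx), extFree_apply_of_mem hx]
    rfl
  rw [freeEv, freeEv, ← ev_comp_of_surjective (pullSpins f) (pullSpins_surjective f), hχ',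
    energy_embedding f (freeCoupling J Λ'), hc]
  refine ev_le_ev_add (comp_mem_posCone _ (charVal_comp_mem_posCone _ _)) (comp_mem_posCone _
    (energy_mem_posCone (fun b => freeCoupling_nonneg hJ Λ b.1) hβ)) ?_
  exact sum_mem fun b _ => smul_charVal_mem (mul_nonneg hβ (freeCoupling_nonneg hJ Λ' b.1)) _

/-- Sums over ordered pairs of lattice sites split easily along `Λ ⊆ Λ'`. The factor `2` comes from
counting every bond, ghost bonds included, in both orders. -/
theorem two_mul_energy_plusCoupling (Λ : Finset (Site d)) (σ : Option Λ → ℤˣ) :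
    2 * energy (plusCoupling J Λ) β σ =
      (∑ x ∈ Λ, ∑ y ∈ Λ, if x ≠ y then
        β * J s(x, y) * (((extPlus Λ σ x : ℤˣ) : ℤ) * ((extPlus Λ σ y : ℤˣ) : ℤ)) else 0) +
      2 * ∑ x ∈ Λ, β * (∑' y : {y : Site d // y ∉ Λ}, J s(x, y.1)) *
        (((extPlus Λ σ x : ℤˣ) : ℤ) * ((σ none : ℤˣ) : ℤ)) := by
  have h := two_mul_sum_bond fun e : Sym2 (Option Λ) =>
    β * plusCoupling J Λ e * (((e.map σ).mul : ℤˣ) : ℤ)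
  have h' : ∑ b : Bond (Option Λ), β * plusCoupling J Λ b.1 * (((b.1.map σ).mul : ℤˣ) : ℤ) =
    energy (plusCoupling J Λ) β σ := rfl
  rw [h'] at h
  rw [h, ← Finset.sum_coe_sort Λ, ← Finset.sum_coe_sort Λ]
  simp only [Fintype.sum_option, ne_eq, not_true_eq_false, if_false, zero_add, reduceCtorEq,
    not_false_eq_true, if_true, Option.some.injEq, Finset.sum_add_distrib]
  have e4 : ∀ x : Λ, extPlus Λ σ x = σ (some x) := fun x => extPlus_apply_of_mem x.2 σ
  have hN : ∑ x : Λ, β * plusCoupling J Λ s(none, some x) *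
      (((s(none, some x).map σ).mul : ℤˣ) : ℤ) = ∑ x : Λ,
      β * (∑' y : {y : Site d // y ∉ Λ}, J s(x.1, y.1)) *
        (((extPlus Λ σ x : ℤˣ) : ℤ) * ((σ none : ℤˣ) : ℤ)) := by
    refine Finset.sum_congr rfl fun x _ => ?_
    simp only [e4, Sym2.map_mk, Sym2.mul_mk, Units.val_mul, Int.cast_mul]
    rw [mul_comm (((σ none : ℤˣ) : ℤ) : ℝ)]
    rfl
  have hS : ∑ x : Λ, β * plusCoupling J Λ s(some x, none) *
      (((s(some x, none).map σ).mul : ℤˣ) : ℤ) = ∑ x : Λ,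
      β * (∑' y : {y : Site d // y ∉ Λ}, J s(x.1, y.1)) *
        (((extPlus Λ σ x : ℤˣ) : ℤ) * ((σ none : ℤˣ) : ℤ)) := by
    refine Finset.sum_congr rfl fun x _ => ?_
    simp only [e4, Sym2.map_mk, Sym2.mul_mk, Units.val_mul, Int.cast_mul]
    rfl
  have hC : ∀ x : Λ, (∑ y : Λ, if ¬ x = y then β * plusCoupling J Λ s(some x, some y) *
      (((s(some x, some y).map σ).mul : ℤˣ) : ℤ) else 0) = ∑ y ∈ Λ, if x.1 ≠ y then
        β * J s(x.1, y) * (((extPlus Λ σ x : ℤˣ) : ℤ) * ((extPlus Λ σ y : ℤˣ) : ℤ)) else 0 := by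
    intro x
    rw [← Finset.sum_coe_sort Λ]
    refine Finset.sum_congr rfl fun y _ => ?_
    simp only [e4, Sym2.map_mk, Sym2.mul_mk, Units.val_mul, Int.cast_mul, Subtype.ext_iff, ne_eq]
    rfl
  rw [hN, hS, Finset.sum_congr rfl fun x _ => hC x]
  ring

/-- Extension of a spin configuration on `Λ ∪ {δ}` to a larger volume by the ghost spin. -/
def enlargePlus (Λ Λ' : Finset (Site d)) : (Option Λ → ℤˣ) →* (Option Λ' → ℤˣ) where
  toFun σ
    | none => σ none
    | some x => extPlus Λ σ x
  map_one' := by ext (_ | x) <;> simp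
  map_mul' σ τ := by ext (_ | x) <;> simp

theorem extPlus_enlargePlus {Λ Λ' : Finset (Site d)} (h : Λ ⊆ Λ') (σ : Option Λ → ℤˣ) :
    extPlus Λ' (enlargePlus Λ Λ' σ) = extPlus Λ σ := by
  ext x
  by_cases hx : x ∈ Λ'
  · rw [extPlus_apply_of_mem hx]; rfl
  · rw [extPlus_apply_of_notMem hx, extPlus_apply_of_notMem fun h' => hx (h h')]; rfl

theorem enlargePlus_injective {Λ Λ' : Finset (Site d)} (h : Λ ⊆ Λ') :
    Function.Injective (enlargePlus Λ Λ') := by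
  intro σ τ hστ
  ext x
  rcases x with _ | x
  · exact congrArg Units.val (congrFun hστ none)
  · have := congrFun hστ (some ⟨x, h x.2⟩)
    change extPlus Λ σ x = extPlus Λ τ x at this
    rw [extPlus_apply_of_mem x.2, extPlus_apply_of_mem x.2] at this
    exact congrArg Units.val this

theorem mem_range_enlargePlus {Λ Λ' : Finset (Site d)} (h : Λ ⊆ Λ') (σ : Option Λ' → ℤˣ) :
    σ ∈ (enlargePlus Λ Λ').range ↔
      ∀ x : {x : Λ' // x.1 ∉ Λ}, σ (some x.1) * σ none = 1 := by
  constructor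
  · rintro ⟨τ, rfl⟩ ⟨x, hx⟩
    change extPlus Λ τ x * τ none = 1
    rw [extPlus_apply_of_notMem hx, Int.units_mul_self]
  · intro hσ
    set τ : Option Λ → ℤˣ := fun | none => σ none | some x => σ (some ⟨x, h x.2⟩) with hτ
    refine ⟨τ, ?_⟩
    ext x
    rcases x with _ | x
    · rfl
    · congr 1
      change extPlus Λ τ x = σ (some x)
      by_cases hx : x.1 ∈ Λ
      · exact extPlus_apply_of_mem hx _
      · refine (extPlus_apply_of_notMem hx _).trans ?_
        have := hσ ⟨x, hx⟩
        rw [mul_eq_one_iff_eq_inv, Int.units_inv_eq_self] at this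
        exact this.symm

/-- The spins of `D` are glued to the ghost. Bonds from `Λ` to `D` then act as ghost bonds and
complete the ghost couplings of `Λ'` to those of `Λ`; bonds inside `D`, or from `D` to the ghost,
are constant and make up `c`. -/
theorem energy_enlargePlus (hJ_symm : ∀ x : Site d, Summable fun y => J s(x, y))
    {Λ Λ' : Finset (Site d)} (h : Λ ⊆ Λ') :
    ∃ c : ℝ, ∀ σ, energy (plusCoupling J Λ') β (enlargePlus Λ Λ' σ) =
      energy (plusCoupling J Λ) β σ + c := by
  set D := Λ' \ Λ with hD
  refine ⟨((∑ x ∈ D, ∑ y ∈ D, if x ≠ y then β * J s(x, y) else 0) +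
    2 * ∑ x ∈ D, β * (∑' y : {y : Site d // y ∉ Λ'}, J s(x, y.1))) / 2, fun σ => ?_⟩
  have h1 := two_mul_energy_plusCoupling (J := J) (β := β) Λ' (enlargePlus Λ Λ' σ)
  have h2 := two_mul_energy_plusCoupling (J := J) (β := β) Λ σ
  rw [extPlus_enlargePlus h] at h1
  set s : Site d → ℝ := fun x => ((extPlus Λ σ x : ℤˣ) : ℤ) with hs
  have ht : ∀ x, x ∈ D → s x = ((σ none : ℤˣ) : ℤ) := fun x hx => by
    simp only [hs]
    rw [extPlus_apply_of_notMem (Finset.mem_sdiff.1 hx).2]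
  set t : ℝ := (((σ none : ℤˣ) : ℤ) : ℝ) with ht'
  change _ = (∑ x ∈ Λ', ∑ y ∈ Λ', if x ≠ y then β * J s(x, y) * (s x * s y) else 0) +
      2 * ∑ x ∈ Λ', β * (∑' y : {y : Site d // y ∉ Λ'}, J s(x, y.1)) * (s x * t) at h1
  change _ = (∑ x ∈ Λ, ∑ y ∈ Λ, if x ≠ y then β * J s(x, y) * (s x * s y) else 0) +
      2 * ∑ x ∈ Λ, β * (∑' y : {y : Site d // y ∉ Λ}, J s(x, y.1)) * (s x * t) at h2
  have htt : t * t = 1 := by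
    rcases Int.units_eq_one_or (σ none) with h' | h' <;> simp [ht', h']
  have hsum : ∀ x, (∑' y : {y : Site d // y ∉ Λ}, J s(x, y.1)) =
      ∑ y ∈ D, J s(x, y) + ∑' y : {y : Site d // y ∉ Λ'}, J s(x, y.1) := fun x => by
    have a1 : ∑ y ∈ Λ, J s(x, y) + (∑' y : {y : Site d // y ∉ Λ}, J s(x, y.1)) = _ :=
      (hJ_symm x).sum_add_tsum_compl (s := Λ)
    have a2 : ∑ y ∈ Λ', J s(x, y) + (∑' y : {y : Site d // y ∉ Λ'}, J s(x, y.1)) = _ :=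
      (hJ_symm x).sum_add_tsum_compl (s := Λ')
    rw [← Finset.sum_sdiff h, ← hD] at a2
    linarith
  have hDΛ : ∑ x ∈ D, ∑ y ∈ Λ, (if x ≠ y then β * J s(x, y) * (s x * s y) else 0) =
      ∑ x ∈ Λ, β * (∑ y ∈ D, J s(x, y)) * (s x * t) := by
    rw [Finset.sum_comm]
    refine Finset.sum_congr rfl fun x hx => ?_
    rw [Finset.mul_sum, Finset.sum_mul]
    refine Finset.sum_congr rfl fun y hy => ?_
    rw [if_pos (by rintro rfl; exact (Finset.mem_sdiff.1 hy).2 hx), ht y hy, Sym2.eq_swap]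
    ring
  have hΛD : ∑ x ∈ Λ, ∑ y ∈ D, (if x ≠ y then β * J s(x, y) * (s x * s y) else 0) =
      ∑ x ∈ Λ, β * (∑ y ∈ D, J s(x, y)) * (s x * t) := by
    refine Finset.sum_congr rfl fun x hx => ?_
    rw [Finset.mul_sum, Finset.sum_mul]
    refine Finset.sum_congr rfl fun y hy => ?_
    rw [if_pos (by rintro rfl; exact (Finset.mem_sdiff.1 hy).2 hx), ht y hy]
  have hDD : ∑ x ∈ D, ∑ y ∈ D, (if x ≠ y then β * J s(x, y) * (s x * s y) else 0) =
      ∑ x ∈ D, ∑ y ∈ D, if x ≠ y then β * J s(x, y) else 0 := by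
    refine Finset.sum_congr rfl fun x hx => Finset.sum_congr rfl fun y hy => ?_
    rw [ht x hx, ht y hy, htt, mul_one]
  have hD2 : ∑ x ∈ D, β * (∑' y : {y : Site d // y ∉ Λ'}, J s(x, y.1)) * (s x * t) =
      ∑ x ∈ D, β * (∑' y : {y : Site d // y ∉ Λ'}, J s(x, y.1)) := by
    refine Finset.sum_congr rfl fun x hx => ?_
    rw [ht x hx, htt, mul_one]
  simp only [← Finset.sum_sdiff h, ← hD, Finset.sum_add_distrib] at h1
  rw [hDΛ, hΛD, hDD, hD2] at h1
  simp only [hsum, mul_add, add_mul, Finset.sum_add_distrib] at h2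
  linarith

/-- Plus correlations are decreasing in the volume. -/
theorem plusEv_anti (hJ : ∀ x y : Site d, 0 ≤ J s(x, y))
    (hJs : ∀ x : Site d, Summable fun y => J s(x, y)) (hβ : 0 ≤ β) {Λ Λ' : Finset (Site d)}
    (h : Λ ⊆ Λ') (χ : (Site d → ℤˣ) →* ℤˣ) :
    plusEv J β Λ' (charVal χ) ≤ plusEv J β Λ (charVal χ) := by
  obtain ⟨c, hc⟩ := energy_enlargePlus (β := β) hJs h
  -- Configurations on `Λ'` whose spins off `Λ` equal the ghost spin form a subgroup, cut out by the
  -- characters `σ_x σ_δ`. Restricting to it produces the plus state of `Λ`.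
  have key := ev_le_ev_comp (enlargePlus Λ Λ') (enlargePlus_injective h)
    (fun x : {x : Λ' // x.1 ∉ Λ} =>
      Pi.evalMonoidHom (fun _ : Option Λ' => ℤˣ) (some x.1) * Pi.evalMonoidHom _ none)
    (fun σ => mem_range_enlargePlus h σ) (charVal_comp_mem_posCone χ (extPlus Λ'))
    (energy_mem_posCone (fun b => plusCoupling_nonneg hJ Λ' b.1) hβ)
  refine key.trans_eq ?_
  have e1 : energy (plusCoupling J Λ') β ∘ enlargePlus Λ Λ' =
      fun σ => energy (plusCoupling J Λ) β σ + c := funext hc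
  have e2 : (charVal χ ∘ extPlus Λ') ∘ enlargePlus Λ Λ' = charVal χ ∘ extPlus Λ := by
    ext σ
    simp only [Function.comp_apply, extPlus_enlargePlus h]
  rw [e1, e2, ev_add_const, plusEv]

end Volumes

/-! ### Infinite-volume limits of correlations -/

section Translation

variable {d : ℕ} {J : Sym2 (Site d) → ℝ} {β : ℝ}

/-- Translation of spin configurations by `z`. -/
def shiftSpins (z : Site d) : (Site d → ℤˣ) →* (Site d → ℤˣ) := pullSpins fun x => x - z

theorem shiftSpins_apply (z : Site d) (s : Site d → ℤˣ) (x : Site d) :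
    shiftSpins z s x = s (x - z) := rfl

/-- The translate of a finite volume. -/
def shiftVol (z : Site d) (Λ : Finset (Site d)) : Finset (Site d) :=
  Λ.map (Equiv.addRight z).toEmbedding

theorem mem_shiftVol {z : Site d} {Λ : Finset (Site d)} {x : Site d} :
    x ∈ shiftVol z Λ ↔ x - z ∈ Λ := by
  simp only [shiftVol, Finset.mem_map_equiv, Equiv.addRight_symm, Equiv.coe_addRight,
    sub_eq_add_neg]

theorem add_mem_shiftVol {z : Site d} {Λ : Finset (Site d)} {x : Site d} :
    x + z ∈ shiftVol z Λ ↔ x ∈ Λ := by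
  rw [mem_shiftVol, add_sub_cancel_right]

/-- Translation as a bijection from a volume to its translate. -/
def shiftEquiv (z : Site d) (Λ : Finset (Site d)) : Λ ≃ shiftVol z Λ where
  toFun x := ⟨x + z, add_mem_shiftVol.2 x.2⟩
  invFun x := ⟨x - z, mem_shiftVol.1 x.2⟩
  left_inv x := by simp
  right_inv x := by simp

theorem coupling_add (hJ : ∀ x y : Site d, J s(x, y) = J s(0, y - x)) (x y z : Site d) :
    J s(x + z, y + z) = J s(x, y) := by
  rw [hJ, hJ x y, add_sub_add_right_eq_sub]

theorem freeEv_shiftVol (hJ : ∀ x y : Site d, J s(x, y) = J s(0, y - x)) (z : Site d)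
    (Λ : Finset (Site d)) (f : (Site d → ℤˣ) → ℝ) :
    freeEv J β (shiftVol z Λ) f = freeEv J β Λ (f ∘ shiftSpins z) := by
  have hc : (fun e : Sym2 Λ => freeCoupling J (shiftVol z Λ) (e.map (shiftEquiv z Λ))) =
      freeCoupling J Λ := by
    ext e
    induction e with | h x y => exact coupling_add hJ x.1 y.1 z
  have hf : f ∘ extFree (shiftVol z Λ) =
      ((f ∘ shiftSpins z) ∘ extFree Λ) ∘ pullSpins (shiftEquiv z Λ) := by
    ext σ
    simp only [Function.comp_apply]
    congr 1
    ext x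
    rw [shiftSpins_apply]
    by_cases hx : x ∈ shiftVol z Λ
    · rw [extFree_apply_of_mem hx, extFree_apply_of_mem (mem_shiftVol.1 hx)]
      simp [pullSpins, shiftEquiv]
    · have hx' : x - z ∉ Λ := fun h => hx (mem_shiftVol.2 h)
      simp [extFree, hx, hx']
  rw [freeEv, freeEv, ← ev_comp_of_surjective (pullSpins (shiftEquiv z Λ))
    (pullSpins_surjective (shiftEquiv z Λ).toEmbedding), ← hf,
    energy_equiv (shiftEquiv z Λ) (freeCoupling J (shiftVol z Λ)), hc]

theorem plusEv_shiftVol (hJ : ∀ x y : Site d, J s(x, y) = J s(0, y - x)) (z : Site d)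
    (Λ : Finset (Site d)) (f : (Site d → ℤˣ) → ℝ) :
    plusEv J β (shiftVol z Λ) f = plusEv J β Λ (f ∘ shiftSpins z) := by
  set q := Equiv.optionCongr (shiftEquiv z Λ) with hq
  have ht : ∀ x : Λ, (∑' y : {y : Site d // y ∉ shiftVol z Λ}, J s(x.1 + z, y.1)) =
      ∑' y : {y : Site d // y ∉ Λ}, J s(x.1, y.1) := by
    intro x
    let r : {y : Site d // y ∉ Λ} ≃ {y : Site d // y ∉ shiftVol z Λ} :=
      (Equiv.addRight z).subtypeEquiv fun y => by
        rw [Equiv.coe_addRight, add_mem_shiftVol]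
    rw [← r.tsum_eq]
    exact tsum_congr fun y => coupling_add hJ _ _ _
  have hc : (fun e : Sym2 (Option Λ) => plusCoupling J (shiftVol z Λ) (e.map q)) =
      plusCoupling J Λ := by
    ext e
    induction e with | h x y =>
    rcases x with _ | x <;> rcases y with _ | y
    · rfl
    · exact ht y
    · exact ht x
    · exact coupling_add hJ x.1 y.1 z
  have hf : f ∘ extPlus (shiftVol z Λ) =
      ((f ∘ shiftSpins z) ∘ extPlus Λ) ∘ pullSpins q := by
    ext σ
    simp only [Function.comp_apply]
    congr 1
    ext x
    rw [shiftSpins_apply]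
    by_cases hx : x ∈ shiftVol z Λ
    · rw [extPlus_apply_of_mem hx, extPlus_apply_of_mem (mem_shiftVol.1 hx)]
      simp [pullSpins, shiftEquiv, hq]
    · have hx' : x - z ∉ Λ := fun h => hx (mem_shiftVol.2 h)
      simp [extPlus, hx, hx', pullSpins, hq]
  rw [plusEv, plusEv, ← ev_comp_of_surjective (pullSpins q)
    (pullSpins_surjective q.toEmbedding), ← hf,
    energy_equiv q (plusCoupling J (shiftVol z Λ)), hc]

end Translation

/-! ### Boxes and the algebra of local spin functions -/

section LocalFunctions

variable {d : ℕ}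

theorem mem_box {L : ℕ} {x : Site d} : x ∈ box d L ↔ ∀ i, |x i| ≤ L := by
  simp only [box, Finset.mem_Icc, Pi.le_def, abs_le, forall_and]

theorem box_mono {L M : ℕ} (h : L ≤ M) : box d L ⊆ box d M := fun x hx =>
  mem_box.2 fun i => (mem_box.1 hx i).trans (by exact_mod_cast h)

/-- The radius of the smallest centered box that contains a site. -/
def siteNorm (x : Site d) : ℕ := Finset.univ.sup fun i => (x i).natAbs

theorem abs_le_siteNorm (x : Site d) (i : Fin d) : |x i| ≤ siteNorm x := by
  rw [Int.abs_eq_natAbs]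
  exact_mod_cast Finset.le_sup (f := fun i => (x i).natAbs) (Finset.mem_univ i)

theorem mem_box_iff_siteNorm {L : ℕ} {x : Site d} : x ∈ box d L ↔ siteNorm x ≤ L := by
  rw [mem_box, siteNorm, Finset.sup_le_iff]
  refine ⟨fun h i _ => ?_, fun h i => ?_⟩
  · have := h i; rw [Int.abs_eq_natAbs] at this; exact_mod_cast this
  · have := h i (Finset.mem_univ i); rw [Int.abs_eq_natAbs]; exact_mod_cast this

theorem exists_subset_box (A : Finset (Site d)) : ∃ L, A ⊆ box d L :=
  ⟨A.sup siteNorm, fun _ hx => mem_box_iff_siteNorm.2 (Finset.le_sup hx)⟩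

theorem eventually_subset_box (A : Finset (Site d)) : ∀ᶠ L in atTop, A ⊆ box d L := by
  obtain ⟨L, hL⟩ := exists_subset_box A
  exact eventually_atTop.2 ⟨L, fun M hM => hL.trans (box_mono hM)⟩

theorem add_mem_box {L : ℕ} {x : Site d} (hx : x ∈ box d L) (z : Site d) :
    x + z ∈ box d (L + siteNorm z) := mem_box.2 fun i => by
  have h1 := mem_box.1 hx i
  have h2 := abs_le_siteNorm z i
  push_cast
  exact (abs_add_le _ _).trans (add_le_add h1 h2)

theorem sub_mem_box {L : ℕ} {x : Site d} (hx : x ∈ box d L) (z : Site d) :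
    x - z ∈ box d (L + siteNorm z) := mem_box.2 fun i => by
  have h1 := mem_box.1 hx i
  have h2 := abs_le_siteNorm z i
  push_cast
  exact (abs_sub _ _).trans (add_le_add h1 h2)

theorem shiftVol_box_subset (z : Site d) (L : ℕ) :
    shiftVol z (box d L) ⊆ box d (L + siteNorm z) := fun x hx => by
  simpa using add_mem_box (mem_shiftVol.1 hx) z

theorem box_subset_shiftVol (z : Site d) (L : ℕ) :
    box d L ⊆ shiftVol z (box d (L + siteNorm z)) := fun _ hx =>
  mem_shiftVol.2 (sub_mem_box hx z)

theorem IsLocalChar.mono {A B : Finset (Site d)} {χ : (Site d → ℤˣ) →* ℤˣ}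
    (h : IsLocalChar A χ) (hAB : A ⊆ B) : IsLocalChar B χ := fun s s' hs =>
  h s s' fun x hx => hs x (hAB hx)

theorem IsLocalChar.comp_shiftSpins {A : Finset (Site d)} {χ : (Site d → ℤˣ) →* ℤˣ}
    (h : IsLocalChar A χ) (z : Site d) :
    IsLocalChar (shiftVol (-z) A) (χ.comp (shiftSpins z)) := fun s s' hs =>
  h _ _ fun x hx => by
    rw [shiftSpins_apply, shiftSpins_apply]
    refine hs _ (mem_shiftVol.2 ?_)
    simpa using hx

variable (d) in
/-- The real-valued characters that depend on finitely many spins. -/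
def localChars : Submonoid ((Site d → ℤˣ) → ℝ) where
  carrier := {f | ∃ (A : Finset (Site d)) (χ : (Site d → ℤˣ) →* ℤˣ),
    IsLocalChar A χ ∧ f = charVal χ}
  one_mem' := ⟨∅, 1, fun _ _ _ => rfl, charVal_one.symm⟩
  mul_mem' := by
    classical
    rintro _ _ ⟨A, χ, hχ, rfl⟩ ⟨B, ψ, hψ, rfl⟩
    refine ⟨A ∪ B, χ * ψ, fun s s' h => ?_, (charVal_mul χ ψ).symm⟩
    rw [MonoidHom.mul_apply, MonoidHom.mul_apply, hχ s s' fun x hx => h x (by simp [hx]),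
      hψ s s' fun x hx => h x (by simp [hx])]

variable (d) in
/-- The algebra of the local functions of the spins. -/
def localAlg : Subalgebra ℝ ((Site d → ℤˣ) → ℝ) :=
  Algebra.adjoin ℝ (localChars d : Set ((Site d → ℤˣ) → ℝ))

theorem charVal_mem_localAlg {A : Finset (Site d)} {χ : (Site d → ℤˣ) →* ℤˣ}
    (hχ : IsLocalChar A χ) : charVal χ ∈ localAlg d :=
  Algebra.subset_adjoin ⟨A, χ, hχ, rfl⟩

-- No product case is needed: local characters form a monoid, so the algebra they generate is their
-- linear span.
@[elab_as_elim]
theorem localAlg_induction {p : ∀ f : (Site d → ℤˣ) → ℝ, f ∈ localAlg d → Prop}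
    (hchar : ∀ (A : Finset (Site d)) (χ : (Site d → ℤˣ) →* ℤˣ) (h : IsLocalChar A χ),
      p (charVal χ) (charVal_mem_localAlg h))
    (hzero : p 0 (zero_mem _))
    (hadd : ∀ f g hf hg, p f hf → p g hg → p (f + g) (add_mem hf hg))
    (hsmul : ∀ (c : ℝ) f hf, p f hf → p (c • f) (Subalgebra.smul_mem _ hf c))
    (f : (Site d → ℤˣ) → ℝ) (hf : f ∈ localAlg d) : p f hf := by
  have hf' := hf
  rw [localAlg, ← Subalgebra.mem_toSubmodule, Algebra.adjoin_eq_span, Submonoid.closure_eq] at hf'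
  have hle : ∀ f ∈ Submodule.span ℝ (localChars d : Set ((Site d → ℤˣ) → ℝ)), f ∈ localAlg d := by
    intro f hf
    rw [localAlg, ← Subalgebra.mem_toSubmodule, Algebra.adjoin_eq_span, Submonoid.closure_eq]
    exact hf
  induction hf' using Submodule.span_induction with
  | mem f hm => obtain ⟨A, χ, hχ, rfl⟩ := hm; exact hchar A χ hχ
  | zero => exact hzero
  | add f g hf' hg' ihf ihg => exact hadd f g (hle f hf') (hle g hg') (ihf _) (ihg _)
  | smul c f hf' ih => exact hsmul c f (hle f hf') (ih _)

theorem isLocalChar_bondChar (b : Bond (Site d)) :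
    IsLocalChar b.1.toFinset (bondChar b) := fun _ _ h =>
  bondChar_congr b fun x hx => h x (Sym2.mem_toFinset.2 hx)

/-- The local function whose expectation is the probability that a random current takes the
values `k` on `E`. -/
def marginalFun (J : Sym2 (Site d) → ℝ) (β : ℝ) (E : Finset (Bond (Site d))) (k : E → ℕ)
    (s : Site d → ℤˣ) : ℝ :=
  ∏ b : E, localWeight (β * J b.1.1 * charVal (bondChar b.1) s) (k b)

/-- Each factor is a power of a bond character times `exp (-c χ) = cosh (-c) + sinh (-c) χ`, hence a
polynomial in that character. -/
theorem marginalFun_mem_localAlg (J : Sym2 (Site d) → ℝ) (β : ℝ) (E : Finset (Bond (Site d)))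
    (k : E → ℕ) : marginalFun J β E k ∈ localAlg d := by
  have : marginalFun J β E k = ∏ b : E, fun s =>
      localWeight (β * J b.1.1 * charVal (bondChar b.1) s) (k b) := by
    ext s; simp [marginalFun]
  rw [this]
  refine prod_mem fun b _ => ?_
  set c := β * J b.1.1 with hc
  have : (fun s => localWeight (c * charVal (bondChar b.1) s) (k b)) =
      (c ^ k b / (k b).factorial) • (charVal (bondChar b.1) ^ k b *
        (Real.cosh (-c) • 1 + Real.sinh (-c) • charVal (bondChar b.1))) := by
    ext s
    simp only [localWeight, ← neg_mul, exp_mul_charVal, mul_pow, Pi.smul_apply, Pi.mul_apply,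
      Pi.pow_apply, Pi.add_apply, Pi.one_apply, smul_eq_mul]
    ring
  rw [this]
  have hm := charVal_mem_localAlg (isLocalChar_bondChar b.1)
  exact Subalgebra.smul_mem _ (mul_mem (pow_mem hm _) (add_mem
    (Subalgebra.smul_mem _ (one_mem _) _) (Subalgebra.smul_mem _ hm _))) _

end LocalFunctions

/-! ### Convergence along boxes and translation invariance -/

section Limits

variable {d : ℕ} {J : Sym2 (Site d) → ℝ} {β : ℝ}

theorem exists_tendsto_freeEv_charVal (hJ : ∀ x y : Site d, 0 ≤ J s(x, y)) (hβ : 0 ≤ β)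
    {A : Finset (Site d)} {χ : (Site d → ℤˣ) →* ℤˣ} (hχ : IsLocalChar A χ) :
    ∃ l, Tendsto (fun L : ℕ => freeEv J β (box d L) (charVal χ)) atTop (𝓝 l) := by
  obtain ⟨M, hM⟩ := exists_subset_box A
  have hmono : Monotone fun L : ℕ => freeEv J β (box d (L + M)) (charVal χ) := fun L L' h =>
    freeEv_mono hJ hβ (box_mono (by omega)) (hχ.mono (hM.trans (box_mono (by omega))))
  refine ⟨_, (tendsto_add_atTop_iff_nat M).1 (tendsto_atTop_ciSup hmono ⟨1, ?_⟩)⟩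
  rintro _ ⟨L, rfl⟩
  exact freeEv_le_one _ _

theorem exists_tendsto_plusEv_charVal (hJ : ∀ x y : Site d, 0 ≤ J s(x, y))
    (hJs : ∀ x : Site d, Summable fun y => J s(x, y)) (hβ : 0 ≤ β)
    (χ : (Site d → ℤˣ) →* ℤˣ) :
    ∃ l, Tendsto (fun L : ℕ => plusEv J β (box d L) (charVal χ)) atTop (𝓝 l) := by
  have hanti : Antitone fun L : ℕ => plusEv J β (box d L) (charVal χ) := fun L L' h =>
    plusEv_anti hJ hJs hβ (box_mono h) χ
  refine ⟨_, tendsto_atTop_ciInf hanti ⟨0, ?_⟩⟩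
  rintro _ ⟨L, rfl⟩
  exact plusEv_nonneg hJ hβ _ _

/-- Translating the observable amounts to translating the box. Centered and translated boxes contain
each other up to a change of radius by `siteNorm z`, so monotonicity in the volume squeezes the two
limits together. -/
theorem freeEv_charVal_shift_limit (hJt : ∀ x y : Site d, J s(x, y) = J s(0, y - x))
    (hJ : ∀ x y : Site d, 0 ≤ J s(x, y)) (hβ : 0 ≤ β)
    {A : Finset (Site d)} {χ : (Site d → ℤˣ) →* ℤˣ} (hχ : IsLocalChar A χ) (z : Site d) {l : ℝ}
    (hl : Tendsto (fun L : ℕ => freeEv J β (box d L) (charVal χ)) atTop (𝓝 l)) :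
    Tendsto (fun L : ℕ => freeEv J β (box d L) (charVal χ ∘ shiftSpins z)) atTop (𝓝 l) := by
  obtain ⟨l', hl'⟩ := exists_tendsto_freeEv_charVal (J := J) hJ hβ (hχ.comp_shiftSpins z)
  have hl'' : Tendsto (fun L : ℕ => freeEv J β (box d L) (charVal χ ∘ shiftSpins z)) atTop
    (𝓝 l') := hl'
  suffices l' = l from this ▸ hl''
  simp only [← freeEv_shiftVol hJt] at hl''
  apply le_antisymm
  · refine le_of_tendsto_of_tendsto hl'' ((tendsto_add_atTop_iff_nat (siteNorm z)).2 hl) ?_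
    filter_upwards [eventually_subset_box (shiftVol (-z) A)] with L hL
    refine freeEv_mono hJ hβ (shiftVol_box_subset z L) (hχ.mono fun x hx => ?_)
    exact mem_shiftVol.2 (hL (mem_shiftVol.2 (by simpa using hx)))
  · refine le_of_tendsto_of_tendsto hl ((tendsto_add_atTop_iff_nat (siteNorm z)).2 hl'') ?_
    filter_upwards [eventually_subset_box A] with L hL
    exact freeEv_mono hJ hβ (box_subset_shiftVol z L) (hχ.mono hL)

theorem plusEv_charVal_shift_limit (hJt : ∀ x y : Site d, J s(x, y) = J s(0, y - x))
    (hJ : ∀ x y : Site d, 0 ≤ J s(x, y)) (hJs : ∀ x : Site d, Summable fun y => J s(x, y))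
    (hβ : 0 ≤ β) (χ : (Site d → ℤˣ) →* ℤˣ) (z : Site d) {l : ℝ}
    (hl : Tendsto (fun L : ℕ => plusEv J β (box d L) (charVal χ)) atTop (𝓝 l)) :
    Tendsto (fun L : ℕ => plusEv J β (box d L) (charVal χ ∘ shiftSpins z)) atTop (𝓝 l) := by
  obtain ⟨l', hl'⟩ := exists_tendsto_plusEv_charVal hJ hJs hβ (χ.comp (shiftSpins z))
  have hl'' : Tendsto (fun L : ℕ => plusEv J β (box d L) (charVal χ ∘ shiftSpins z)) atTop
    (𝓝 l') := hl'
  suffices l' = l from this ▸ hl''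
  simp only [← plusEv_shiftVol hJt] at hl''
  apply le_antisymm
  · exact le_of_tendsto_of_tendsto ((tendsto_add_atTop_iff_nat (siteNorm z)).2 hl'') hl
      (Eventually.of_forall fun L => plusEv_anti hJ hJs hβ (box_subset_shiftVol z L) χ)
  · exact le_of_tendsto_of_tendsto ((tendsto_add_atTop_iff_nat (siteNorm z)).2 hl) hl''
      (Eventually.of_forall fun L => plusEv_anti hJ hJs hβ (shiftVol_box_subset z L) χ)

theorem freeEv_add (Λ : Finset (Site d)) (f g : (Site d → ℤˣ) → ℝ) :
    freeEv J β Λ (f + g) = freeEv J β Λ f + freeEv J β Λ g := ev_add _ _ _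

theorem freeEv_smul (Λ : Finset (Site d)) (c : ℝ) (f : (Site d → ℤˣ) → ℝ) :
    freeEv J β Λ (c • f) = c * freeEv J β Λ f := ev_smul _ _ _

theorem plusEv_add (Λ : Finset (Site d)) (f g : (Site d → ℤˣ) → ℝ) :
    plusEv J β Λ (f + g) = plusEv J β Λ f + plusEv J β Λ g := ev_add _ _ _

theorem plusEv_smul (Λ : Finset (Site d)) (c : ℝ) (f : (Site d → ℤˣ) → ℝ) :
    plusEv J β Λ (c • f) = c * plusEv J β Λ f := ev_smul _ _ _

/-- Free expectations of local functions converge to a translation invariant limit. -/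
theorem exists_tendsto_freeEv (hJt : ∀ x y : Site d, J s(x, y) = J s(0, y - x))
    (hJ : ∀ x y : Site d, 0 ≤ J s(x, y)) (hβ : 0 ≤ β) {f : (Site d → ℤˣ) → ℝ}
    (hf : f ∈ localAlg d) :
    ∃ l, ∀ z, Tendsto (fun L : ℕ => freeEv J β (box d L) (f ∘ shiftSpins z)) atTop (𝓝 l) := by
  induction f, hf using localAlg_induction with
  | hchar A χ hχ =>
    obtain ⟨l, hl⟩ := exists_tendsto_freeEv_charVal (J := J) hJ hβ hχ
    exact ⟨l, fun z => freeEv_charVal_shift_limit hJt hJ hβ hχ z hl⟩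
  | hzero => exact ⟨0, fun z => by simp [freeEv, ev]⟩
  | hadd f g _ _ hf hg =>
    obtain ⟨l, hl⟩ := hf
    obtain ⟨m, hm⟩ := hg
    refine ⟨l + m, fun z => ?_⟩
    simpa only [← freeEv_add] using! (hl z).add (hm z)
  | hsmul c f _ hf =>
    obtain ⟨l, hl⟩ := hf
    refine ⟨c * l, fun z => ?_⟩
    simpa only [← freeEv_smul] using! (hl z).const_mul c

/-- Plus expectations of local functions converge to a translation invariant limit. -/
theorem exists_tendsto_plusEv (hJt : ∀ x y : Site d, J s(x, y) = J s(0, y - x))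
    (hJ : ∀ x y : Site d, 0 ≤ J s(x, y)) (hJs : ∀ x : Site d, Summable fun y => J s(x, y))
    (hβ : 0 ≤ β) {f : (Site d → ℤˣ) → ℝ} (hf : f ∈ localAlg d) :
    ∃ l, ∀ z, Tendsto (fun L : ℕ => plusEv J β (box d L) (f ∘ shiftSpins z)) atTop (𝓝 l) := by
  induction f, hf using localAlg_induction with
  | hchar A χ hχ =>
    obtain ⟨l, hl⟩ := exists_tendsto_plusEv_charVal hJ hJs hβ χ
    exact ⟨l, fun z => plusEv_charVal_shift_limit hJt hJ hJs hβ χ z hl⟩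
  | hzero => exact ⟨0, fun z => by simp [plusEv, ev]⟩
  | hadd f g _ _ hf hg =>
    obtain ⟨l, hl⟩ := hf
    obtain ⟨m, hm⟩ := hg
    refine ⟨l + m, fun z => ?_⟩
    simpa only [← plusEv_add] using! (hl z).add (hm z)
  | hsmul c f _ hf =>
    obtain ⟨l, hl⟩ := hf
    refine ⟨c * l, fun z => ?_⟩
    simpa only [← plusEv_smul] using! (hl z).const_mul c

end Limits

/-! ### Infinite-volume limits of the current measures -/

section LocalLimits

variable {d : ℕ}

theorem measureReal_eq_tsum_indicator {X : Type*} [Countable X] [MeasurableSpace X]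
    [MeasurableSingletonClass X] (μ : Measure X) [IsFiniteMeasure μ] (A : Set X) :
    μ.real A = ∑' x, A.indicator (fun x => μ.real {x}) x := by
  have hA : MeasurableSet A := A.to_countable.measurableSet
  rw [measureReal_def, ← Measure.tsum_indicator_apply_singleton μ A hA, ENNReal.tsum_toReal_eq]
  · refine tsum_congr fun x => ?_
    by_cases hx : x ∈ A <;> simp [hx, measureReal_def]
  · intro x
    by_cases hx : x ∈ A <;> simp [hx]

theorem measurableSet_cylinder' (E : Finset (Bond (Site d))) (A : Set (E → ℕ)) :
    MeasurableSet (cylinder (α := fun _ : Bond (Site d) => ℕ) E A) :=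
  MeasurableSet.cylinder E A.to_countable.measurableSet

theorem measureReal_cylinder (μ : Measure (Current (Site d))) [IsFiniteMeasure μ]
    (E : Finset (Bond (Site d))) (A : Set (E → ℕ)) :
    μ.real (cylinder E A) = ∑' k, A.indicator (fun k => μ.real (cylinder E {k})) k := by
  have hm : ∀ B : Set (E → ℕ), (μ.map E.restrict).real B = μ.real (cylinder E B) := fun B => by
    rw [measureReal_def, Measure.map_apply (by fun_prop) B.to_countable.measurableSet]
    rfl
  rw [← hm, measureReal_eq_tsum_indicator]
  simp only [hm]

theorem isClopen_cylinder (E : Finset (Bond (Site d))) (A : Set (E → ℕ)) :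
    IsClopen (cylinder (α := fun _ : Bond (Site d) => ℕ) E A) :=
  (isClopen_discrete A).preimage (f := E.restrict (π := fun _ => ℕ))
    (continuous_pi fun b => continuous_apply b.1)

/-- Products of bounded intervals of integers are compact. As there are countably many bonds, the
allowed error `ε` can be distributed over them as a convergent series. -/
theorem isTightMeasureSet_of_marginals {μL : ℕ → Measure (Current (Site d))}
    (h : ∀ (b : Bond (Site d)) (ε : ENNReal), 0 < ε → ∃ K : ℕ, ∀ L, μL L {n | K < n b} ≤ ε) :
    IsTightMeasureSet (Set.range μL) := by
  rw [isTightMeasureSet_iff_exists_isCompact_measure_compl_le]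
  intro ε hε
  obtain ⟨δ, hδ, hsum⟩ := ENNReal.exists_pos_sum_of_countable' hε.ne' (Bond (Site d))
  choose K hK using fun b => h b (δ b) (hδ b)
  refine ⟨Set.univ.pi fun b => Set.Iic (K b), isCompact_univ_pi fun b =>
    (Set.finite_Iic (K b)).isCompact, ?_⟩
  rintro _ ⟨L, rfl⟩
  have : (Set.univ.pi fun b => Set.Iic (K b))ᶜ ⊆ ⋃ b, {n : Current (Site d) | K b < n b} := by
    intro n hn
    simp only [Set.mem_compl_iff, Set.mem_univ_pi, Set.mem_Iic, not_forall, not_le] at hn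
    exact Set.mem_iUnion.2 hn
  refine (measure_mono this).trans ((measure_iUnion_le _).trans ?_)
  exact (ENNReal.tsum_le_tsum fun b => hK b L).trans hsum.le

/-- Tightness yields a limit point, and convergence of all cylinder probabilities makes it the
limit. `hbound` may be asked for large `L` only, as it serves a limit; `hsingle` is asked for every
`L`, since tightness concerns the whole sequence. -/
theorem exists_isLocalLimit {μL : ℕ → Measure (Current (Site d))}
    (hprob : ∀ L, IsProbabilityMeasure (μL L)) {p : ∀ E : Finset (Bond (Site d)), (E → ℕ) → ℝ}
    (hp : ∀ E k, Tendsto (fun L => (μL L).real (cylinder E {k})) atTop (𝓝 (p E k)))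
    {g : Bond (Site d) → ℕ → ℝ} (hg : ∀ b, Summable (g b))
    (hbound : ∀ E, ∀ᶠ L in atTop, ∀ k, (μL L).real (cylinder E {k}) ≤ ∏ b : E, g b (k b))
    (hsingle : ∀ b k L, (μL L).real {n | n b = k} ≤ g b k) :
    ∃ μ, IsLocalLimit μL μ ∧ ∀ E k, μ.real (cylinder E {k}) = p E k := by
  have hlim : ∀ E A, ∃ l : ENNReal, Tendsto (fun L => μL L (cylinder E A)) atTop (𝓝 l) := by
    intro E A
    refine ⟨ENNReal.ofReal (∑' k, A.indicator (p E) k), ?_⟩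
    have h1 : Tendsto (fun L => (μL L).real (cylinder E A)) atTop
        (𝓝 (∑' k, A.indicator (p E) k)) := by
      simp only [fun L => measureReal_cylinder (μL L) E A]
      refine tendsto_tsum_of_dominated_convergence
        (hasSum_prod_pi (fun b : E => g b) fun b => hg b).summable (fun k => ?_) ?_
      · by_cases hk : k ∈ A
        · simpa only [Set.indicator_of_mem hk] using hp E k
        · simpa only [Set.indicator_of_notMem hk] using tendsto_const_nhds
      · filter_upwards [hbound E] with L hL k
        refine le_trans ?_ (hL k)
        rw [Real.norm_of_nonneg (Set.indicator_nonneg (fun _ _ => measureReal_nonneg) _)]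
        exact Set.indicator_le_self' (fun _ _ => measureReal_nonneg) _
    refine (ENNReal.tendsto_ofReal h1).congr fun L => ofReal_measureReal
  have htight : IsTightMeasureSet (Set.range μL) := by
    refine isTightMeasureSet_of_marginals fun b ε hε => ?_
    have ht := ENNReal.tendsto_ofReal (tendsto_sum_nat_add (g b))
    rw [ENNReal.ofReal_zero] at ht
    obtain ⟨K, hK⟩ := (ht.eventually_le_const hε).exists
    refine ⟨K, fun L => le_trans ?_ hK⟩
    have hsub : {n : Current (Site d) | K < n b} ⊆ ⋃ k : ℕ, {n | n b = k + K} := fun n hn =>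
      Set.mem_iUnion.2 ⟨n b - K, (Nat.sub_add_cancel (le_of_lt hn)).symm⟩
    have hg0 : ∀ k, 0 ≤ g b k := fun k => measureReal_nonneg.trans (hsingle b k 0)
    rw [ENNReal.ofReal_tsum_of_nonneg (fun k => hg0 _) ((summable_nat_add_iff K).2 (hg b))]
    refine (measure_mono hsub).trans ((measure_iUnion_le _).trans (ENNReal.tsum_le_tsum fun k => ?_))
    rw [← ofReal_measureReal]
    exact ENNReal.ofReal_le_ofReal (hsingle b _ L)
  let ν : ℕ → ProbabilityMeasure (Current (Site d)) := fun L => ⟨μL L, hprob L⟩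
  have hcomp := isCompact_closure_of_isTightMeasureSet (S := Set.range ν) (by
    convert htight using 1
    ext μ
    simp only [ν, Set.mem_range]
    constructor
    · rintro ⟨_, ⟨L, rfl⟩, rfl⟩
      exact ⟨L, rfl⟩
    · rintro ⟨L, rfl⟩
      exact ⟨_, ⟨L, rfl⟩, rfl⟩)
  -- An ultrafilter finer than `atTop` plays the role of a convergent subsequence.
  obtain ⟨μ, -, hμ⟩ := isCompact_iff_ultrafilter_le_nhds.1 hcomp
    ((Ultrafilter.of atTop).map ν) (by
      refine le_trans ?_ (principal_mono.2 subset_closure)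
      rw [Ultrafilter.coe_map, le_principal_iff]
      exact Filter.mem_map.2 (Filter.univ_mem' fun L => ⟨L, rfl⟩))
  have hμ' : Tendsto ν ((Ultrafilter.of (atTop : Filter ℕ) : Ultrafilter ℕ) : Filter ℕ) (𝓝 μ) := hμ
  have hμl : IsLocalLimit μL (μ : Measure (Current (Site d))) := by
    refine ⟨inferInstance, fun E A => ?_⟩
    obtain ⟨l, hl⟩ := hlim E A
    -- Cylinders are clopen, so their frontier is empty and the portmanteau theorem applies to each
    -- of them.
    have h1 := ProbabilityMeasure.tendsto_measure_of_null_frontier_of_tendsto' hμ'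
      (E := cylinder E A) (by rw [(isClopen_cylinder E A).frontier_eq]; simp)
    have h2 := hl.mono_left (Ultrafilter.of_le atTop)
    rwa [← tendsto_nhds_unique h2 h1]
  refine ⟨μ, hμl, fun E k => ?_⟩
  refine tendsto_nhds_unique ?_ (hp E k)
  exact (ENNReal.tendsto_toReal (measure_ne_top _ _)).comp (hμl.2 E {k})

theorem localLimit_spec {μL : ℕ → Measure (Current (Site d))} (h : ∃ μ, IsLocalLimit μL μ) :
    IsLocalLimit μL (localLimit μL) := by
  rw [localLimit, dif_pos h]
  exact h.choose_spec

end LocalLimits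

/-! ### Infinite-volume free and plus currents -/

section CurrentLimits

variable {d : ℕ} {J : Sym2 (Site d) → ℝ} {β : ℝ}

theorem exists_bond_map_subtype {Λ : Finset (Site d)} {b : Bond (Site d)} (hb : ∀ x ∈ b.1, x ∈ Λ) :
    ∃ b' : Bond Λ, b'.map (Function.Embedding.subtype (· ∈ Λ)) = b := by
  obtain ⟨e, he⟩ := b
  induction e with | h x y =>
  exact ⟨⟨s(⟨x, hb x (by simp)⟩, ⟨y, hb y (by simp)⟩), by simpa using he⟩, rfl⟩

theorem exists_lift_bonds {Λ : Finset (Site d)} {E : Finset (Bond (Site d))}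
    (hE : ∀ b ∈ E, ∀ x ∈ b.1, x ∈ Λ) : ∃ j : E → Bond Λ, Function.Injective j ∧
      ∀ b, (j b).map (Function.Embedding.subtype (· ∈ Λ)) = b.1 := by
  choose j hj using fun b : E => exists_bond_map_subtype (hE b b.2)
  exact ⟨j, fun a b h => Subtype.ext (by rw [← hj a, ← hj b, h]), hj⟩

theorem freeCoupling_lift {Λ : Finset (Site d)} {b : Bond (Site d)} {c : Bond Λ}
    (hc : c.map (Function.Embedding.subtype (· ∈ Λ)) = b) :
    freeCoupling J Λ c.1 = J b.1 := by
  rw [← hc]; rfl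

theorem charVal_bondChar_lift_free {Λ : Finset (Site d)} {b : Bond (Site d)} {c : Bond Λ}
    (hc : c.map (Function.Embedding.subtype (· ∈ Λ)) = b) (σ : Λ → ℤˣ) :
    charVal (bondChar c) σ = charVal ((bondChar b).comp (extFree Λ)) σ := by
  rw [charVal, charVal, ← hc, MonoidHom.comp_apply, bondChar_map]
  congr 3
  ext x
  exact congrArg Units.val (extFree_apply_of_mem x.2 σ).symm

theorem plusCoupling_lift {Λ : Finset (Site d)} {b : Bond (Site d)} {c : Bond Λ}
    (hc : c.map (Function.Embedding.subtype (· ∈ Λ)) = b) :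
    plusCoupling J Λ (c.map Function.Embedding.some).1 = J b.1 := by
  rw [← hc]
  obtain ⟨e, he⟩ := c
  induction e with | h x y => rfl

theorem charVal_bondChar_lift_plus {Λ : Finset (Site d)} {b : Bond (Site d)} {c : Bond Λ}
    (hc : c.map (Function.Embedding.subtype (· ∈ Λ)) = b) (σ : Option Λ → ℤˣ) :
    charVal (bondChar (c.map Function.Embedding.some)) σ =
      charVal ((bondChar b).comp (extPlus Λ)) σ := by
  rw [charVal, charVal, ← hc, MonoidHom.comp_apply, bondChar_map, bondChar_map]
  congr 3
  ext x
  exact congrArg Units.val (extPlus_apply_of_mem x.2 σ).symm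

theorem mem_cylinder_singleton {E : Finset (Bond (Site d))} {k : E → ℕ} {n : Current (Site d)} :
    n ∈ cylinder (α := fun _ : Bond (Site d) => ℕ) E {k} ↔ ∀ b : E, n b = k b := by
  rw [mem_cylinder, Set.mem_singleton_iff, funext_iff]
  rfl

theorem extendCurrent_map {Λ : Finset (Site d)} (n : Current Λ) (b : Bond Λ) :
    extendCurrent Λ n (b.map (Function.Embedding.subtype (· ∈ Λ))) = n b :=
  (Bond.map_injective _).extend_apply n 0 b

theorem extendCurrent_of_notMem {Λ : Finset (Site d)} (n : Current Λ) {b : Bond (Site d)}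
    {x : Site d} (hx : x ∈ b.1) (hxΛ : x ∉ Λ) : extendCurrent Λ n b = 0 := by
  refine Function.extend_apply' _ _ _ ?_
  rintro ⟨b', rfl⟩
  obtain ⟨y, -, rfl⟩ := Sym2.mem_map.1 hx
  exact hxΛ y.2

theorem freeLawIn_cylinder (hJ : ∀ x y : Site d, 0 ≤ J s(x, y)) (hβ : 0 ≤ β)
    {Λ : Finset (Site d)} {E : Finset (Bond (Site d))} (hE : ∀ b ∈ E, ∀ x ∈ b.1, x ∈ Λ)
    (k : E → ℕ) : (freeLawIn J β Λ).real (cylinder E {k}) =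
      freeEv J β Λ (marginalFun J β E k) := by
  obtain ⟨j, hj, hjE⟩ := exists_lift_bonds hE
  rw [freeLawIn, measureReal_def, Measure.map_apply .of_discrete (measurableSet_cylinder' E _)]
  have h1 : extendCurrent Λ ⁻¹' cylinder E {k} = {n | ∀ b, n (j b) = k b} := by
    ext n
    rw [Set.mem_preimage, mem_cylinder_singleton]
    refine forall_congr' fun b => ?_
    rw [← hjE b, extendCurrent_map]
  rw [h1, ← measureReal_def, currentLaw_marginal (fun b => freeCoupling_nonneg hJ Λ b.1) hβ hj, freeEv]
  congr 1
  ext σ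
  refine Finset.prod_congr rfl fun b _ => ?_
  rw [freeCoupling_lift (hjE b), charVal_bondChar_lift_free (hjE b)]
  rfl

theorem plusLawIn_cylinder (hJ : ∀ x y : Site d, 0 ≤ J s(x, y)) (hβ : 0 ≤ β)
    {Λ : Finset (Site d)} {E : Finset (Bond (Site d))} (hE : ∀ b ∈ E, ∀ x ∈ b.1, x ∈ Λ)
    (k : E → ℕ) : (plusLawIn J β Λ).real (cylinder E {k}) =
      plusEv J β Λ (marginalFun J β E k) := by
  obtain ⟨j, hj, hjE⟩ := exists_lift_bonds hE
  rw [plusLawIn, measureReal_def, Measure.map_apply .of_discrete (measurableSet_cylinder' E _)]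
  have h1 : (fun n : Current (Option Λ) =>
      extendCurrent Λ fun b => n (Bond.map Function.Embedding.some b)) ⁻¹' cylinder E {k} =
      {n | ∀ b, n ((j b).map Function.Embedding.some) = k b} := by
    ext n
    rw [Set.mem_preimage, mem_cylinder_singleton]
    refine forall_congr' fun b => ?_
    rw [← hjE b, extendCurrent_map]
  rw [h1, ← measureReal_def, currentLaw_marginal (j := fun b => (j b).map Function.Embedding.some)
    (fun b => plusCoupling_nonneg hJ Λ b.1) hβ
    ((Bond.map_injective Function.Embedding.some).comp hj), plusEv]
  congr 1
  ext σ
  refine Finset.prod_congr rfl fun b _ => ?_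
  rw [plusCoupling_lift (hjE b), charVal_bondChar_lift_plus (hjE b)]
  rfl

/-- A summable bound on the marginals of a random current. -/
def marginalBound (x : ℝ) (k : ℕ) : ℝ := x ^ k / k.factorial * Real.exp x

theorem summable_marginalBound (x : ℝ) : Summable (marginalBound x) :=
  (Real.summable_pow_div_factorial x).mul_right _

theorem abs_localWeight_le {x : ℝ} (hx : 0 ≤ x) {t : ℝ} (ht : |t| = 1) (k : ℕ) :
    |localWeight (x * t) k| ≤ marginalBound x k := by
  rw [localWeight, marginalBound, abs_mul, abs_div, abs_pow, abs_mul, ht, mul_one, Real.abs_exp,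
    abs_of_nonneg hx, Nat.abs_cast]
  gcongr
  have := neg_abs_le (x * t)
  rw [abs_mul, ht, abs_of_nonneg hx] at this
  linarith

theorem marginalFun_le (hJ : ∀ x y : Site d, 0 ≤ J s(x, y)) (hβ : 0 ≤ β)
    (E : Finset (Bond (Site d))) (k : E → ℕ) (s : Site d → ℤˣ) :
    marginalFun J β E k s ≤ ∏ b : E, marginalBound (β * J b.1.1) (k b) := by
  refine (le_abs_self _).trans ?_
  rw [marginalFun, Finset.abs_prod]
  refine Finset.prod_le_prod (fun _ _ => abs_nonneg _) fun b _ => ?_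
  refine abs_localWeight_le (mul_nonneg hβ ?_) (abs_charVal _ _) _
  obtain ⟨⟨e, he⟩, -⟩ := b
  induction e with | h x y => exact hJ x y

theorem marginalBound_nonneg {x : ℝ} (hx : 0 ≤ x) (k : ℕ) : 0 ≤ marginalBound x k := by
  unfold marginalBound; positivity

theorem bond_nonneg (hJ : ∀ x y : Site d, 0 ≤ J s(x, y)) (b : Bond (Site d)) : 0 ≤ J b.1 := by
  obtain ⟨e, he⟩ := b
  induction e with | h x y => exact hJ x y

theorem isProbabilityMeasure_freeLawIn (hJ : ∀ x y : Site d, 0 ≤ J s(x, y)) (hβ : 0 ≤ β)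
    (Λ : Finset (Site d)) : IsProbabilityMeasure (freeLawIn J β Λ) := by
  have := isProbabilityMeasure_currentLaw (fun b => freeCoupling_nonneg hJ Λ b.1) hβ
  exact Measure.isProbabilityMeasure_map (Measurable.of_discrete (f := extendCurrent Λ)).aemeasurable

theorem isProbabilityMeasure_plusLawIn (hJ : ∀ x y : Site d, 0 ≤ J s(x, y)) (hβ : 0 ≤ β)
    (Λ : Finset (Site d)) : IsProbabilityMeasure (plusLawIn J β Λ) := by
  have := isProbabilityMeasure_currentLaw (fun b => plusCoupling_nonneg hJ Λ b.1) hβ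
  exact Measure.isProbabilityMeasure_map (Measurable.of_discrete
    (f := fun n : Current (Option Λ) =>
      extendCurrent Λ fun b => n (Bond.map Function.Embedding.some b))).aemeasurable

theorem eventually_bonds_subset_box (E : Finset (Bond (Site d))) :
    ∀ᶠ L in atTop, ∀ b ∈ E, ∀ x ∈ b.1, x ∈ box d L := by
  classical
  filter_upwards [eventually_subset_box (E.biUnion fun b => b.1.toFinset)] with L hL b hb x hx
  exact hL (Finset.mem_biUnion.2 ⟨b, hb, Sym2.mem_toFinset.2 hx⟩)

theorem cylinder_singleton_bond (b : Bond (Site d)) (k : ℕ) :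
    {n : Current (Site d) | n b = k} =
      cylinder (α := fun _ : Bond (Site d) => ℕ) {b} {fun _ => k} := by
  ext n
  rw [mem_cylinder_singleton]
  simp

theorem ae_map_bond_eq_zero {V : Type*} [MeasurableSpace V] {ν : Measure V}
    {F : V → Current (Site d)} (hF : Measurable F) {b : Bond (Site d)} (h : ∀ v, F v b = 0) :
    ∀ᵐ n ∂ν.map F, n b = 0 :=
  (ae_map_iff hF.aemeasurable (measurable_pi_apply b (measurableSet_singleton 0))).2
    (ae_of_all _ h)

/-- The case to watch is a bond not contained in `Λ`: there the current vanishes, and the bound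
survives because `marginalBound x 0 = exp x ≥ 1` for `x ≥ 0`. -/
theorem measureReal_bond_eq_le (hJ : ∀ x y : Site d, 0 ≤ J s(x, y)) (hβ : 0 ≤ β)
    {Λ : Finset (Site d)} {μ : Measure (Current (Site d))} [IsProbabilityMeasure μ]
    {ξ : ((Site d → ℤˣ) → ℝ) → ℝ} (hξ : ∀ f c, (∀ s, f s ≤ c) → ξ f ≤ c)
    (hin : ∀ E : Finset (Bond (Site d)), (∀ b ∈ E, ∀ x ∈ b.1, x ∈ Λ) → ∀ k : E → ℕ,
      μ.real (cylinder E {k}) = ξ (marginalFun J β E k))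
    (hout : ∀ b : Bond (Site d), (∃ x ∈ b.1, x ∉ Λ) → ∀ᵐ n ∂μ, n b = 0)
    (b : Bond (Site d)) (k : ℕ) : μ.real {n | n b = k} ≤ marginalBound (β * J b.1) k := by
  have h0 := mul_nonneg hβ (bond_nonneg hJ b)
  by_cases hb : ∀ x ∈ b.1, x ∈ Λ
  · rw [cylinder_singleton_bond, hin {b} (by simpa using! hb)]
    refine hξ _ _ fun s => (marginalFun_le hJ hβ _ _ s).trans_eq ?_
    simp
  · push Not at hb
    rcases Nat.eq_zero_or_pos k with rfl | hk
    · refine measureReal_le_one.trans ?_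
      simpa [marginalBound] using h0
    · have : μ {n | n b = k} = 0 := by
        refine measure_mono_null ?_ (hout b hb)
        rintro n (rfl : n b = k)
        exact hk.ne'
      rw [measureReal_def, this]
      exact marginalBound_nonneg h0 k

theorem freeEv_le (Λ : Finset (Site d)) {f : (Site d → ℤˣ) → ℝ} {c : ℝ} (h : ∀ s, f s ≤ c) :
    freeEv J β Λ f ≤ c := (ev_mono _ fun _ => h _).trans_eq (ev_const _ c)

theorem plusEv_le (Λ : Finset (Site d)) {f : (Site d → ℤˣ) → ℝ} {c : ℝ} (h : ∀ s, f s ≤ c) :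
    plusEv J β Λ f ≤ c := (ev_mono _ fun _ => h _).trans_eq (ev_const _ c)

/-- `μ` is a translation invariant random current measure, whose finite-dimensional
distributions are given by the spin expectation `ξ`. -/
structure IsCurrentState (J : Sym2 (Site d) → ℝ) (β : ℝ) (μ : Measure (Current (Site d)))
    (ξ : ((Site d → ℤˣ) → ℝ) → ℝ) : Prop where
  isProbabilityMeasure : IsProbabilityMeasure μ
  marginal : ∀ E k, μ.real (cylinder E {k}) = ξ (marginalFun J β E k)
  shift : ∀ z, ∀ f ∈ localAlg d, ξ (f ∘ shiftSpins z) = ξ f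
  add : ∀ f ∈ localAlg d, ∀ g ∈ localAlg d, ξ (f + g) = ξ f + ξ g
  smul : ∀ c : ℝ, ∀ f ∈ localAlg d, ξ (c • f) = c * ξ f
  le : ∀ c : ℝ, ∀ f ∈ localAlg d, (∀ s, f s ≤ c) → ξ f ≤ c

/-- Treats free and plus boundary conditions at once. Off `localAlg` the limit that defines `ξ` need
not exist and its value may be a default one, so the properties of `ξ` are claimed on `localAlg`
only. -/
theorem exists_isCurrentState (hJ : ∀ x y : Site d, 0 ≤ J s(x, y)) (hβ : 0 ≤ β)
    {μΛ : Finset (Site d) → Measure (Current (Site d))}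
    {ξΛ : Finset (Site d) → ((Site d → ℤˣ) → ℝ) → ℝ}
    (hprob : ∀ Λ, IsProbabilityMeasure (μΛ Λ))
    (hmarg : ∀ (Λ : Finset (Site d)) (E : Finset (Bond (Site d))), (∀ b ∈ E, ∀ x ∈ b.1, x ∈ Λ) →
      ∀ k : E → ℕ, (μΛ Λ).real (cylinder E {k}) = ξΛ Λ (marginalFun J β E k))
    (hout : ∀ (Λ : Finset (Site d)) (b : Bond (Site d)), (∃ x ∈ b.1, x ∉ Λ) →
      ∀ᵐ n ∂μΛ Λ, n b = 0)
    (hle : ∀ Λ f c, (∀ s, f s ≤ c) → ξΛ Λ f ≤ c)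
    (hadd : ∀ Λ f g, ξΛ Λ (f + g) = ξΛ Λ f + ξΛ Λ g)
    (hsmul : ∀ Λ (c : ℝ) f, ξΛ Λ (c • f) = c * ξΛ Λ f)
    (hlim : ∀ f ∈ localAlg d,
      ∃ l, ∀ z, Tendsto (fun L : ℕ => ξΛ (box d L) (f ∘ shiftSpins z)) atTop (𝓝 l)) :
    IsLocalLimit (fun L => μΛ (box d L)) (localLimit fun L => μΛ (box d L)) ∧
    ∃ ξ : ((Site d → ℤˣ) → ℝ) → ℝ,
      (∀ f ∈ localAlg d, Tendsto (fun L : ℕ => ξΛ (box d L) f) atTop (𝓝 (ξ f))) ∧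
      IsCurrentState J β (localLimit fun L => μΛ (box d L)) ξ := by
  classical
  set ξ : ((Site d → ℤˣ) → ℝ) → ℝ := fun f => limUnder atTop fun L : ℕ => ξΛ (box d L) f with hξ
  have hlim' : ∀ f ∈ localAlg d, ∀ z,
      Tendsto (fun L : ℕ => ξΛ (box d L) (f ∘ shiftSpins z)) atTop (𝓝 (ξ f)) := by
    intro f hf z
    obtain ⟨l, hl⟩ := hlim f hf
    have h0 : Tendsto (fun L : ℕ => ξΛ (box d L) f) atTop (𝓝 l) := by
      have hs : f ∘ shiftSpins 0 = f := by
        ext s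
        exact congrArg f (funext fun x => by rw [shiftSpins_apply, sub_zero])
      simpa only [hs] using hl 0
    rw [hξ]
    simp only
    rw [h0.limUnder_eq]
    exact hl z
  have hlim0 : ∀ f ∈ localAlg d, Tendsto (fun L : ℕ => ξΛ (box d L) f) atTop (𝓝 (ξ f)) :=
    fun f hf => tendsto_nhds_limUnder ⟨_, by
      have hs : f ∘ shiftSpins 0 = f := by
        ext s
        exact congrArg f (funext fun x => by rw [shiftSpins_apply, sub_zero])
      simpa only [hs] using hlim' f hf 0⟩
  have hp : ∀ (E : Finset (Bond (Site d))) (k : E → ℕ), Tendsto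
      (fun L : ℕ => (μΛ (box d L)).real (cylinder E {k})) atTop
      (𝓝 (ξ (marginalFun J β E k))) := fun E k => by
    refine Tendsto.congr' ?_ (hlim0 _ (marginalFun_mem_localAlg J β E k))
    filter_upwards [eventually_bonds_subset_box E] with L hL
    rw [hmarg _ E hL]
  obtain ⟨μ, hμ, hμp⟩ := exists_isLocalLimit (fun L => hprob (box d L)) hp
    (fun b => summable_marginalBound (β * J b.1)) (fun E => by
      filter_upwards [eventually_bonds_subset_box E] with L hL k
      rw [hmarg _ E hL]
      exact hle _ _ _ (marginalFun_le hJ hβ E k)) (fun b k L => by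
      have := hprob (box d L)
      exact measureReal_bond_eq_le hJ hβ (hle (box d L)) (hmarg _) (hout _) b k)
  have hloc := localLimit_spec ⟨μ, hμ⟩
  refine ⟨hloc, ξ, hlim0, ?_⟩
  rw [← hμ.unique hloc]
  refine ⟨hμ.1, hμp, fun z f hf => ?_, fun f hf g hg => ?_, fun c f hf => ?_,
    fun c f hf h => ?_⟩
  · exact (hlim' f hf z).limUnder_eq
  · refine Tendsto.limUnder_eq ?_
    simp only [hadd]
    exact (hlim0 f hf).add (hlim0 g hg)
  · refine Tendsto.limUnder_eq ?_
    simp only [hsmul]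
    exact (hlim0 f hf).const_mul c
  · exact le_of_tendsto' (hlim0 f hf) fun L => hle _ f c h

theorem summable_coupling (hJt : ∀ x y : Site d, J s(x, y) = J s(0, y - x))
    (hJs : Summable fun x : Site d => J s(0, x)) (x : Site d) : Summable fun y => J s(x, y) := by
  simp only [hJt x]
  exact (Equiv.subRight x).summable_iff.2 hJs

theorem freeLaw_spec (hJt : ∀ x y : Site d, J s(x, y) = J s(0, y - x))
    (hJ : ∀ x y : Site d, 0 ≤ J s(x, y)) (hβ : 0 ≤ β) :
    IsLocalLimit (fun L => freeLawIn J β (box d L)) (freeLaw J β) ∧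
    ∃ ξ : ((Site d → ℤˣ) → ℝ) → ℝ,
      (∀ f ∈ localAlg d, Tendsto (fun L : ℕ => freeEv J β (box d L) f) atTop (𝓝 (ξ f))) ∧
      IsCurrentState J β (freeLaw J β) ξ :=
  exists_isCurrentState hJ hβ (isProbabilityMeasure_freeLawIn hJ hβ)
    (fun _ _ hE k => freeLawIn_cylinder hJ hβ hE k)
    (fun _ _ ⟨_, hx, hxΛ⟩ => ae_map_bond_eq_zero .of_discrete fun _ =>
      extendCurrent_of_notMem _ hx hxΛ)
    (fun Λ _ _ h => freeEv_le Λ h) freeEv_add freeEv_smul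
    fun _ hf => exists_tendsto_freeEv hJt hJ hβ hf

theorem plusLaw_spec (hJt : ∀ x y : Site d, J s(x, y) = J s(0, y - x))
    (hJ : ∀ x y : Site d, 0 ≤ J s(x, y)) (hJs : Summable fun x : Site d => J s(0, x))
    (hβ : 0 ≤ β) :
    IsLocalLimit (fun L => plusLawIn J β (box d L)) (plusLaw J β) ∧
    ∃ ξ : ((Site d → ℤˣ) → ℝ) → ℝ,
      (∀ f ∈ localAlg d, Tendsto (fun L : ℕ => plusEv J β (box d L) f) atTop (𝓝 (ξ f))) ∧
      IsCurrentState J β (plusLaw J β) ξ :=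
  exists_isCurrentState hJ hβ (isProbabilityMeasure_plusLawIn hJ hβ)
    (fun _ _ hE k => plusLawIn_cylinder hJ hβ hE k)
    (fun _ _ ⟨_, hx, hxΛ⟩ => ae_map_bond_eq_zero .of_discrete fun _ =>
      extendCurrent_of_notMem _ hx hxΛ)
    (fun Λ _ _ h => plusEv_le Λ h) plusEv_add plusEv_smul
    fun _ hf => exists_tendsto_plusEv hJt hJ (summable_coupling hJt hJs) hβ hf

/-- The character `s ↦ s_x s_y`. -/
def twoPointChar (x y : Site d) : (Site d → ℤˣ) →* ℤˣ :=
  Pi.evalMonoidHom (fun _ : Site d => ℤˣ) x * Pi.evalMonoidHom _ y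

theorem twoPointChar_apply (x y : Site d) (s : Site d → ℤˣ) :
    twoPointChar x y s = s x * s y := rfl

theorem isLocalChar_twoPointChar (x y : Site d) :
    IsLocalChar ({x, y} : Finset (Site d)) (twoPointChar x y) := fun s s' h => by
  rw [twoPointChar_apply, twoPointChar_apply, h x (by simp), h y (by simp)]

theorem freeCorrIn_eq_freeEv {Λ : Finset (Site d)} {x y : Site d} (hx : x ∈ Λ) (hy : y ∈ Λ) :
    freeCorrIn J β Λ x y = freeEv J β Λ (charVal (twoPointChar x y)) := by
  rw [freeCorrIn, gibbs_eq_ev, freeEv]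
  congr 1
  ext σ
  simp [spin, hx, hy, charVal, twoPointChar_apply, extFree_apply_of_mem]

theorem eventually_freeCorrIn_eq (x y : Site d) : ∀ᶠ L in atTop,
    freeCorrIn J β (box d L) x y = freeEv J β (box d L) (charVal (twoPointChar x y)) := by
  filter_upwards [eventually_subset_box {x, y}] with L hL
  exact freeCorrIn_eq_freeEv (hL (by simp)) (hL (by simp))

/-- The two-point function converges along the boxes. -/
theorem tendsto_freeCorrIn (hJ : ∀ x y : Site d, 0 ≤ J s(x, y)) (hβ : 0 ≤ β) (x y : Site d) :
    Tendsto (fun L : ℕ => freeCorrIn J β (box d L) x y) atTop (𝓝 (freeCorr J β x y)) := by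
  obtain ⟨l, hl⟩ := exists_tendsto_freeEv_charVal (J := J) hJ hβ (isLocalChar_twoPointChar x y)
  exact tendsto_nhds_limUnder ⟨l, hl.congr' ((eventually_freeCorrIn_eq x y).mono fun _ h => h.symm)⟩

theorem tendsto_freeEv_twoPointChar (hJ : ∀ x y : Site d, 0 ≤ J s(x, y)) (hβ : 0 ≤ β)
    (x y : Site d) : Tendsto (fun L : ℕ => freeEv J β (box d L) (charVal (twoPointChar x y))) atTop
      (𝓝 (freeCorr J β x y)) :=
  (tendsto_freeCorrIn hJ hβ x y).congr' (eventually_freeCorrIn_eq x y)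

theorem freeCorr_nonneg (hJ : ∀ x y : Site d, 0 ≤ J s(x, y)) (hβ : 0 ≤ β) (x y : Site d) :
    0 ≤ freeCorr J β x y :=
  ge_of_tendsto' (tendsto_freeEv_twoPointChar hJ hβ x y) fun _ => freeEv_nonneg hJ hβ _ _

end CurrentLimits

/-! ### Properties of the infinite-volume current measures -/

section Comparison

variable {d : ℕ}

/-- A finite measure on currents is dominated by another one if this holds on the cylinders
over the sets of bonds which contain a given one. -/
theorem measure_le_of_cylinder {μ ν : Measure (Current (Site d))} [IsFiniteMeasure μ]
    [IsFiniteMeasure ν] (E₀ : Finset (Bond (Site d)))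
    (h : ∀ E, E₀ ⊆ E → ∀ k : E → ℕ, μ.real (cylinder E {k}) ≤ ν.real (cylinder E {k})) :
    μ ≤ ν := by
  classical
  have h1 : ∀ t ∈ measurableCylinders fun _ : Bond (Site d) => ℕ, μ t ≤ ν t := by
    intro t ht
    obtain ⟨E, S, -, rfl⟩ := (mem_measurableCylinders t).1 ht
    -- A cylinder over `E` is also one over `E ∪ E₀`, where the hypothesis applies.
    obtain ⟨S', hS'⟩ : ∃ S' : Set ((E ∪ E₀ : Finset _) → ℕ),
        cylinder (α := fun _ : Bond (Site d) => ℕ) E S = cylinder (E ∪ E₀) S' :=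
      ⟨Finset.restrict₂ (π := fun _ => ℕ) (Finset.subset_union_left (s₁ := E) (s₂ := E₀)) ⁻¹' S, rfl⟩
    rw [hS', ← ofReal_measureReal (μ := μ), ← ofReal_measureReal (μ := ν)]
    refine ENNReal.ofReal_le_ofReal ?_
    rw [measureReal_cylinder, measureReal_cylinder]
    have hs : ∀ (ρ : Measure (Current (Site d))) [IsFiniteMeasure ρ], Summable fun k =>
        S'.indicator (fun k => ρ.real (cylinder (E ∪ E₀) {k})) k := by
      intro ρ _
      have hm : ∀ B : Set ((E ∪ E₀ : Finset _) → ℕ),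
          ρ.real (cylinder (E ∪ E₀) B) = (ρ.map (Finset.restrict (E ∪ E₀))).real B := fun B => by
        rw [measureReal_def, measureReal_def,
          Measure.map_apply (by fun_prop) B.to_countable.measurableSet]
        rfl
      simp only [hm]
      refine Summable.indicator ?_ _
      have := ENNReal.summable_toReal (f := fun k => (ρ.map (Finset.restrict (E ∪ E₀))) {k}) (by
        have h2 := Measure.tsum_indicator_apply_singleton (ρ.map (Finset.restrict (E ∪ E₀)))
          Set.univ .univ
        rw [Set.indicator_univ] at h2
        rw [h2]
        exact measure_ne_top _ _)
      exact this
    refine (hs μ).tsum_le_tsum (fun k => ?_) (hs ν)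
    exact Set.indicator_le_indicator (h _ Finset.subset_union_right k)
  refine Measure.le_iff.2 fun s hs => ?_
  -- Density is taken with respect to `μ + ν`, so that a single cylinder approximates `s` under both
  -- measures.
  have hd := Measure.MeasureDense.of_generateFrom_isSetAlgebra_finite (μ + ν)
    (isSetAlgebra_measurableCylinders (α := fun _ : Bond (Site d) => ℕ))
    generateFrom_measurableCylinders.symm
  refine ENNReal.le_of_forall_pos_le_add fun ε hε _ => ?_
  obtain ⟨t, ht, hst⟩ := hd.approx s hs (measure_ne_top _ _) ε (by exact_mod_cast hε)
  rw [ENNReal.ofReal_coe_nnreal, Measure.add_apply] at hst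
  calc μ s ≤ μ t + μ (symmDiff s t) := by
        refine (measure_mono ?_).trans (measure_union_le t (symmDiff s t))
        intro x hx
        by_cases hxt : x ∈ t
        · exact Or.inl hxt
        · exact Or.inr (Or.inl ⟨hx, hxt⟩)
    _ ≤ ν t + μ (symmDiff s t) := add_le_add_left (h1 t ht) _
    _ ≤ ν s + ν (symmDiff s t) + μ (symmDiff s t) := by
        gcongr
        refine (measure_mono ?_).trans (measure_union_le s (symmDiff s t))
        intro x hx
        by_cases hxs : x ∈ s
        · exact Or.inl hxs
        · exact Or.inr (Or.inr ⟨hx, hxs⟩)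
    _ ≤ ν s + ε := by
        rw [add_assoc, add_comm (ν _) (μ _)]
        gcongr

end Comparison

/-! ### Translation invariance and insertion tolerance of currents -/

section States

variable {d : ℕ} {J : Sym2 (Site d) → ℝ} {β : ℝ} {μ : Measure (Current (Site d))}
  {ξ : ((Site d → ℤˣ) → ℝ) → ℝ}

theorem IsCurrentState.marginal_injective (h : IsCurrentState J β μ ξ) {I : Type*} [Fintype I]
    {j : I → Bond (Site d)} (hj : Function.Injective j) (k : I → ℕ) :
    μ.real {n | ∀ i, n (j i) = k i} = ξ fun s =>
      ∏ i, localWeight (β * J (j i).1 * charVal (bondChar (j i)) s) (k i) := by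
  classical
  let E : Finset (Bond (Site d)) := Finset.univ.map ⟨j, hj⟩
  let e : I ≃ E := Equiv.ofBijective (fun i => ⟨j i, by simp [E]⟩)
    ⟨fun a b hab => hj (congrArg Subtype.val hab), fun b => by
      obtain ⟨i, -, hi⟩ := Finset.mem_map.1 b.2
      exact ⟨i, Subtype.ext hi⟩⟩
  have hm := h.marginal E (fun b => k (e.symm b))
  convert hm using 2
  · ext n
    rw [mem_cylinder_singleton, Set.mem_ofPred_eq, ← e.forall_congr_right]
    simp only [Equiv.symm_apply_apply]
    rfl
  · ext s
    rw [marginalFun, ← e.prod_comp]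
    simp only [Equiv.symm_apply_apply]
    rfl

/-- Translation of bonds. -/
def shiftBond (z : Site d) : Bond (Site d) → Bond (Site d) :=
  Bond.map (Equiv.addRight z).toEmbedding

/-- Translation of currents. -/
def shiftCurrent (z : Site d) (n : Current (Site d)) : Current (Site d) := fun b =>
  n (shiftBond z b)

theorem measurable_shiftCurrent (z : Site d) : Measurable (shiftCurrent z) :=
  measurable_pi_lambda _ fun b => measurable_pi_apply (shiftBond z b)

theorem IsCurrentState.map_shiftCurrent (h : IsCurrentState J β μ ξ)
    (hJ : ∀ x y : Site d, J s(x, y) = J s(0, y - x)) (z : Site d) :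
    μ.map (shiftCurrent z) = μ := by
  have := h.isProbabilityMeasure
  have := Measure.isProbabilityMeasure_map (μ := μ) (measurable_shiftCurrent z).aemeasurable
  have key : ∀ (E : Finset (Bond (Site d))) (k : E → ℕ),
      (μ.map (shiftCurrent z)).real (cylinder E {k}) = μ.real (cylinder E {k}) := by
    intro E k
    rw [measureReal_def, Measure.map_apply (measurable_shiftCurrent z)
      (measurableSet_cylinder' E _), ← measureReal_def]
    have h1 : shiftCurrent z ⁻¹' cylinder E {k} = {n | ∀ b : E, n (shiftBond z b) = k b} := by
      ext n
      rw [Set.mem_preimage, mem_cylinder_singleton]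
      rfl
    rw [h1, h.marginal_injective (j := fun b : E => shiftBond z b)
      ((Bond.map_injective _).comp Subtype.val_injective), h.marginal,
      ← h.shift (-z) _ (marginalFun_mem_localAlg J β E k)]
    congr 1
    ext s
    refine Finset.prod_congr rfl fun b _ => ?_
    have h2 : J (shiftBond z b.1).1 = J b.1.1 := by
      obtain ⟨⟨e, he⟩, -⟩ := b
      induction e with | h x y => exact coupling_add hJ x y z
    have h3 : charVal (bondChar (shiftBond z b.1)) s =
        charVal (bondChar b.1) (shiftSpins (-z) s) := by
      rw [charVal, charVal, shiftBond, bondChar_map]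
      congr 3
      ext x
      rw [shiftSpins_apply, sub_neg_eq_add]
      rfl
    rw [h2, h3]
  exact le_antisymm (measure_le_of_cylinder ∅ fun E _ k => (key E k).le)
    (measure_le_of_cylinder ∅ fun E _ k => (key E k).ge)

/-- The current on `b` vanishes with probability the expectation of `exp (-β J_b σ_b)`, which is at
least `1 - β J_b`. -/
theorem IsCurrentState.measureReal_bond_pos_le (h : IsCurrentState J β μ ξ)
    (hJ : ∀ x y : Site d, 0 ≤ J s(x, y)) (hβ : 0 ≤ β) (b : Bond (Site d)) :
    μ.real {n | 0 < n b} ≤ β * J b.1 := by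
  have := h.isProbabilityMeasure
  have hc : {n : Current (Site d) | 0 < n b} = {n | n b = 0}ᶜ := by
    ext n; simp [Nat.pos_iff_ne_zero]
  have hm : MeasurableSet {n : Current (Site d) | n b = 0} :=
    measurable_pi_apply b (measurableSet_singleton 0)
  rw [hc, probReal_compl_eq_one_sub hm, cylinder_singleton_bond, h.marginal]
  set f := marginalFun J β {b} fun _ => 0 with hf
  have hfm : f ∈ localAlg d := marginalFun_mem_localAlg _ _ _ _
  have h1 : ξ ((-1 : ℝ) • f) ≤ β * J b.1 - 1 := by
    refine h.le _ _ (Subalgebra.smul_mem _ hfm _) fun s => ?_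
    have h2 : f s = Real.exp (-(β * J b.1 * charVal (bondChar b) s)) := by
      simp [hf, marginalFun, localWeight]
    have h3 := Real.add_one_le_exp (-(β * J b.1 * charVal (bondChar b) s))
    have h4 := mul_le_mul_of_nonneg_left (charVal_le_one (bondChar b) s)
      (mul_nonneg hβ (bond_nonneg hJ b))
    simp only [Pi.smul_apply, smul_eq_mul, h2]
    linarith
  rw [h.smul _ _ hfm] at h1
  linarith

/-- Insertion of the value `2` on a bond on which the current vanishes. -/
def openCurrent (b : Bond (Site d)) (n : Current (Site d)) : Current (Site d) :=
  open Classical in Function.update n b (if n b = 0 then 2 else n b)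

theorem openCurrent_self (b : Bond (Site d)) (n : Current (Site d)) :
    openCurrent b n b = if n b = 0 then 2 else n b := by
  simp [openCurrent]

theorem openCurrent_of_ne {b c : Bond (Site d)} (h : c ≠ b) (n : Current (Site d)) :
    openCurrent b n c = n c := by
  simp [openCurrent, h]

theorem measurable_openCurrent (b : Bond (Site d)) : Measurable (openCurrent b) := by
  refine measurable_pi_lambda _ fun c => ?_
  by_cases h : c = b
  · subst h
    simp only [openCurrent_self]
    exact (Measurable.of_discrete (f := fun m : ℕ => if m = 0 then 2 else m)).comp
      (measurable_pi_apply c)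
  · simp only [openCurrent_of_ne h]
    exact measurable_pi_apply c

/-- Insertion tolerance. -/
theorem IsCurrentState.map_openCurrent_le (h : IsCurrentState J β μ ξ) {b : Bond (Site d)}
    (hb : 0 < β * J b.1) :
    μ.map (openCurrent b) ≤ ENNReal.ofReal (1 + 2 / (β * J b.1) ^ 2) • μ := by
  classical
  have := h.isProbabilityMeasure
  have := Measure.isProbabilityMeasure_map (μ := μ) (measurable_openCurrent b).aemeasurable
  have := μ.smul_finite (c := ENNReal.ofReal (1 + 2 / (β * J b.1) ^ 2)) ENNReal.ofReal_ne_top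
  refine measure_le_of_cylinder {b} fun E hE k => ?_
  set x := β * J b.1 with hx
  have hbE : b ∈ E := hE (by simp)
  rw [measureReal_def, Measure.map_apply (measurable_openCurrent b)
      (measurableSet_cylinder' E _), ← measureReal_def, measureReal_ennreal_smul_apply,
      ENNReal.toReal_ofReal (by positivity), add_mul, one_mul]
  -- A value `2` on `b` arises from `2` or from `0`. Since `σ_b ^ 2 = 1`, the marginal function at
  -- `2` is `x ^ 2 / 2` times the one at `0`; hence the constant `1 + 2 / x ^ 2`. Any other value
  -- can only arise from itself.
  by_cases h2 : k ⟨b, hbE⟩ = 2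
  · have hsub : openCurrent b ⁻¹' cylinder E {k} ⊆
        cylinder E {k} ∪ cylinder E {Function.update k ⟨b, hbE⟩ 0} := by
      intro n hn
      rw [Set.mem_preimage, mem_cylinder_singleton] at hn
      by_cases hn0 : n b = 0
      · right
        rw [mem_cylinder_singleton]
        intro c
        by_cases hc : c = ⟨b, hbE⟩
        · subst hc; simpa using hn0
        · rw [Function.update_of_ne hc, ← hn c, openCurrent_of_ne fun h' => hc (Subtype.ext h')]
      · left
        rw [mem_cylinder_singleton]
        intro c
        rw [← hn c]
        by_cases hc : c = ⟨b, hbE⟩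
        · subst hc; rw [openCurrent_self, if_neg hn0]
        · rw [openCurrent_of_ne fun h' => hc (Subtype.ext h')]
    refine (measureReal_mono hsub).trans ((measureReal_union_le _ _).trans ?_)
    have hfun : marginalFun J β E k =
        (x ^ 2 / 2) • marginalFun J β E (Function.update k ⟨b, hbE⟩ 0) := by
      ext s
      rw [Pi.smul_apply, smul_eq_mul, marginalFun, marginalFun,
        ← Finset.mul_prod_erase _ _ (Finset.mem_univ (⟨b, hbE⟩ : E)),
        ← Finset.mul_prod_erase (Finset.univ : Finset E) (fun c => localWeight _ (_ : ℕ))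
          (Finset.mem_univ (⟨b, hbE⟩ : E)), h2, Function.update_self, ← mul_assoc]
      congr 1
      · have := charVal_mul_self (bondChar b) s
        simp only [localWeight, ← hx]
        norm_num
        rw [mul_pow, pow_two (charVal _ _), this]
        ring
      · refine Finset.prod_congr rfl fun c hc => ?_
        rw [Function.update_of_ne (Finset.ne_of_mem_erase hc)]
    have hξ := h.smul (x ^ 2 / 2) _ (marginalFun_mem_localAlg J β E
      (Function.update k ⟨b, hbE⟩ 0))
    rw [← hfun, ← h.marginal, ← h.marginal] at hξ
    rw [hξ]
    apply le_of_eq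
    field_simp
  · have hsub : openCurrent b ⁻¹' cylinder E {k} ⊆ cylinder E {k} := by
      intro n hn
      rw [Set.mem_preimage, mem_cylinder_singleton] at hn
      rw [mem_cylinder_singleton]
      intro c
      rw [← hn c]
      by_cases hc : c = ⟨b, hbE⟩
      · subst hc
        have hnb := hn ⟨b, hbE⟩
        rw [openCurrent_self] at hnb ⊢
        split_ifs at hnb ⊢ with hn0
        · exact absurd hnb.symm h2
        · rfl
      · rw [openCurrent_of_ne fun h' => hc (Subtype.ext h')]
    refine (measureReal_mono hsub).trans (le_add_of_nonneg_right ?_)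
    positivity

end States

/-! ### The switching inequality -/

section Switching

/-- The binomial theorem: as for Poisson variables, the parameters of independent currents add up.
-/
theorem sum_antidiagonal_localWeight (x y : ℝ) (m : ℕ) :
    ∑ p ∈ Finset.HasAntidiagonal.antidiagonal m, localWeight x p.1 * localWeight y p.2 =
      localWeight (x + y) m := by
  have h : (x + y) ^ m / (m.factorial : ℝ) =
      ∑ p ∈ Finset.HasAntidiagonal.antidiagonal m, x ^ p.1 / p.1.factorial * (y ^ p.2 / p.2.factorial) := by
    rw [(Commute.all x y).add_pow', Finset.sum_div]
    refine Finset.sum_congr rfl fun p hp => ?_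
    rw [Finset.HasAntidiagonal.mem_antidiagonal] at hp
    have h1 := Nat.add_choose_mul_factorial_mul_factorial p.1 p.2
    rw [hp] at h1
    rw [nsmul_eq_mul, Nat.choose_symm_of_eq_add hp.symm, div_mul_div_comm, div_eq_div_iff (by positivity) (by positivity), ← h1]
    push_cast
    ring
  rw [localWeight, h, neg_add, Real.exp_add, Finset.sum_mul]
  refine Finset.sum_congr rfl fun p _ => ?_
  simp only [localWeight]
  ring

theorem hasSum_localWeight (x : ℝ) : HasSum (localWeight x) 1 := by
  have := (NormedSpace.expSeries_div_hasSum_exp (𝔸 := ℝ) x).mul_right (Real.exp (-x))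
  rwa [← congrFun Real.exp_eq_exp_ℝ, ← Real.exp_add, add_neg_cancel, Real.exp_zero] at this

/-- The pairs of functions with a given sum. -/
def addPairs {I : Type*} [Fintype I] [DecidableEq I] (m : I → ℕ) : Finset (I → ℕ × ℕ) :=
  Fintype.piFinset fun i => Finset.HasAntidiagonal.antidiagonal (m i)

variable {G H : Type*} [CommGroup G] [Fintype G] [CommGroup H] [Fintype H]

theorem ev_mul_ev (U f : G → ℝ) (W g : H → ℝ) :
    ev U f * ev W g = ev (fun p : G × H => U p.1 + W p.2) fun p => f p.1 * g p.2 := by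
  simp only [ev]
  rw [div_mul_div_comm, Finset.sum_mul_sum, Finset.sum_mul_sum, ← Finset.sum_product',
    ← Finset.sum_product', Finset.univ_product_univ]
  simp only [Real.exp_add]
  congr 1
  exact Finset.sum_congr rfl fun p _ => by ring

theorem ev_sum {ι : Type*} (U : G → ℝ) (s : Finset ι) (f : ι → G → ℝ) :
    ev U (∑ i ∈ s, f i) = ∑ i ∈ s, ev U (f i) := by
  classical
  induction s using Finset.induction_on with
  | empty => simp [ev_zero]
  | insert a s ha ih => rw [Finset.sum_insert ha, Finset.sum_insert ha, ev_add, ih]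

/-- The probability that the sum of two independent currents takes a value in a finite set
whose elements force `X = Y` is at most `⟨X⟩ ⟨Y⟩`. -/
theorem sum_ev_mul_ev_le {I : Type*} [Fintype I] [DecidableEq I] {K : I → ℝ} (hK : ∀ i, 0 ≤ K i)
    {χ : I → G →* ℤˣ} {ψ : I → H →* ℤˣ} {U : G → ℝ} {W : H → ℝ}
    (hU : (fun g => U g - ∑ i, K i * charVal (χ i) g) ∈ posCone G)
    (hW : (fun h => W h - ∑ i, K i * charVal (ψ i) h) ∈ posCone H)
    (X : G →* ℤˣ) (Y : H →* ℤˣ) (M : Finset (I → ℕ))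
    (hM : ∀ m ∈ M, ∀ g h, (∀ i, 0 < m i → χ i g = ψ i h) → X g = Y h) :
    ∑ m ∈ M, ∑ p ∈ addPairs m,
      ev U (fun g => ∏ i, localWeight (K i * charVal (χ i) g) (p i).1) *
      ev W (fun h => ∏ i, localWeight (K i * charVal (ψ i) h) (p i).2) ≤
    ev U (charVal X) * ev W (charVal Y) := by
  set V : G × H → ℝ := fun p => U p.1 + W p.2 with hV
  set Z : G × H →* ℤˣ := X.comp (MonoidHom.fst G H) * Y.comp (MonoidHom.snd G H) with hZ
  set D : (I → ℕ) → G × H → ℝ := fun m p =>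
    ∏ i, localWeight (K i * charVal (χ i) p.1 + K i * charVal (ψ i) p.2) (m i) with hD
  have hZval : ∀ p : G × H, charVal Z p = charVal X p.1 * charVal Y p.2 := fun p => by
    simp [charVal, hZ]
  -- For given spins of both copies, the sum of the currents has local parameters `K i * (χ i + ψ
  -- i)`.
  have h1 : ∀ m, ∑ p ∈ addPairs m,
      ev U (fun g => ∏ i, localWeight (K i * charVal (χ i) g) (p i).1) *
      ev W (fun h => ∏ i, localWeight (K i * charVal (ψ i) h) (p i).2) = ev V (D m) := by
    intro m
    simp only [ev_mul_ev]
    rw [← ev_sum]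
    congr 1
    ext q
    simp only [Finset.sum_apply, hD, ← Finset.prod_mul_distrib, ← sum_antidiagonal_localWeight]
    rw [Finset.prod_univ_sum]
    rfl
  -- If some `i` with `m i > 0` has `χ i = -ψ i`, the weight vanishes; otherwise `hM` gives `X = Y`
  -- and `Z = 1`. Either way the factor `Z` costs nothing.
  have h2 : ∀ m ∈ M, ev V (D m) = ev V (charVal Z * D m) := by
    intro m hm
    congr 1
    ext q
    rw [Pi.mul_apply]
    by_cases hq : ∀ i, 0 < m i → χ i q.1 = ψ i q.2
    · have : charVal Z q = 1 := by
        rw [hZval]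
        simp only [charVal, hM m hm q.1 q.2 hq]
        exact charVal_mul_self Y q.2
      rw [this, one_mul]
    · push Not at hq
      obtain ⟨i, hi, hne⟩ := hq
      have h0 : charVal (χ i) q.1 + charVal (ψ i) q.2 = 0 := by
        simp only [charVal]
        rcases Int.units_eq_one_or (χ i q.1) with a | a <;>
          rcases Int.units_eq_one_or (ψ i q.2) with b | b <;> simp_all
      have : D m q = 0 := by
        refine Finset.prod_eq_zero (Finset.mem_univ i) ?_
        rw [← mul_add, h0, mul_zero, localWeight, zero_pow hi.ne', zero_div, zero_mul]
      rw [this, mul_zero]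
  -- The exponentials in the local weights cancel the selected terms of `V`. The remaining energy is
  -- still in the cone, so the first Griffiths inequality applies to every `m`, not only to those of
  -- `M`.
  have h3 : ∀ m, 0 ≤ ev V (charVal Z * D m) := by
    intro m
    refine div_nonneg ?_ (sum_exp_pos V).le
    set S : G × H → ℝ := (fun g => U g - ∑ i, K i * charVal (χ i) g) ∘ MonoidHom.fst G H +
      (fun h => W h - ∑ i, K i * charVal (ψ i) h) ∘ MonoidHom.snd G H with hS
    have hSm : S ∈ posCone (G × H) :=
      add_mem (comp_mem_posCone _ hU) (comp_mem_posCone _ hW)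
    set T : G × H → ℝ := ∏ i, ((K i ^ m i / (m i).factorial) •
      (charVal ((χ i).comp (MonoidHom.fst G H)) + charVal ((ψ i).comp (MonoidHom.snd G H))) ^ m i)
      with hT
    have hTm : T ∈ posCone (G × H) := prod_mem_posCone _ fun i _ =>
      smul_mem_posCone (div_nonneg (pow_nonneg (hK i) _) (by positivity))
        (pow_mem_posCone (add_mem (charVal_mem _) (charVal_mem _)) _)
    have := sum_nonneg_of_mem_posCone (mul_mem_posCone (charVal_mem Z)
      (mul_mem_posCone hTm (exp_mem_posCone hSm)))
    refine this.trans_eq (Finset.sum_congr rfl fun q _ => ?_)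
    simp only [Pi.mul_apply, mul_assoc]
    congr 1
    have e1 : D m q = T q * Real.exp (-(∑ i, K i * charVal (χ i) q.1) -
        ∑ i, K i * charVal (ψ i) q.2) := by
      simp only [hD, hT, localWeight, Finset.prod_mul_distrib, ← Real.exp_sum, Finset.prod_apply]
      congr 1
      · refine Finset.prod_congr rfl fun i _ => ?_
        simp only [Pi.smul_apply, Pi.pow_apply, Pi.add_apply, smul_eq_mul, charVal_comp,
          MonoidHom.coe_fst, MonoidHom.coe_snd]
        rw [← mul_add, mul_pow]
        ring
      · simp only [neg_add, Finset.sum_add_distrib, Finset.sum_neg_distrib]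
        rw [sub_eq_add_neg]
    rw [e1, mul_assoc, ← Real.exp_add]
    congr 2
    simp only [hS, hV, Pi.add_apply, Function.comp_apply, MonoidHom.coe_fst, MonoidHom.coe_snd]
    ring
  -- The weights `D m` sum to `1` for fixed spins; extending the sum from `M` to all `m` thus leaves
  -- the expectation of `Z`, which factorises.
  have h4 : HasSum (fun m => ev V (charVal Z * D m)) (ev V (charVal Z)) := by
    have hs : ∀ q, HasSum (fun m => D m q) 1 := fun q => by
      have := hasSum_prod_pi
        (fun i => localWeight (K i * charVal (χ i) q.1 + K i * charVal (ψ i) q.2))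
        fun i => (hasSum_localWeight _).summable
      simpa only [(hasSum_localWeight _).tsum_eq, Finset.prod_const_one] using this
    refine HasSum.div_const ?_ _
    refine hasSum_sum fun q _ => ?_
    simpa using! ((hs q).mul_left (charVal Z q)).mul_right (Real.exp (V q))
  rw [Finset.sum_congr rfl fun m hm => (h1 m).trans (h2 m hm), ev_mul_ev]
  refine (sum_le_hasSum M (fun m _ => h3 m) h4).trans_eq ?_
  congr 1
  ext q
  exact hZval q

end Switching

/-! ### Ferromagnetic energies with some bonds removed -/

section Connectivity

variable {V : Type*} [Fintype V] [DecidableEq V]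

theorem energy_sub_mem_posCone {J : Sym2 V → ℝ} {β : ℝ} (hJ : ∀ b : Bond V, 0 ≤ J b.1)
    (hβ : 0 ≤ β) {I : Type*} [Fintype I] {j : I → Bond V} (hj : Function.Injective j) :
    (fun σ => energy J β σ - ∑ i, β * J (j i).1 * charVal (bondChar (j i)) σ) ∈
      posCone (V → ℤˣ) := by
  have : (fun σ => energy J β σ - ∑ i, β * J (j i).1 * charVal (bondChar (j i)) σ) =
      ∑ b ∈ (Finset.univ.map ⟨j, hj⟩)ᶜ, (β * J b.1) • charVal (bondChar b) := by
    ext σ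
    rw [energy, ← Finset.sum_add_sum_compl (Finset.univ.map ⟨j, hj⟩), Finset.sum_map]
    simp
  rw [this]
  exact sum_mem fun b _ => smul_charVal_mem (mul_nonneg hβ (hJ b)) _

end Connectivity

/-! ### Measurability of connection events -/

section Measurability

theorem measurableSet_reachable {Ω V : Type*} [MeasurableSpace Ω] [Countable V]
    {G : Ω → SimpleGraph V} (hG : ∀ u v, MeasurableSet {ω | (G ω).Adj u v}) (x y : V) :
    MeasurableSet {ω | (G ω).Reachable x y} := by
  have hn : ∀ (n : ℕ) (x : V), MeasurableSet {ω | ∃ w : (G ω).Walk x y, w.length = n} := by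
    intro n
    induction n with
    | zero =>
      intro x
      by_cases h : x = y
      · subst h
        convert MeasurableSet.univ
        exact Set.eq_univ_of_forall fun ω => ⟨.nil, rfl⟩
      · convert MeasurableSet.empty
        refine Set.eq_empty_iff_forall_notMem.2 fun ω ⟨w, hw⟩ => h ?_
        exact SimpleGraph.Walk.eq_of_length_eq_zero hw
    | succ n ih =>
      intro x
      have : {ω | ∃ w : (G ω).Walk x y, w.length = n + 1} =
          ⋃ z, {ω | (G ω).Adj x z} ∩ {ω | ∃ w : (G ω).Walk z y, w.length = n} := by
        ext ω
        simp only [Set.mem_ofPred_eq, Set.mem_iUnion, Set.mem_inter_iff]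
        constructor
        · rintro ⟨w, hw⟩
          cases w with
          | nil => simp at hw
          | cons h w => exact ⟨_, h, w, by simpa using hw⟩
        · rintro ⟨z, h, w, hw⟩
          exact ⟨.cons h w, by simp [hw]⟩
      rw [this]
      exact MeasurableSet.iUnion fun z => (hG x z).inter (ih z)
  have : {ω | (G ω).Reachable x y} = ⋃ n, {ω | ∃ w : (G ω).Walk x y, w.length = n} := by
    ext ω
    simp only [Set.mem_ofPred_eq, Set.mem_iUnion]
    exact ⟨fun ⟨w⟩ => ⟨_, w, rfl⟩, fun ⟨_, w, _⟩ => ⟨w⟩⟩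
  rw [this]
  exact MeasurableSet.iUnion fun n => hn n x

theorem measurableSet_infinite {Ω V : Type*} [MeasurableSpace Ω] [Countable V]
    {S : Ω → Set V} (hS : ∀ v, MeasurableSet {ω | v ∈ S ω}) :
    MeasurableSet {ω | (S ω).Infinite} := by
  have : {ω | (S ω).Infinite} = ⋂ F : Finset V, ⋃ v ∈ (F : Set V)ᶜ, {ω | v ∈ S ω} := by
    ext ω
    simp only [Set.mem_ofPred_eq, Set.mem_iInter, Set.mem_iUnion, exists_prop]
    constructor
    · intro h F
      obtain ⟨v, hv, hvF⟩ := h.exists_notMem_finset F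
      exact ⟨v, hvF, hv⟩
    · intro h hfin
      obtain ⟨v, hv, hv'⟩ := h hfin.toFinset
      exact hv (hfin.mem_toFinset.2 hv')
  rw [this]
  exact MeasurableSet.iInter fun F => MeasurableSet.biUnion (Set.to_countable _) fun v _ => hS v

variable {d : ℕ}

theorem openGraph_adj {ω : Config d} {x y : Site d} :
    (openGraph ω).Adj x y ↔ ∃ b : Bond (Site d), b.1 = s(x, y) ∧ ω b = true := by
  rw [openGraph, SimpleGraph.fromEdgeSet_adj]
  refine ⟨fun h => h.1, fun h => ⟨h, ?_⟩⟩
  obtain ⟨b, hb, -⟩ := h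
  rintro rfl
  exact b.2 (by rw [hb]; rfl)

theorem measurableSet_bond_eq (b : Bond (Site d)) (v : Bool) :
    MeasurableSet {ω : Config d | ω b = v} :=
  measurableSet_eq_fun (measurable_pi_apply b) measurable_const

theorem measurableSet_adj (x y : Site d) :
    MeasurableSet {ω : Config d | (openGraph ω).Adj x y} := by
  simp only [openGraph_adj]
  have : {ω : Config d | ∃ b : Bond (Site d), b.1 = s(x, y) ∧ ω b = true} =
      ⋃ b ∈ {b : Bond (Site d) | b.1 = s(x, y)}, {ω | ω b = true} := by
    ext ω; simp
  rw [this]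
  exact MeasurableSet.biUnion (Set.to_countable _) fun b _ => measurableSet_bond_eq b _

theorem measurableSet_connEvent (x y : Site d) : MeasurableSet (connEvent x y) :=
  measurableSet_reachable measurableSet_adj x y

theorem measurableSet_connInfEvent (x : Site d) : MeasurableSet (connInfEvent x) :=
  measurableSet_infinite fun y => measurableSet_connEvent x y

end Measurability

/-! ### Connection probabilities and the free two-point function -/

section TwoPoint

variable {d : ℕ} {J : Sym2 (Site d) → ℝ} {β : ℝ}

/-- The products along the edges of a path telescope, each intermediate spin occurring squared. -/
theorem mul_eq_mul_of_reachable {S : Set (Sym2 (Site d))} {s s' : Site d → ℤˣ}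
    (h : ∀ u v, s(u, v) ∈ S → s u * s v = s' u * s' v) {x y : Site d}
    (hxy : (SimpleGraph.fromEdgeSet S).Reachable x y) : s x * s y = s' x * s' y := by
  obtain ⟨w⟩ := hxy
  induction w with
  | nil => rw [Int.units_mul_self, Int.units_mul_self]
  | @cons u v y ha _ ih =>
    have h1 := h u v ((SimpleGraph.fromEdgeSet_adj _).1 ha).1
    calc s u * s y = (s u * s v) * (s v * s y) := by
          rw [mul_assoc, ← mul_assoc (s v), Int.units_mul_self, one_mul]
      _ = (s' u * s' v) * (s' v * s' y) := by rw [h1, ih]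
      _ = s' u * s' y := by rw [mul_assoc, ← mul_assoc (s' v), Int.units_mul_self, one_mul]

/-- The graph of the bonds on which a current on a finite set of bonds does not vanish. -/
def finGraph (E : Finset (Bond (Site d))) (m : E → ℕ) : SimpleGraph (Site d) :=
  SimpleGraph.fromEdgeSet {e | ∃ b : E, b.1.1 = e ∧ 0 < m b}

/-- If the spin products of the two copies agree on every bond of a path from `x` to `y`, then so do
the products at its ends, as `sum_ev_mul_ev_le` requires. The plus correlation that it produces is
bounded by `1`. -/
theorem sum_freeEv_mul_plusEv_le (hJ : ∀ x y : Site d, 0 ≤ J s(x, y)) (hβ : 0 ≤ β)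
    {Λ : Finset (Site d)} {E : Finset (Bond (Site d))} (hE : ∀ b ∈ E, ∀ x ∈ b.1, x ∈ Λ)
    {x y : Site d} (M : Finset (E → ℕ)) (hM : ∀ m ∈ M, (finGraph E m).Reachable x y) :
    ∑ m ∈ M, ∑ p ∈ addPairs m, freeEv J β Λ (marginalFun J β E fun b => (p b).1) *
      plusEv J β Λ (marginalFun J β E fun b => (p b).2) ≤
    freeEv J β Λ (charVal (twoPointChar x y)) := by
  obtain ⟨j, hj, hjE⟩ := exists_lift_bonds hE
  have hU : (fun σ => energy (freeCoupling J Λ) β σ - ∑ b : E,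
      β * J b.1.1 * charVal ((bondChar b.1).comp (extFree Λ)) σ) ∈ posCone (Λ → ℤˣ) := by
    have h := energy_sub_mem_posCone (β := β) (fun b => freeCoupling_nonneg hJ Λ b.1) hβ hj
    have e : ∀ (b : E) (σ : Λ → ℤˣ), β * freeCoupling J Λ (j b).1 * charVal (bondChar (j b)) σ =
        β * J b.1.1 * charVal ((bondChar b.1).comp (extFree Λ)) σ := fun b σ => by
      rw [freeCoupling_lift (hjE b), charVal_bondChar_lift_free (hjE b)]
    simp only [e] at h
    exact h
  have hW : (fun σ => energy (plusCoupling J Λ) β σ - ∑ b : E,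
      β * J b.1.1 * charVal ((bondChar b.1).comp (extPlus Λ)) σ) ∈ posCone (Option Λ → ℤˣ) := by
    have h := energy_sub_mem_posCone (j := fun b => (j b).map Function.Embedding.some) (β := β)
      (fun b => plusCoupling_nonneg hJ Λ b.1) hβ
      ((Bond.map_injective Function.Embedding.some).comp hj)
    have e : ∀ (b : E) (σ : Option Λ → ℤˣ),
        β * plusCoupling J Λ ((j b).map Function.Embedding.some).1 *
          charVal (bondChar ((j b).map Function.Embedding.some)) σ =
        β * J b.1.1 * charVal ((bondChar b.1).comp (extPlus Λ)) σ := fun b σ => by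
      rw [plusCoupling_lift (hjE b), charVal_bondChar_lift_plus (hjE b)]
    simp only [e] at h
    exact h
  have key := sum_ev_mul_ev_le (G := Λ → ℤˣ) (H := Option Λ → ℤˣ) (I := E)
    (U := energy (freeCoupling J Λ) β) (W := energy (plusCoupling J Λ) β)
    (K := fun b : E => β * J b.1.1)
    (fun b => mul_nonneg hβ (bond_nonneg hJ b.1)) (χ := fun b : E => (bondChar b.1).comp (extFree Λ))
    (ψ := fun b : E => (bondChar b.1).comp (extPlus Λ)) hU hW
    ((twoPointChar x y).comp (extFree Λ)) ((twoPointChar x y).comp (extPlus Λ)) M ?_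
  · have e0 : ∀ k : E → ℕ, freeEv J β Λ (marginalFun J β E k) =
        ev (energy (freeCoupling J Λ) β) fun σ => ∏ b : E, localWeight
          (β * J b.1.1 * charVal ((bondChar b.1).comp (extFree Λ)) σ) (k b) := fun _ => rfl
    have e1 : ∀ k : E → ℕ, plusEv J β Λ (marginalFun J β E k) =
        ev (energy (plusCoupling J Λ) β) fun σ => ∏ b : E, localWeight
          (β * J b.1.1 * charVal ((bondChar b.1).comp (extPlus Λ)) σ) (k b) := fun _ => rfl
    simp only [e0, e1]
    refine key.trans ?_
    exact mul_le_of_le_one_right (freeEv_nonneg hJ hβ Λ (twoPointChar x y))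
      (plusEv_le_one Λ (twoPointChar x y))
  · intro m hm g h hgh
    refine mul_eq_mul_of_reachable (s := extFree Λ g) (s' := extPlus Λ h) (fun u v huv => ?_)
      (hM m hm)
    obtain ⟨b, hb, hb0⟩ := huv
    have := hgh b hb0
    obtain ⟨⟨e, he⟩, hbE⟩ := b
    change e = s(u, v) at hb
    subst hb
    exact this

theorem measurableSet_pair_sum (E : Finset (Bond (Site d))) (A : Set (E → ℕ)) :
    MeasurableSet {n : Current (Site d) × Current (Site d) | E.restrict (n.1 + n.2) ∈ A} :=
  (Measurable.comp (g := E.restrict) (Finset.measurable_restrict E) (measurable_fst.add measurable_snd))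
    A.to_countable.measurableSet

theorem prod_measureReal_sum_eq (μ ν : Measure (Current (Site d))) [IsProbabilityMeasure μ]
    [IsProbabilityMeasure ν] (E : Finset (Bond (Site d))) (m : E → ℕ) :
    (μ.prod ν).real {n | E.restrict (n.1 + n.2) = m} = ∑ p ∈ addPairs m,
      μ.real (cylinder E {fun b => (p b).1}) * ν.real (cylinder E {fun b => (p b).2}) := by
  have h1 : {n : Current (Site d) × Current (Site d) | E.restrict (n.1 + n.2) = m} =
      ⋃ p ∈ addPairs m, cylinder (α := fun _ : Bond (Site d) => ℕ) E {fun b => (p b).1} ×ˢ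
        cylinder (α := fun _ : Bond (Site d) => ℕ) E {fun b => (p b).2} := by
    ext n
    simp only [Set.mem_ofPred_eq, Set.mem_iUnion, Set.mem_prod, mem_cylinder_singleton, addPairs,
      Fintype.mem_piFinset, Finset.HasAntidiagonal.mem_antidiagonal, exists_prop]
    constructor
    · rintro rfl
      exact ⟨fun b => (n.1 b, n.2 b), fun b => rfl, fun b => rfl, fun b => rfl⟩
    · rintro ⟨p, hp, hp1, hp2⟩
      ext b
      rw [← hp b, ← hp1, ← hp2]
      rfl
  rw [h1, measureReal_biUnion_finset]
  · exact Finset.sum_congr rfl fun p _ => measureReal_prod_prod _ _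
  · intro p _ q _ hpq
    refine Set.disjoint_left.2 fun n hn hn' => hpq ?_
    simp only [Set.mem_prod, mem_cylinder_singleton] at hn hn'
    ext b
    · rw [← hn.1, ← hn'.1]
    · rw [← hn.2, ← hn'.2]
  · exact fun p _ => (measurableSet_cylinder' _ _).prod (measurableSet_cylinder' _ _)

theorem measurable_trace_add : Measurable fun n : Current (Site d) × Current (Site d) =>
    trace (n.1 + n.2) :=
  measurable_pi_lambda _ fun b => (Measurable.of_discrete (f := fun k : ℕ => decide (0 < k))).comp
    (((measurable_pi_apply b).comp measurable_fst).add
      ((measurable_pi_apply b).comp measurable_snd))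

theorem reachable_trace_iff (n : Current (Site d)) (x y : Site d) :
    (openGraph (trace n)).Reachable x y ↔
      ∃ E : Finset (Bond (Site d)), (finGraph E (E.restrict n)).Reachable x y := by
  classical
  have hmono : ∀ E F : Finset (Bond (Site d)), E ⊆ F →
      finGraph E (E.restrict n) ≤ finGraph F (F.restrict n) := fun E F h =>
    SimpleGraph.fromEdgeSet_mono fun e ⟨b, hb, hb0⟩ => ⟨⟨b.1, h b.2⟩, hb, hb0⟩
  constructor
  · rintro ⟨w⟩
    induction w with
    | nil => exact ⟨∅, SimpleGraph.Reachable.refl _⟩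
    | @cons u v y ha _ ih =>
      obtain ⟨E, hE⟩ := ih
      obtain ⟨⟨b, hb, hb0⟩, hne⟩ := (SimpleGraph.fromEdgeSet_adj _).1 ha
      refine ⟨insert b E, SimpleGraph.Reachable.trans (v := v) ?_
        (hE.mono (hmono _ _ (Finset.subset_insert _ _)))⟩
      refine SimpleGraph.Adj.reachable ((SimpleGraph.fromEdgeSet_adj _).2 ⟨?_, hne⟩)
      exact ⟨⟨b, Finset.mem_insert_self _ _⟩, hb, by simpa [trace] using hb0⟩
  · rintro ⟨E, hE⟩
    refine hE.mono (SimpleGraph.fromEdgeSet_mono ?_)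
    rintro e ⟨b, hb, hb0⟩
    exact ⟨b.1, hb, by simpa [trace] using hb0⟩

theorem isProbabilityMeasure_percLaw (hJt : ∀ x y : Site d, J s(x, y) = J s(0, y - x))
    (hJ : ∀ x y : Site d, 0 ≤ J s(x, y)) (hJs : Summable fun x : Site d => J s(0, x))
    (hβ : 0 ≤ β) : IsProbabilityMeasure (percLaw J β) := by
  have h0 := (freeLaw_spec hJt hJ hβ).1.1
  have h1 := (plusLaw_spec hJt hJ hJs hβ).1.1
  exact Measure.isProbabilityMeasure_map measurable_trace_add.aemeasurable

theorem percLaw_connEvent_le (hJt : ∀ x y : Site d, J s(x, y) = J s(0, y - x))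
    (hJ : ∀ x y : Site d, 0 ≤ J s(x, y)) (hJs : Summable fun x : Site d => J s(0, x))
    (hβ : 0 ≤ β) (x y : Site d) :
    (percLaw J β).real (connEvent x y) ≤ freeCorr J β x y := by
  obtain ⟨-, ξ, hξ, hμ⟩ := freeLaw_spec (J := J) (β := β) hJt hJ hβ
  obtain ⟨-, η, hη, hν⟩ := plusLaw_spec (J := J) (β := β) hJt hJ hJs hβ
  have := hμ.isProbabilityMeasure
  have := hν.isProbabilityMeasure
  set P := (freeLaw J β).prod (plusLaw J β) with hP
  set A : Finset (Bond (Site d)) → Set (Current (Site d) × Current (Site d)) := fun E =>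
    {n | E.restrict (n.1 + n.2) ∈ {m : E → ℕ | (finGraph E m).Reachable x y}} with hA
  have hAm : ∀ E, MeasurableSet (A E) := fun E => measurableSet_pair_sum E _
  have hAle : ∀ E, P.real (A E) ≤ freeCorr J β x y := by
    intro E
    set ρ := P.map fun n => E.restrict (n.1 + n.2) with hρ
    have hmeas : Measurable fun n : Current (Site d) × Current (Site d) =>
        E.restrict (n.1 + n.2) :=
      Measurable.comp (g := E.restrict) (Finset.measurable_restrict E) (measurable_fst.add measurable_snd)
    have hρA : ∀ B : Set (E → ℕ), ρ.real B = P.real {n | E.restrict (n.1 + n.2) ∈ B} := fun B => by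
      rw [measureReal_def, hρ, Measure.map_apply hmeas B.to_countable.measurableSet]
      rfl
    have : IsProbabilityMeasure ρ := Measure.isProbabilityMeasure_map hmeas.aemeasurable
    change P.real {n | E.restrict (n.1 + n.2) ∈ {m : E → ℕ | (finGraph E m).Reachable x y}} ≤ _
    rw [← hρA, measureReal_eq_tsum_indicator]
    -- A partial sum involves finitely many expectations of local functions, so the finite-volume
    -- inequality passes to the limit; the infinite sum comes afterwards.
    refine Real.tsum_le_of_sum_le (fun m => Set.indicator_nonneg (fun _ _ => measureReal_nonneg) m)
      fun M => ?_
    classical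
    rw [Finset.sum_indicator_eq_sum_filter]
    set M' := M.filter fun m => m ∈ {m : E → ℕ | (finGraph E m).Reachable x y} with hM'
    have h1 : ∀ m, ρ.real {m} = ∑ p ∈ addPairs m, ξ (marginalFun J β E fun b => (p b).1) *
        η (marginalFun J β E fun b => (p b).2) := fun m => by
      rw [hρA]
      simp only [← hμ.marginal, ← hν.marginal]
      exact prod_measureReal_sum_eq _ _ E m
    simp only [h1]
    refine le_of_tendsto_of_tendsto (tendsto_finsetSum M' fun m _ => tendsto_finsetSum _ fun p _ =>
      (hξ _ (marginalFun_mem_localAlg J β E fun b => (p b).1)).mul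
        (hη _ (marginalFun_mem_localAlg J β E fun b => (p b).2)))
      (tendsto_freeEv_twoPointChar hJ hβ x y) ?_
    filter_upwards [eventually_bonds_subset_box E] with L hL
    exact sum_freeEv_mul_plusEv_le hJ hβ hL M' fun m hm => (Finset.mem_filter.1 hm).2
  -- A path uses finitely many bonds. Connection is thus the increasing union over `E` of connection
  -- inside `E`, and the bound uniform in `E` carries over.
  have hpre : (fun n : Current (Site d) × Current (Site d) => trace (n.1 + n.2)) ⁻¹'
      connEvent x y = ⋃ E, A E := by
    ext n
    rw [Set.mem_preimage, connEvent, Set.mem_ofPred_eq, reachable_trace_iff, Set.mem_iUnion]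
    rfl
  have hAmono : Monotone A := by
    intro E F h n hn
    refine SimpleGraph.Reachable.mono (SimpleGraph.fromEdgeSet_mono ?_) (hn : (finGraph E _).Reachable x y)
    rintro e ⟨b, hb, hb0⟩
    exact ⟨⟨b.1, h b.2⟩, hb, hb0⟩
  rw [percLaw, measureReal_def,
    Measure.map_apply measurable_trace_add (measurableSet_connEvent x y), hpre]
  refine ENNReal.toReal_le_of_le_ofReal (freeCorr_nonneg hJ hβ x y) ?_
  rw [hAmono.directed_le.measure_iUnion]
  refine iSup_le fun E => ?_
  rw [← ofReal_measureReal]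
  exact ENNReal.ofReal_le_ofReal (hAle E)

end TwoPoint

/-! ### Translation invariant, insertion tolerant percolation -/

section Tolerant

variable {d : ℕ}

/-- Translation of percolation configurations. -/
def shiftConfig (z : Site d) (ω : Config d) : Config d := fun b => ω (shiftBond z b)

theorem measurable_shiftConfig (z : Site d) : Measurable (shiftConfig z) :=
  measurable_pi_lambda _ fun b => measurable_pi_apply (shiftBond z b)

/-- The configuration in which the bonds of `F` have been opened. -/
def openBonds (F : Finset (Bond (Site d))) (ω : Config d) : Config d :=
  open Classical in fun b => if b ∈ F then true else ω b

theorem openBonds_of_mem {F : Finset (Bond (Site d))} {b : Bond (Site d)} (h : b ∈ F)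
    (ω : Config d) : openBonds F ω b = true := if_pos h

theorem openBonds_of_notMem {F : Finset (Bond (Site d))} {b : Bond (Site d)} (h : b ∉ F)
    (ω : Config d) : openBonds F ω b = ω b := if_neg h

theorem measurable_openBonds (F : Finset (Bond (Site d))) : Measurable (openBonds F) := by
  refine measurable_pi_lambda _ fun b => ?_
  by_cases h : b ∈ F
  · simp only [openBonds_of_mem h, measurable_const]
  · simp only [openBonds_of_notMem h]
    exact measurable_pi_apply b

/-- A translation invariant percolation measure with summable bond densities bounded by `q`,
under which every bond with `q > 0` can be opened at a finite cost. -/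
structure IsTolerant (q : Sym2 (Site d) → ℝ) (P : Measure (Config d)) : Prop where
  isProbabilityMeasure : IsProbabilityMeasure P
  map_shift : ∀ z, P.map (shiftConfig z) = P
  bond_le : ∀ b : Bond (Site d), P {ω | ω b = true} ≤ ENNReal.ofReal (q b.1)
  tolerance : ∀ b : Bond (Site d), 0 < q b.1 →
    ∃ C : ENNReal, C ≠ ⊤ ∧ P.map (openBonds {b}) ≤ C • P

variable {q : Sym2 (Site d) → ℝ} {P : Measure (Config d)}

theorem IsTolerant.map_openBonds_le (h : IsTolerant q P) (F : Finset (Bond (Site d)))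
    (hF : ∀ b ∈ F, 0 < q b.1) : ∃ C : ENNReal, C ≠ ⊤ ∧ P.map (openBonds F) ≤ C • P := by
  classical
  induction F using Finset.induction_on with
  | empty =>
    refine ⟨1, ENNReal.one_ne_top, ?_⟩
    have : openBonds (∅ : Finset (Bond (Site d))) = id := by
      ext ω b; simp [openBonds]
    rw [this, Measure.map_id, one_smul]
  | insert b F hb ih =>
    obtain ⟨C, hC, hCF⟩ := ih fun c hc => hF c (by simp [hc])
    obtain ⟨C', hC', hCb⟩ := h.tolerance b (hF b (by simp))
    refine ⟨C * C', ENNReal.mul_ne_top hC hC', ?_⟩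
    have : openBonds (insert b F) = openBonds {b} ∘ openBonds F := by
      ext ω c
      by_cases h1 : c = b <;> simp [openBonds, h1]
    rw [this, ← Measure.map_map (measurable_openBonds _) (measurable_openBonds _)]
    refine (Measure.map_mono hCF (measurable_openBonds _)).trans ?_
    rw [Measure.map_smul, mul_smul]
    exact Measure.le_iff.2 fun s hs => by
      simp only [Measure.smul_apply]
      exact mul_le_mul_right (Measure.le_iff.1 hCb s hs) C

/-- Translation by `2 L + 1` in each coordinate moves the box of radius `L` off itself, provided
that there is a coordinate. -/
theorem exists_shiftBond_notMem (hd : 0 < d) (E F : Finset (Bond (Site d))) :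
    ∃ z, ∀ b ∈ E, shiftBond z b ∉ F := by
  classical
  obtain ⟨L, hL⟩ := eventually_atTop.1 (eventually_bonds_subset_box (E ∪ F))
  refine ⟨fun _ => 2 * L + 1, fun b hb hbF => ?_⟩
  obtain ⟨⟨e, he⟩, rfl⟩ : ∃ c : Bond (Site d), c = b := ⟨b, rfl⟩
  induction e with | h x y =>
  have h1 := mem_box.1 (hL L le_rfl _ (Finset.mem_union_left F hb) x (by simp)) ⟨0, hd⟩
  have h2 := mem_box.1 (hL L le_rfl _ (Finset.mem_union_right E hbF) (x + fun _ => 2 * (L : ℤ) + 1)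
    (by simp [shiftBond, Bond.map])) ⟨0, hd⟩
  rw [abs_le] at h1 h2
  simp only [Pi.add_apply] at h2
  omega

/-- Translation invariant events are not affected by opening finitely many bonds. -/
theorem IsTolerant.measure_diff_preimage_openBonds (h : IsTolerant q P) (hd : 0 < d)
    {I : Set (Config d)} (hI : MeasurableSet I) (hinv : ∀ z, shiftConfig z ⁻¹' I = I)
    (F : Finset (Bond (Site d))) (hF : ∀ b ∈ F, 0 < q b.1) :
    P (I \ openBonds F ⁻¹' I) = 0 := by
  have := h.isProbabilityMeasure
  obtain ⟨C, hC, hCF⟩ := h.map_openBonds_le F hF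
  have hdense := Measure.MeasureDense.of_generateFrom_isSetAlgebra_finite P
    (isSetAlgebra_measurableCylinders (α := fun _ : Bond (Site d) => Bool))
    generateFrom_measurableCylinders.symm
  -- A cylinder approximating `I` is translated until its bonds avoid `F`. By invariance its
  -- translate `B` still approximates `I`, but `B` does not notice the opening of `F`. The error is
  -- `ε` before the opening and at most `C * ε` after it.
  have key : ∀ ε : NNReal, 0 < ε → P (I \ openBonds F ⁻¹' I) ≤ (1 + C) * ε := by
    intro ε hε
    obtain ⟨A, hA, hIA⟩ := hdense.approx I hI (measure_ne_top _ _) ε (by exact_mod_cast hε)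
    rw [ENNReal.ofReal_coe_nnreal] at hIA
    obtain ⟨E, S, hS, rfl⟩ := (mem_measurableCylinders A).1 hA
    obtain ⟨z, hz⟩ := exists_shiftBond_notMem hd E F
    set A := cylinder (α := fun _ : Bond (Site d) => Bool) E S with hAdef
    have hAm : MeasurableSet A := MeasurableSet.cylinder E hS
    set B := shiftConfig z ⁻¹' A with hB
    have hBm : MeasurableSet B := measurable_shiftConfig z hAm
    have hBT : openBonds F ⁻¹' B = B := by
      ext ω
      simp only [hB, hAdef, Set.mem_preimage, mem_cylinder]
      have : E.restrict (shiftConfig z (openBonds F ω)) = E.restrict (shiftConfig z ω) := by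
        ext b
        exact openBonds_of_notMem (hz b.1 b.2) ω
      rw [this]
    have hIB : P (symmDiff I B) ≤ ε := by
      have : symmDiff I B = shiftConfig z ⁻¹' (symmDiff I A) := by
        rw [Set.preimage_symmDiff, hinv z]
      rw [this, ← Measure.map_apply (measurable_shiftConfig z) (hI.symmDiff hAm), h.map_shift]
      exact hIA.le
    have hsub : I \ openBonds F ⁻¹' I ⊆ symmDiff I B ∪ openBonds F ⁻¹' (symmDiff I B) := by
      intro ω hω
      by_cases hωB : ω ∈ B
      · right
        rw [← hBT] at hωB
        exact Or.inr ⟨hωB, hω.2⟩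
      · exact Or.inl (Or.inl ⟨hω.1, hωB⟩)
    refine (measure_mono hsub).trans ((measure_union_le _ _).trans ?_)
    rw [add_mul, one_mul]
    refine add_le_add hIB ?_
    rw [← Measure.map_apply (measurable_openBonds F) (hI.symmDiff hBm)]
    refine (Measure.le_iff.1 hCF _ (hI.symmDiff hBm)).trans ?_
    rw [Measure.smul_apply, smul_eq_mul]
    gcongr
  by_contra hne
  have hfin : (1 + C) ≠ ⊤ := ENNReal.add_ne_top.2 ⟨ENNReal.one_ne_top, hC⟩
  have hpos : 0 < P (I \ openBonds F ⁻¹' I) / (1 + C) :=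
    ENNReal.div_pos hne hfin
  obtain ⟨ε, hε, hlt⟩ := ENNReal.lt_iff_exists_nnreal_btwn.1 hpos
  have h1 := key ε (by exact_mod_cast hε)
  rw [ENNReal.lt_div_iff_mul_lt (Or.inl (by simp)) (Or.inl hfin), mul_comm] at hlt
  exact absurd h1 (not_le.2 hlt)

end Tolerant

/-! ### The double current percolation is tolerant -/

section PercLaw

variable {d : ℕ} {J : Sym2 (Site d) → ℝ} {β : ℝ}

/-- The factor `2` is the union bound over the two currents. To open a bond it suffices to modify
the first current, the second being left alone. -/
theorem isTolerant_percLaw (hJt : ∀ x y : Site d, J s(x, y) = J s(0, y - x))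
    (hJ : ∀ x y : Site d, 0 ≤ J s(x, y)) (hJs : Summable fun x : Site d => J s(0, x))
    (hβ : 0 ≤ β) : IsTolerant (fun e => 2 * (β * J e)) (percLaw J β) := by
  obtain ⟨-, ξ, -, hμ⟩ := freeLaw_spec (J := J) (β := β) hJt hJ hβ
  obtain ⟨-, η, -, hν⟩ := plusLaw_spec (J := J) (β := β) hJt hJ hJs hβ
  have := hμ.isProbabilityMeasure
  have := hν.isProbabilityMeasure
  refine ⟨isProbabilityMeasure_percLaw hJt hJ hJs hβ, fun z => ?_, fun b => ?_, fun b hb => ?_⟩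
  · rw [percLaw, Measure.map_map (measurable_shiftConfig z) measurable_trace_add]
    have h1 : shiftConfig z ∘ (fun n : Current (Site d) × Current (Site d) => trace (n.1 + n.2)) =
        (fun n => trace (n.1 + n.2)) ∘ Prod.map (shiftCurrent z) (shiftCurrent z) := rfl
    rw [h1, ← Measure.map_map measurable_trace_add
      ((measurable_shiftCurrent z).prodMap (measurable_shiftCurrent z)),
      ← Measure.map_prod_map _ _ (measurable_shiftCurrent z) (measurable_shiftCurrent z),
      hμ.map_shiftCurrent hJt, hν.map_shiftCurrent hJt]
  · rw [percLaw, Measure.map_apply measurable_trace_add (measurableSet_bond_eq b true)]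
    have hsub : (fun n : Current (Site d) × Current (Site d) => trace (n.1 + n.2)) ⁻¹'
        {ω | ω b = true} ⊆ {n | 0 < n b} ×ˢ Set.univ ∪ Set.univ ×ˢ {n | 0 < n b} := by
      intro n hn
      have h0 : 0 < n.1 b + n.2 b := by simpa [trace] using! hn
      rcases Nat.add_pos_iff_pos_or_pos.1 h0 with h | h
      · exact Or.inl ⟨h, trivial⟩
      · exact Or.inr ⟨trivial, h⟩
    refine (measure_mono hsub).trans ((measure_union_le _ _).trans ?_)
    rw [Measure.prod_prod, Measure.prod_prod, measure_univ, measure_univ, mul_one, one_mul,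
      two_mul, ENNReal.ofReal_add (mul_nonneg hβ (bond_nonneg hJ b))
        (mul_nonneg hβ (bond_nonneg hJ b)), ← ofReal_measureReal, ← ofReal_measureReal]
    exact add_le_add (ENNReal.ofReal_le_ofReal (hμ.measureReal_bond_pos_le hJ hβ b))
      (ENNReal.ofReal_le_ofReal (hν.measureReal_bond_pos_le hJ hβ b))
  · have hb' : 0 < β * J b.1 := by linarith
    refine ⟨ENNReal.ofReal (1 + 2 / (β * J b.1) ^ 2), ENNReal.ofReal_ne_top, ?_⟩
    have hle := hμ.map_openCurrent_le hb'
    have h1 : openBonds {b} ∘ (fun n : Current (Site d) × Current (Site d) => trace (n.1 + n.2)) =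
        (fun n => trace (n.1 + n.2)) ∘ Prod.map (openCurrent b) id := by
      ext n c
      by_cases hc : c = b
      · subst hc
        by_cases h0 : n.1 c = 0 <;>
          simp [openBonds, trace, openCurrent_self, h0, Nat.pos_iff_ne_zero]
      · simp [openBonds, trace, openCurrent_of_ne hc, hc]
    rw [percLaw, Measure.map_map (measurable_openBonds _) measurable_trace_add, h1,
      ← Measure.map_map measurable_trace_add ((measurable_openCurrent b).prodMap measurable_id),
      ← Measure.map_prod_map _ _ (measurable_openCurrent b) measurable_id, Measure.map_id]
    refine (Measure.map_mono (Measure.prod_mono hle le_rfl) measurable_trace_add).trans ?_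
    rw [Measure.prod_smul_left, Measure.map_smul]

end PercLaw

/-! ### Trifurcations in graphs -/

section Trifurcation

variable {V : Type*}

/-- The graph `G` with the vertices of `S` isolated. -/
def avoid (G : SimpleGraph V) (S : Set V) : SimpleGraph V where
  Adj u v := G.Adj u v ∧ u ∉ S ∧ v ∉ S
  symm := ⟨fun _ _ h => ⟨h.1.symm, h.2.2, h.2.1⟩⟩
  loopless := ⟨fun _ h => h.1.ne rfl⟩

theorem avoid_le (G : SimpleGraph V) (S : Set V) : avoid G S ≤ G := fun _ _ h => h.1

theorem avoid_anti (G : SimpleGraph V) {S T : Set V} (h : S ⊆ T) : avoid G T ≤ avoid G S :=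
  fun _ _ huv => ⟨huv.1, fun hu => huv.2.1 (h hu), fun hv => huv.2.2 (h hv)⟩

theorem Reachable.notMem_of_avoid {G : SimpleGraph V} {S : Set V} {x v : V} (hx : x ∉ S)
    (h : (avoid G S).Reachable x v) : v ∉ S := by
  obtain ⟨p⟩ := h
  induction p with
  | nil => exact hx
  | cons h _ ih => exact ih h.2.2

/-- A path leaving `A` has a first step out of `A`. -/
theorem exists_adj_of_reachable {H : SimpleGraph V} {A : Set V} {a b : V}
    (h : H.Reachable a b) (ha : a ∈ A) (hb : b ∉ A) :
    ∃ u ∈ A, ∃ v ∉ A, H.Adj u v ∧ (avoid H Aᶜ).Reachable a u := by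
  obtain ⟨p⟩ := h
  induction p with
  | nil => exact absurd ha hb
  | @cons a c b hac p ih =>
    by_cases hc : c ∈ A
    · obtain ⟨u, hu, v, hv, huv, hr⟩ := ih hc hb
      have hadj : (avoid H Aᶜ).Adj a c := ⟨hac, by simpa using ha, by simpa using hc⟩
      exact ⟨u, hu, v, hv, huv, hadj.reachable.trans hr⟩
    · exact ⟨a, ha, c, hc, hac, SimpleGraph.Reachable.refl _⟩

/-- An infinite cluster of a locally finite graph has an infinite piece outside a finite set. -/
theorem exists_infinite_avoid {G : SimpleGraph V} (hG : ∀ v, {w | G.Adj v w}.Finite)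
    {S : Set V} (hS : S.Finite) {x : V} (hx : x ∈ S) (hinf : {v | G.Reachable x v}.Infinite) :
    ∃ x', x' ∉ S ∧ G.Reachable x x' ∧ {v | (avoid G S).Reachable x' v}.Infinite := by
  by_contra! hcon
  refine hinf ?_
  -- A site of the cluster outside `S` is joined off `S` to a neighbour of `S`. Local finiteness
  -- leaves finitely many such neighbours, so their pieces cannot all be finite.
  have hN : {y | y ∉ S ∧ G.Reachable x y ∧ ∃ s ∈ S, G.Adj s y}.Finite :=
    (hS.biUnion fun s _ => hG s).subset fun y hy => by
      obtain ⟨s, hs, hsy⟩ := hy.2.2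
      exact Set.mem_biUnion hs hsy
  refine (hS.union (hN.biUnion (t := fun y => {v | (avoid G S).Reachable y v})
    fun y hy => ?_)).subset fun v hv => ?_
  · exact hcon y hy.1 hy.2.1
  · by_cases hvS : v ∈ S
    · exact Or.inl hvS
    · right
      obtain ⟨u, hu, w, hw, huw, hr⟩ :=
        exists_adj_of_reachable (A := Sᶜ) (SimpleGraph.Reachable.symm hv) hvS (by simpa using hx)
      rw [compl_compl] at hr
      refine Set.mem_biUnion (x := u) ⟨hu, ?_, w, by simpa using hw, huw.symm⟩ hr.symm
      exact SimpleGraph.Reachable.trans hv (hr.mono (avoid_le G S))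

/-- Adding edges between finitely many vertices only merges clusters. -/
theorem exists_infinite_of_le {G G' : SimpleGraph V} {W : Set V} (hW : W.Finite)
    (hGW : ∀ u v, G'.Adj u v → G.Adj u v ∨ u ∈ W) {x : V}
    (hinf : {v | G'.Reachable x v}.Infinite) :
    ∃ w, G'.Reachable x w ∧ {v | G.Reachable w v}.Infinite := by
  by_contra! hcon
  refine hinf ?_
  have hN : {w | (w ∈ W ∨ w = x) ∧ G'.Reachable x w}.Finite :=
    (hW.union (Set.finite_singleton x)).subset fun w hw => hw.1
  refine (hN.biUnion (t := fun w => {v | G.Reachable w v})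
    fun w hw => hcon w hw.2).subset fun v hv => ?_
  by_cases hvx : G.Reachable x v
  · exact Set.mem_biUnion (x := x) ⟨Or.inr rfl, SimpleGraph.Reachable.refl _⟩ hvx
  · obtain ⟨u, hu, w, hw, huw, hr⟩ := exists_adj_of_reachable (A := {u | G.Reachable v u})
      (SimpleGraph.Reachable.symm hv) (SimpleGraph.Reachable.refl _) (fun h => hvx h.symm)
    refine Set.mem_biUnion (x := u) ⟨Or.inl ?_, ?_⟩ (SimpleGraph.Reachable.symm hu)
    · exact (hGW u w huw).resolve_left fun h => hw (SimpleGraph.Reachable.trans hu h.reachable)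
    · exact SimpleGraph.Reachable.trans hv (hr.mono (avoid_le G' _))

/-- `S` is a connected set whose removal leaves at least three infinite pieces of its cluster. -/
structure IsTrifurcation (G : SimpleGraph V) (S : Set V) : Prop where
  nonempty : S.Nonempty
  connected : ∀ u ∈ S, ∀ v ∈ S, (avoid G Sᶜ).Reachable u v
  exists_pieces : ∃ x : Fin 3 → V, (∀ i, x i ∉ S) ∧
    (∀ i j, i ≠ j → ¬ (avoid G S).Reachable (x i) (x j)) ∧
    (∀ i, {v | (avoid G S).Reachable (x i) v}.Infinite) ∧
    ∀ i, ∀ s ∈ S, G.Reachable s (x i)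

/-- The piece of `x` after the removal of `S`. -/
def piece (G : SimpleGraph V) (S : Set V) (x : V) : Set V := {v | (avoid G S).Reachable x v}

variable {G : SimpleGraph V} {S T : Set V} {x y r u v : V}

theorem mem_piece_of_adj (hu : u ∈ piece G S x) (hx : x ∉ S) (huv : G.Adj u v) (hv : v ∉ S) :
    v ∈ piece G S x := by
  have : (avoid G S).Adj u v := ⟨huv, Reachable.notMem_of_avoid hx hu, hv⟩
  exact SimpleGraph.Reachable.trans hu this.reachable

theorem mem_piece_of_reachable (hu : u ∈ piece G S x) (h : (avoid G S).Reachable u v) :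
    v ∈ piece G S x := SimpleGraph.Reachable.trans hu h

theorem subset_piece_of_mem (hT : ∀ u ∈ T, ∀ v ∈ T, (avoid G Tᶜ).Reachable u v)
    (hST : Disjoint S T) (hu : u ∈ T) (hux : u ∈ piece G S x) : T ⊆ piece G S x := fun v hv =>
  mem_piece_of_reachable hux
    ((hT u hu v hv).mono (avoid_anti G fun _ ha hb => hST.le_bot ⟨ha, hb⟩))

/-- If `T` lies in a piece of the complement of `S`, then so do the pieces of the complement of
`T` which do not contain a given vertex outside. -/
theorem piece_subset_piece (hS : ∀ u ∈ S, ∀ v ∈ S, (avoid G Sᶜ).Reachable u v)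
    (hST : Disjoint S T) (hxS : x ∉ S) (hyT : y ∉ T) (hT : T ⊆ piece G S x)
    (hrS : r ∉ S) (hrx : r ∉ piece G S x) (hry : r ∉ piece G T y) {t : V} (ht : t ∈ T)
    (hty : G.Reachable t y) (hrt : G.Reachable r t) : piece G T y ⊆ piece G S x := by
  intro v hv
  by_contra hvx
  have hyt : G.Reachable v t := (hty.trans (SimpleGraph.Reachable.mono (avoid_le G T) hv)).symm
  obtain ⟨u, hu, w, hw, huw, hr⟩ := exists_adj_of_reachable hyt hv
    (fun h => Reachable.notMem_of_avoid hyT h ht)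
  have hwT : w ∈ T := by
    by_contra hwT
    exact hw (mem_piece_of_adj hu hyT huw hwT)
  -- Otherwise the path from `v` to `u` stays off `S`; as `u` is adjacent to `T`, which lies in the
  -- piece of `x`, so would `v`.
  have hmeet : ∃ s ∈ S, s ∈ piece G T y := by
    by_contra! hno
    have huS : u ∉ S := fun h => hno u h hu
    have hux : u ∈ piece G S x := mem_piece_of_adj (hT hwT) hxS huw.symm huS
    exact hvx (mem_piece_of_reachable hux (hr.symm.mono (avoid_anti G hno)))
  obtain ⟨s, hs, hsy⟩ := hmeet
  have hSy : S ⊆ piece G T y := subset_piece_of_mem hS hST.symm hs hsy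
  -- A path from `r` to `T` can enter the piece of `x` only through `S`, which now lies in the piece
  -- of `y`. Until it reaches `S` it avoids `T`, so `r` would be in the piece of `y`.
  obtain ⟨u', hu', w', hw', huw', hr'⟩ := exists_adj_of_reachable (A := (S ∪ piece G S x)ᶜ) hrt
    (by simp [hrS, hrx]) (by simp [hT ht])
  rw [compl_compl] at hr'
  simp only [Set.mem_compl_iff, Set.mem_union, not_or, not_and_or, not_not] at hu' hw'
  have hw'S : w' ∈ S := hw'.resolve_right fun h => hu'.2 (mem_piece_of_adj h hxS huw'.symm hu'.1)
  have hu'y : u' ∈ piece G T y :=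
    mem_piece_of_adj (hSy hw'S) hyT huw'.symm fun h => hu'.2 (hT h)
  exact hry (mem_piece_of_reachable hu'y
    (hr'.symm.mono (avoid_anti G fun a ha => Or.inr (hT ha))))

/-- From a common vertex, follow a path to `S` until it leaves the piece of `x`. Up to there it
avoids `T`, so it stays in the piece of `y`, and its next vertex is in `S`, against `h2`. -/
theorem disjoint_piece_piece (hST : Disjoint S T) (hxS : x ∉ S) (hyT : y ∉ T)
    (h1 : Disjoint T (piece G S x)) (h2 : Disjoint S (piece G T y)) {s : V} (hs : s ∈ S)
    (hsx : G.Reachable s x) : Disjoint (piece G S x) (piece G T y) := by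
  rw [Set.disjoint_left]
  intro v hvx hvy
  have hvs : G.Reachable v s := (hsx.trans (SimpleGraph.Reachable.mono (avoid_le G S) hvx)).symm
  obtain ⟨u, hu, w, hw, huw, hr⟩ := exists_adj_of_reachable hvs hvx
    (fun h => Reachable.notMem_of_avoid hxS h hs)
  have hwS : w ∈ S := by
    by_contra hwS
    exact hw (mem_piece_of_adj hu hxS huw hwS)
  have huy : u ∈ piece G T y := mem_piece_of_reachable hvy
    (hr.mono (avoid_anti G fun a ha hb => h1.le_bot ⟨ha, hb⟩))
  exact h2.le_bot ⟨hwS, mem_piece_of_adj huy hyT huw fun h => hST.le_bot ⟨hwS, h⟩⟩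

/-- Every infinite piece meets the outer boundary of a finite set that contains `S`. -/
theorem exists_mem_boundary {Λ : Set V} (hΛ : Λ.Finite) (hSΛ : S ⊆ Λ)
    (hinf : (piece G S x).Infinite) {s : V} (hs : s ∈ S) (hsx : G.Reachable s x) :
    ∃ y ∈ piece G S x, y ∉ Λ ∧ ∃ z ∈ Λ, G.Adj z y := by
  by_cases hxΛ : x ∈ Λ
  · obtain ⟨v, hv, hvΛ⟩ := hinf.exists_notMem_finite hΛ
    obtain ⟨u, hu, w, hw, huw, hr⟩ := exists_adj_of_reachable hv hxΛ hvΛ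
    exact ⟨w, SimpleGraph.Reachable.trans (hr.mono (avoid_le _ _)) huw.reachable, hw, u, hu, huw.1⟩
  · obtain ⟨u, hu, w, hw, huw, hr⟩ := exists_adj_of_reachable (A := Λᶜ) hsx.symm hxΛ
      (by simpa using hSΛ hs)
    rw [compl_compl] at hr
    exact ⟨u, hr.mono (avoid_anti G hSΛ), hu, w, by simpa using hw, huw.symm⟩

/-- At most one of three disjoint pieces contains the root `ρ` of the cluster. The other two are
kept, each marked by its vertex of `Y` of least rank `e`. -/
theorem IsTrifurcation.exists_two_pieces (hS : IsTrifurcation G S) {Λ : Set V} (hΛ : Λ.Finite)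
    (hSΛ : S ⊆ Λ) {Y : Finset V} (hY : ∀ y ∉ Λ, (∃ z ∈ Λ, G.Adj z y) → y ∈ Y) (e : V → ℕ)
    {ρ : V → V} (hρ : ∀ u v, G.Reachable u v → ρ u = ρ v)
    (hρY : ∀ u, (∃ y ∈ Y, G.Reachable u y) → G.Reachable u (ρ u) ∧ ρ u ∈ Y) :
    ∃ (x : Bool → V) (m : Bool → V), (∀ a, x a ∉ S) ∧
      (∀ a b, a ≠ b → Disjoint (piece G S (x a)) (piece G S (x b))) ∧
      (∀ a, ∀ s ∈ S, G.Reachable s (x a)) ∧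
      (∀ a, ∀ s ∈ S, ρ s ∉ piece G S (x a)) ∧
      (∀ a, m a ∈ Y ∧ m a ∈ piece G S (x a) ∧
        ∀ y ∈ Y, y ∈ piece G S (x a) → e (m a) ≤ e y) ∧
      (∀ s ∈ S, G.Reachable s (ρ s) ∧ ρ s ∈ Y) := by
  classical
  obtain ⟨⟨s₀, hs₀⟩, -, x, hxS, hxd, hxi, hxr⟩ := hS
  have hYx : ∀ j, ∃ y ∈ piece G S (x j), y ∈ Y := fun j => by
    obtain ⟨y, h1, h2, h3⟩ := exists_mem_boundary hΛ hSΛ (hxi j) hs₀ (hxr j s₀ hs₀)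
    exact ⟨y, h1, hY y h2 h3⟩
  have hm : ∀ j, ∃ m, m ∈ Y ∧ m ∈ piece G S (x j) ∧
      ∀ y ∈ Y, y ∈ piece G S (x j) → e m ≤ e y := by
    intro j
    obtain ⟨y, h1, h2⟩ := hYx j
    obtain ⟨m, hm, hmin⟩ := Finset.exists_min_image
      (Y.filter fun y => y ∈ piece G S (x j)) e ⟨y, Finset.mem_filter.2 ⟨h2, h1⟩⟩
    rw [Finset.mem_filter] at hm
    exact ⟨m, hm.1, hm.2, fun y hy hyx => hmin y (Finset.mem_filter.2 ⟨hy, hyx⟩)⟩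
  choose m hm using hm
  have hρs : ∀ s ∈ S, ρ s = ρ s₀ := fun s hs =>
    hρ s s₀ ((hxr 0 s hs).trans (hxr 0 s₀ hs₀).symm)
  have hdis : ∀ j k, j ≠ k → Disjoint (piece G S (x j)) (piece G S (x k)) := by
    intro j k hjk
    rw [Set.disjoint_left]
    intro v hv hv'
    exact hxd j k hjk (SimpleGraph.Reachable.trans hv (SimpleGraph.Reachable.symm hv'))
  obtain ⟨j, k, hjk, hj, hk⟩ : ∃ j k : Fin 3, j ≠ k ∧ ρ s₀ ∉ piece G S (x j) ∧
      ρ s₀ ∉ piece G S (x k) := by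
    have hd : ∀ j k, j ≠ k → ρ s₀ ∈ piece G S (x j) → ρ s₀ ∉ piece G S (x k) :=
      fun j k h hj => Set.disjoint_left.1 (hdis j k h) hj
    by_cases h0 : ρ s₀ ∈ piece G S (x 0)
    · exact ⟨1, 2, by decide, hd 0 1 (by decide) h0, hd 0 2 (by decide) h0⟩
    · by_cases h1 : ρ s₀ ∈ piece G S (x 1)
      · exact ⟨0, 2, by decide, h0, hd 1 2 (by decide) h1⟩
      · exact ⟨0, 1, by decide, h0, h1⟩
  refine ⟨fun a => bif a then x j else x k, fun a => bif a then m j else m k,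
    ?_, ?_, ?_, ?_, ?_, ?_⟩
  · rintro (_ | _) <;> exact hxS _
  · rintro (_ | _) (_ | _) hab
    · exact absurd rfl hab
    · exact hdis _ _ hjk.symm
    · exact hdis _ _ hjk
    · exact absurd rfl hab
  · rintro (_ | _) <;> exact hxr _
  · rintro (_ | _) s hs <;> rw [hρs s hs] <;> assumption
  · rintro (_ | _) <;> exact hm _
  · intro s hs
    obtain ⟨y, h1, h2⟩ := hYx 0
    exact hρY s ⟨y, h2, (hxr 0 s hs).trans (SimpleGraph.Reachable.mono (avoid_le _ _) h1)⟩

/-- A vertex of `Y` for every cluster that meets `Y`. -/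
theorem exists_root (G : SimpleGraph V) (Y : Finset V) :
    ∃ ρ : V → V, (∀ u v, G.Reachable u v → ρ u = ρ v) ∧
      ∀ u, (∃ y ∈ Y, G.Reachable u y) → G.Reachable u (ρ u) ∧ ρ u ∈ Y := by
  have : ∀ c : G.ConnectedComponent, ∃ y, (∃ y ∈ Y, G.connectedComponentMk y = c) →
      y ∈ Y ∧ G.connectedComponentMk y = c := by
    intro c
    by_cases h : ∃ y ∈ Y, G.connectedComponentMk y = c
    · obtain ⟨y, h1, h2⟩ := h
      exact ⟨y, fun _ => ⟨h1, h2⟩⟩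
    · exact ⟨c.out, fun h' => absurd h' h⟩
  choose f hf using this
  refine ⟨fun u => f (G.connectedComponentMk u), fun u v h => ?_, fun u hu => ?_⟩
  · exact congrArg f (SimpleGraph.ConnectedComponent.eq.2 h)
  · obtain ⟨y, hy, huy⟩ := hu
    obtain ⟨h1, h2⟩ := hf (G.connectedComponentMk u)
      ⟨y, hy, SimpleGraph.ConnectedComponent.eq.2 huy.symm⟩
    exact ⟨(SimpleGraph.ConnectedComponent.eq.1 h2).symm, h1⟩

/-- Disjoint trifurcations in a finite set are at most as many as its boundary vertices. -/
theorem card_trifurcation_le {ι : Type*} [Fintype ι] [Countable V] {G : SimpleGraph V}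
    {S : ι → Set V} (hS : ∀ i, IsTrifurcation G (S i)) (hdisj : ∀ i j, i ≠ j → Disjoint (S i) (S j))
    {Λ : Set V} (hΛ : Λ.Finite) (hSΛ : ∀ i, S i ⊆ Λ) {Y : Finset V}
    (hY : ∀ y ∉ Λ, (∃ z ∈ Λ, G.Adj z y) → y ∈ Y) (hYΛ : ∀ y ∈ Y, y ∉ Λ) :
    Fintype.card ι ≤ Y.card := by
  classical
  obtain ⟨e, he⟩ := exists_injective_nat V
  obtain ⟨ρ, hρ, hρY⟩ := exists_root G Y
  choose x m hxS hdis hxr hρx hm hρS using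
    fun i => (hS i).exists_two_pieces hΛ (hSΛ i) hY e hρ hρY
  -- Each trifurcation is sent to whichever of its two markers has the larger rank; this map turns
  -- out to be injective.
  choose b hb using fun i => Finite.exists_max fun a => e (m i a)
  have key : ∀ i j, i ≠ j → m i (b i) = m j (b j) →
      ∀ a, Disjoint (S j) (piece G (S i) (x i a)) := by
    intro i j hij heq a
    rw [Set.disjoint_left]
    intro s hs hsa
    have hsub := subset_piece_of_mem (hS j).connected (hdisj i j hij) hs hsa
    obtain ⟨s', hs'⟩ := (hS i).nonempty
    have hss' : G.Reachable s s' :=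
      ((hxr i a s' hs').trans (SimpleGraph.Reachable.mono (avoid_le _ _) hsa)).symm
    have hle : ∀ c, piece G (S j) (x j c) ⊆ piece G (S i) (x i a) := fun c =>
      piece_subset_piece (hS i).connected (hdisj i j hij) (hxS i a) (hxS j c) hsub
        (fun h => hYΛ _ (hρS j s hs).2 (hSΛ i h)) (by rw [hρ s s' hss']; exact hρx i a s' hs')
        (hρx j c s hs) hs (hxr j c s hs) (hρS j s hs).1.symm
    -- The pieces of `j`, and hence its markers, lie in the piece `a` of `i`; the common marker is
    -- one of them.
    have hba : b i = a := by
      by_contra hba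
      refine (hdis i _ _ hba).le_bot ⟨(hm i (b i)).2.1, ?_⟩
      rw [heq]
      exact hle _ (hm j (b j)).2.1
    -- The common marker has least rank in a piece that contains both markers of `j`, yet the larger
    -- rank of these two. So the two coincide, although their pieces are disjoint.
    have h1 : e (m j (b j)) ≤ e (m j (!b j)) := by
      rw [← heq, hba]
      exact (hm i a).2.2 _ (hm j _).1 (hle _ (hm j _).2.1)
    have h2 : m j (b j) = m j (!b j) := he (h1.antisymm (hb j _))
    refine (hdis j (b j) (!b j) (by simp)).le_bot ⟨(hm j _).2.1, ?_⟩
    rw [h2]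
    exact (hm j _).2.1
  refine Finset.card_le_card_of_injOn (s := Finset.univ) (fun i => m i (b i))
    (fun i _ => (hm i (b i)).1) ?_
  intro i _ j _ heq
  by_contra hij
  obtain ⟨s, hs⟩ := (hS i).nonempty
  refine (disjoint_piece_piece (hdisj i j hij) (hxS i (b i)) (hxS j (b j)) (key i j hij heq _)
    (key j i (Ne.symm hij) heq.symm _) hs (hxr i (b i) s hs)).le_bot ⟨(hm i (b i)).2.1, ?_⟩
  simp only at heq
  rw [heq]
  exact (hm j (b j)).2.1

end Trifurcation

/-! ### Invariance of trifurcations under graph isomorphisms -/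

section Transport

variable {V W : Type*} {G : SimpleGraph V} {H : SimpleGraph W}

/-- The restriction of a graph isomorphism to the complement of a set of vertices. -/
def avoidIso (f : G ≃g H) {S : Set V} {T : Set W} (h : ∀ v, f v ∈ T ↔ v ∈ S) :
    avoid G S ≃g avoid H T where
  toEquiv := f.toEquiv
  map_rel_iff' := by
    intro a b
    change (H.Adj (f a) (f b) ∧ f a ∉ T ∧ f b ∉ T) ↔ (G.Adj a b ∧ a ∉ S ∧ b ∉ S)
    rw [f.map_adj_iff, h, h]

theorem infinite_cluster_iff (f : G ≃g H) (x : V) :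
    {v | G.Reachable x v}.Infinite ↔ {w | H.Reachable (f x) w}.Infinite := by
  have : {w | H.Reachable (f x) w} = f '' {v | G.Reachable x v} := by
    ext w
    constructor
    · intro hw
      refine ⟨f.symm w, ?_, f.apply_symm_apply w⟩
      have h2 : H.Reachable (f x) (f (f.symm w)) := by rw [f.apply_symm_apply]; exact hw
      exact f.reachable_iff.1 h2
    · rintro ⟨v, hv, rfl⟩
      exact f.reachable_iff.2 hv
  rw [this, Set.infinite_image_iff f.injective.injOn]

theorem IsTrifurcation.map (f : G ≃g H) {S : Set V} {T : Set W} (h : ∀ v, f v ∈ T ↔ v ∈ S)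
    (hS : IsTrifurcation G S) : IsTrifurcation H T := by
  have hc : ∀ v, f v ∈ Tᶜ ↔ v ∈ Sᶜ := fun v => not_congr (h v)
  have hsurj : ∀ w ∈ T, ∃ v ∈ S, f v = w := fun w hw =>
    ⟨f.symm w, (h _).1 (by rwa [f.apply_symm_apply]), f.apply_symm_apply w⟩
  obtain ⟨⟨s, hs⟩, hcon, x, h1, h2, h3, h4⟩ := hS
  refine ⟨⟨f s, (h s).2 hs⟩, fun u hu v hv => ?_, fun i => f (x i), fun i => ?_,
    fun i j hij => ?_, fun i => ?_, fun i w hw => ?_⟩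
  · obtain ⟨a, ha, rfl⟩ := hsurj u hu
    obtain ⟨b, hb, rfl⟩ := hsurj v hv
    exact (avoidIso f hc).reachable_iff.2 (hcon a ha b hb)
  · rw [h]; exact h1 i
  · exact fun hr => h2 i j hij ((avoidIso f h).reachable_iff.1 hr)
  · exact (infinite_cluster_iff (avoidIso f h) (x i)).1 (h3 i)
  · obtain ⟨a, ha, rfl⟩ := hsurj w hw
    exact f.reachable_iff.2 (h4 i a ha)

theorem isTrifurcation_iff (f : G ≃g H) {S : Set V} {T : Set W} (h : ∀ v, f v ∈ T ↔ v ∈ S) :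
    IsTrifurcation G S ↔ IsTrifurcation H T :=
  ⟨fun hS => hS.map f h, fun hT => hT.map f.symm fun w => by
    rw [← h, f.apply_symm_apply]⟩

end Transport

/-! ### Boundary-to-volume ratio of boxes -/

section Volume

variable {d : ℕ}

theorem card_box (L : ℕ) : (box d L).card = (2 * L + 1) ^ d := by
  rw [box, Pi.card_Icc]
  simp only [Int.card_Icc, Finset.prod_const, Finset.card_univ, Fintype.card_fin]
  congr 1
  omega

/-- The number of sites of a box that are moved out of it by a translation. -/
def exitCount (L : ℕ) (z : Site d) : ℕ :=
  ((box d L).filter fun x => x + z ∉ box d L).card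

theorem exitCount_le_card (L : ℕ) (z : Site d) : exitCount L z ≤ (box d L).card :=
  Finset.card_filter_le _ _

/-- Translation by `z` keeps the smaller box inside the larger one, so the sites that leave the
larger box come from the shell between them. -/
theorem card_box_le_add_exitCount (L : ℕ) (z : Site d) :
    (box d L).card + exitCount (L + siteNorm z) z ≤ (box d (L + siteNorm z)).card := by
  rw [exitCount, ← Finset.card_union_of_disjoint]
  · refine Finset.card_le_card (Finset.union_subset (box_mono (by omega))
      (Finset.filter_subset _ _))
  · rw [Finset.disjoint_left]
    intro x hx hx'
    exact (Finset.mem_filter.1 hx').2 (add_mem_box hx z)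

theorem tendsto_exitCount_div_card (z : Site d) :
    Tendsto (fun L => (exitCount L z : ℝ) / (box d L).card) atTop (𝓝 0) := by
  rw [← tendsto_add_atTop_iff_nat (siteNorm z)]
  set m := siteNorm z
  have hlim : Tendsto (fun L : ℕ => 1 - ((2 * (L : ℝ) + 1) / (2 * (L + m : ℕ) + 1)) ^ d) atTop
      (𝓝 (1 - 1 ^ d)) := by
    refine tendsto_const_nhds.sub (Tendsto.pow ?_ d)
    have h1 : Tendsto (fun L : ℕ => 1 - (2 * m : ℝ) * ((2 * (L + m : ℕ) + 1 : ℝ))⁻¹) atTop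
        (𝓝 (1 - (2 * m : ℝ) * 0)) := by
      refine tendsto_const_nhds.sub (tendsto_const_nhds.mul ?_)
      refine tendsto_inv_atTop_zero.comp (tendsto_atTop_add_const_right _ _ ?_)
      exact Tendsto.const_mul_atTop two_pos
        (tendsto_natCast_atTop_atTop.comp (tendsto_add_atTop_nat m))
    rw [mul_zero, sub_zero] at h1
    refine h1.congr fun L => ?_
    push_cast
    have : (2 * ((L : ℝ) + m) + 1) ≠ 0 := by positivity
    field_simp
    ring
  rw [one_pow, sub_self] at hlim
  refine squeeze_zero (fun L => by positivity) (fun L => ?_) hlim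
  have hpos : (0 : ℝ) < (box d (L + m)).card := by rw [card_box]; positivity
  rw [div_le_iff₀ hpos, sub_mul, one_mul, le_sub_iff_add_le]
  have h2 : ((2 * (L : ℝ) + 1) / (2 * (L + m : ℕ) + 1)) ^ d * (box d (L + m)).card =
      (box d L).card := by
    rw [card_box, card_box]
    push_cast
    rw [div_pow, div_mul_cancel₀]
    positivity
  rw [h2, add_comm]
  exact_mod_cast card_box_le_add_exitCount L z

variable {q : Sym2 (Site d) → ℝ}

/-- Dominated convergence with majorant `q s(0, z)`: summability of the couplings takes the place of
a finite range. -/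
theorem tendsto_tsum_exitCount (hq : ∀ x y : Site d, 0 ≤ q s(x, y))
    (hqs : Summable fun x : Site d => q s(0, x)) :
    Tendsto (fun L => ∑' z : Site d, q s(0, z) * ((exitCount L z : ℝ) / (box d L).card)) atTop
      (𝓝 0) := by
  have := tendsto_tsum_of_dominated_convergence (𝓕 := atTop)
    (f := fun (L : ℕ) (z : Site d) => q s(0, z) * ((exitCount L z : ℝ) / (box d L).card))
    (g := fun _ => 0) hqs
    (fun z => by simpa using (tendsto_exitCount_div_card z).const_mul (q s(0, z)))
    (Eventually.of_forall fun L z => by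
      rw [Real.norm_of_nonneg (mul_nonneg (hq _ _) (by positivity))]
      refine mul_le_of_le_one_right (hq _ _) (div_le_one_of_le₀ ?_ (by positivity))
      exact_mod_cast exitCount_le_card L z)
  simpa using this

/-- Both sides add `q` over the pairs that cross the boundary of the box; on the right they are
grouped by their difference `z = y - x`. -/
theorem tsum_boundary_eq (hqt : ∀ x y : Site d, q s(x, y) = q s(0, y - x))
    (hq : ∀ x y : Site d, 0 ≤ q s(x, y)) (hqs : Summable fun x : Site d => q s(0, x)) (L : ℕ) :
    ∑' y : {y : Site d // y ∉ box d L}, ∑ x ∈ box d L, ENNReal.ofReal (q s(x, y.1)) =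
      ENNReal.ofReal (∑' z : Site d, q s(0, z) * exitCount L z) := by
  classical
  rw [ENNReal.ofReal_tsum_of_nonneg (fun z => mul_nonneg (hq _ _) (Nat.cast_nonneg _))]
  · rw [Summable.tsum_finsetSum fun x _ => ENNReal.summable]
    have h1 : ∀ x, ∑' y : {y : Site d // y ∉ box d L}, ENNReal.ofReal (q s(x, y.1)) =
        ∑' z, if x + z ∉ box d L then ENNReal.ofReal (q s(0, z)) else 0 := by
      intro x
      refine (tsum_subtype {y | y ∉ box d L} fun y => ENNReal.ofReal (q s(x, y))).trans ?_
      rw [← (Equiv.addLeft x).tsum_eq]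
      refine tsum_congr fun z => ?_
      simp only [Set.indicator, Equiv.coe_addLeft, Set.mem_ofPred_eq]
      rw [hqt, add_sub_cancel_left]
      congr
    simp only [h1]
    rw [← Summable.tsum_finsetSum fun x _ => ENNReal.summable]
    refine tsum_congr fun z => ?_
    rw [← Finset.sum_filter, Finset.sum_const, ENNReal.ofReal_mul (hq _ _), ENNReal.ofReal_natCast,
      mul_comm, nsmul_eq_mul, exitCount]
  · refine Summable.of_nonneg_of_le (fun z => mul_nonneg (hq _ _) (Nat.cast_nonneg _)) (fun z => ?_)
      (hqs.mul_right ((box d L).card : ℝ))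
    exact mul_le_mul_of_nonneg_left (by exact_mod_cast exitCount_le_card L z) (hq _ _)

end Volume

/-! ### Finite connecting sets from aperiodicity -/

section Connecting

variable {d : ℕ} {q : Sym2 (Site d) → ℝ}

theorem exists_connecting_set_single
    (hqa : ∀ x : Site d, Relation.ReflTransGen (fun u v => 0 < q s(u, v)) 0 x) (x : Site d) :
    ∃ (S : Finset (Site d)) (F : Finset (Bond (Site d))), 0 ∈ S ∧ x ∈ S ∧
      (∀ b ∈ F, 0 < q b.1 ∧ ∀ v ∈ b.1, v ∈ S) ∧
      ∀ G : SimpleGraph (Site d), (∀ b ∈ F, ∀ u v, b.1 = s(u, v) → G.Adj u v) →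
        ∀ u ∈ S, (avoid G (S : Set (Site d))ᶜ).Reachable 0 u := by
  classical
  induction hqa x with
  | refl =>
    refine ⟨{0}, ∅, by simp, by simp, by simp, fun G _ u hu => ?_⟩
    rw [Finset.mem_singleton.1 hu]
  | @tail u v _ huv ih =>
    obtain ⟨S, F, h0, hu, hF, hG⟩ := ih
    -- The relation allows a step from a site to itself, which is not a bond and is skipped.
    by_cases huv' : u = v
    · exact ⟨S, F, h0, huv' ▸ hu, hF, hG⟩
    · have hmono : ∀ G : SimpleGraph (Site d), avoid G (S : Set (Site d))ᶜ ≤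
          avoid G ((insert v S : Finset (Site d)) : Set (Site d))ᶜ := fun G =>
        avoid_anti G (Set.compl_subset_compl.2 (by simp))
      refine ⟨insert v S, insert ⟨s(u, v), by simpa using huv'⟩ F, by simp [h0], by simp,
        fun b hb => ?_, fun G hFG w hw => ?_⟩
      · rcases Finset.mem_insert.1 hb with rfl | hb
        · refine ⟨huv, fun w hw => ?_⟩
          rcases Sym2.mem_iff.1 hw with rfl | rfl <;> simp [hu]
        · exact ⟨(hF b hb).1, fun w hw => Finset.mem_insert_of_mem ((hF b hb).2 w hw)⟩
      · have hS : ∀ w ∈ S, (avoid G ((insert v S : Finset (Site d)) : Set (Site d))ᶜ).Reachable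
            0 w := fun w hw =>
          (hG G (fun b hb => hFG b (Finset.mem_insert_of_mem hb)) w hw).mono (hmono G)
        rcases Finset.mem_insert.1 hw with rfl | hw
        · refine (hS u hu).trans (SimpleGraph.Adj.reachable ⟨?_, by simp [hu], by simp⟩)
          exact hFG ⟨s(u, w), by simpa using huv'⟩ (Finset.mem_insert_self _ _) u w rfl
        · exact hS w hw

/-- Finitely many sites can be connected by opening finitely many bonds with `q > 0`. -/
theorem exists_connecting_set
    (hqa : ∀ x : Site d, Relation.ReflTransGen (fun u v => 0 < q s(u, v)) 0 x)
    (X : Finset (Site d)) :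
    ∃ (S : Finset (Site d)) (F : Finset (Bond (Site d))), 0 ∈ S ∧ X ⊆ S ∧
      (∀ b ∈ F, 0 < q b.1 ∧ ∀ v ∈ b.1, v ∈ S) ∧
      ∀ G : SimpleGraph (Site d), (∀ b ∈ F, ∀ u v, b.1 = s(u, v) → G.Adj u v) →
        ∀ u ∈ S, (avoid G (S : Set (Site d))ᶜ).Reachable 0 u := by
  classical
  induction X using Finset.induction_on with
  | empty =>
    obtain ⟨S, F, h0, -, hF, hG⟩ := exists_connecting_set_single hqa 0
    exact ⟨S, F, h0, by simp, hF, hG⟩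
  | insert x X _ ih =>
    obtain ⟨S, F, h0, hX, hF, hG⟩ := ih
    obtain ⟨S', F', -, hx, hF', hG'⟩ := exists_connecting_set_single hqa x
    refine ⟨S ∪ S', F ∪ F', by simp [h0], ?_, fun b hb => ?_, fun G hFG u hu => ?_⟩
    · exact Finset.insert_subset (by simp [hx]) (hX.trans Finset.subset_union_left)
    · rcases Finset.mem_union.1 hb with hb | hb
      · exact ⟨(hF b hb).1, fun v hv => Finset.mem_union_left _ ((hF b hb).2 v hv)⟩
      · exact ⟨(hF' b hb).1, fun v hv => Finset.mem_union_right _ ((hF' b hb).2 v hv)⟩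
    · rcases Finset.mem_union.1 hu with hu | hu
      · exact (hG G (fun b hb => hFG b (Finset.mem_union_left _ hb)) u hu).mono
          (avoid_anti G (Set.compl_subset_compl.2 (by simp)))
      · exact (hG' G (fun b hb => hFG b (Finset.mem_union_right _ hb)) u hu).mono
          (avoid_anti G (Set.compl_subset_compl.2 (by simp)))

end Connecting

/-! ### Counting trifurcations against boundary vertices -/

section Events

variable {d : ℕ} {q : Sym2 (Site d) → ℝ} {P : Measure (Config d)}

theorem openGraph_shiftConfig_adj {z : Site d} {ω : Config d} {x y : Site d} :
    (openGraph (shiftConfig z ω)).Adj x y ↔ (openGraph ω).Adj (x + z) (y + z) := by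
  constructor
  · intro h
    obtain ⟨b, hb, hω⟩ := openGraph_adj.1 h
    refine openGraph_adj.2 ⟨shiftBond z b, ?_, hω⟩
    simp [shiftBond, Bond.map, hb]
  · intro h
    have hne : x ≠ y := fun hxy => h.ne (by rw [hxy])
    obtain ⟨b, hb, hω⟩ := openGraph_adj.1 h
    have hs : shiftBond z ⟨s(x, y), by simpa using hne⟩ = b :=
      Subtype.ext (by simp [shiftBond, Bond.map, hb])
    exact openGraph_adj.2 ⟨⟨s(x, y), by simpa using hne⟩, rfl, by rw [shiftConfig, hs, hω]⟩

/-- Translation as an isomorphism of the graphs of open bonds. -/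
def shiftIso (z : Site d) (ω : Config d) : openGraph (shiftConfig z ω) ≃g openGraph ω where
  toEquiv := Equiv.addRight z
  map_rel_iff' := openGraph_shiftConfig_adj.symm

theorem shiftIso_apply (z : Site d) (ω : Config d) (x : Site d) : shiftIso z ω x = x + z := rfl

theorem shiftConfig_mem_connInfEvent {z : Site d} {ω : Config d} {x : Site d} :
    shiftConfig z ω ∈ connInfEvent x ↔ ω ∈ connInfEvent (x + z) :=
  infinite_cluster_iff (shiftIso z ω) x

theorem shiftConfig_mem_connEvent {z : Site d} {ω : Config d} {x y : Site d} :
    shiftConfig z ω ∈ connEvent x y ↔ ω ∈ connEvent (x + z) (y + z) :=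
  (shiftIso z ω).reachable_iff.symm

theorem openGraph_openBonds_adj {F : Finset (Bond (Site d))} {ω : Config d} {x y : Site d} :
    (openGraph (openBonds F ω)).Adj x y ↔
      (openGraph ω).Adj x y ∨ ∃ b ∈ F, b.1 = s(x, y) := by
  simp only [openGraph_adj]
  constructor
  · rintro ⟨b, hb, hω⟩
    by_cases hbF : b ∈ F
    · exact Or.inr ⟨b, hbF, hb⟩
    · exact Or.inl ⟨b, hb, by rwa [openBonds_of_notMem hbF] at hω⟩
  · rintro (⟨b, hb, hω⟩ | ⟨b, hbF, hb⟩)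
    · refine ⟨b, hb, ?_⟩
      by_cases hbF : b ∈ F
      · exact openBonds_of_mem hbF ω
      · rwa [openBonds_of_notMem hbF]
    · exact ⟨b, hb, openBonds_of_mem hbF ω⟩

theorem openGraph_le_openBonds (F : Finset (Bond (Site d))) (ω : Config d) :
    openGraph ω ≤ openGraph (openBonds F ω) := fun _ _ h => openGraph_openBonds_adj.2 (Or.inl h)

/-- Bonds with both ends in `S` disappear once `S` is isolated, so opening them does not change the
pieces outside. -/
theorem avoid_openBonds {F : Finset (Bond (Site d))} {S : Set (Site d)}
    (hF : ∀ b ∈ F, ∀ v ∈ b.1, v ∈ S) (ω : Config d) :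
    avoid (openGraph (openBonds F ω)) S = avoid (openGraph ω) S := by
  ext u v
  refine and_congr_left fun h => ?_
  rw [openGraph_openBonds_adj, or_iff_left]
  rintro ⟨b, hb, hbuv⟩
  exact h.1 (hF b hb u (by rw [hbuv]; exact Sym2.mem_mk_left u v))

/-- The event that `S` is a trifurcation. -/
def trifEvent (S : Set (Site d)) : Set (Config d) := {ω | IsTrifurcation (openGraph ω) S}

theorem measurableSet_avoid_adj (S : Set (Site d)) (x y : Site d) :
    MeasurableSet {ω : Config d | (avoid (openGraph ω) S).Adj x y} := by
  by_cases h : x ∉ S ∧ y ∉ S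
  · have : {ω : Config d | (avoid (openGraph ω) S).Adj x y} = {ω | (openGraph ω).Adj x y} := by
      ext ω
      exact and_iff_left h
    rw [this]
    exact measurableSet_adj x y
  · have : {ω : Config d | (avoid (openGraph ω) S).Adj x y} = ∅ := by
      ext ω
      exact iff_of_false (fun hω => h hω.2) id
    rw [this]
    exact MeasurableSet.empty

theorem measurableSet_trifEvent (S : Set (Site d)) : MeasurableSet (trifEvent S) := by
  have : trifEvent S = {ω : Config d | S.Nonempty ∧
      (∀ u ∈ S, ∀ v ∈ S, (avoid (openGraph ω) Sᶜ).Reachable u v) ∧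
      ∃ x : Fin 3 → Site d, (∀ i, x i ∉ S) ∧
        (∀ i j, i ≠ j → ¬ (avoid (openGraph ω) S).Reachable (x i) (x j)) ∧
        (∀ i, {v | (avoid (openGraph ω) S).Reachable (x i) v}.Infinite) ∧
        ∀ i, ∀ s ∈ S, (openGraph ω).Reachable s (x i)} := by
    ext ω
    exact ⟨fun h => ⟨h.1, h.2, h.3⟩, fun h => ⟨h.1, h.2.1, h.2.2⟩⟩
  rw [this, measurableSet_setOfPred]
  have hr : ∀ (T : Set (Site d)) (x y : Site d),
      Measurable fun ω : Config d => (avoid (openGraph ω) T).Reachable x y := fun T x y =>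
    measurableSet_setOfPred.1 (measurableSet_reachable (measurableSet_avoid_adj T) x y)
  refine measurable_const.and (Measurable.and ?_ (Measurable.exists fun x =>
    measurable_const.and (Measurable.and ?_ (Measurable.and ?_ ?_))))
  · exact Measurable.forall fun u => measurable_const.imp (Measurable.forall fun v =>
      measurable_const.imp (hr _ _ _))
  · exact Measurable.forall fun i => Measurable.forall fun j =>
      measurable_const.imp (hr _ _ _).not
  · exact Measurable.forall fun i => measurableSet_setOfPred.1
      (measurableSet_infinite fun v => measurableSet_setOfPred.2 (hr _ _ _))
  · exact Measurable.forall fun i => Measurable.forall fun s =>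
      measurable_const.imp (measurableSet_setOfPred.1 (measurableSet_connEvent _ _))

theorem shiftConfig_mem_trifEvent {z : Site d} {ω : Config d} {S : Set (Site d)} :
    shiftConfig z ω ∈ trifEvent S ↔ ω ∈ trifEvent {v | v - z ∈ S} :=
  isTrifurcation_iff (shiftIso z ω) fun v => by simp [shiftIso_apply]

theorem IsTolerant.measure_adj_le (h : IsTolerant q P) (x y : Site d) :
    P {ω | (openGraph ω).Adj x y} ≤ ENNReal.ofReal (q s(x, y)) := by
  by_cases hxy : x = y
  · have : {ω : Config d | (openGraph ω).Adj x y} = ∅ := by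
      ext ω
      exact iff_of_false (fun hω => SimpleGraph.Adj.ne (G := openGraph ω) hω hxy) id
    rw [this, measure_empty]
    exact zero_le
  · refine (measure_mono fun ω hω => ?_).trans (h.bond_le ⟨s(x, y), by simpa using hxy⟩)
    obtain ⟨b, hb, hbω⟩ := openGraph_adj.1 hω
    have : b = ⟨s(x, y), by simpa using hxy⟩ := Subtype.ext hb
    exact this ▸ hbω

/-- Borel–Cantelli: the bond densities at a site are summable. -/
theorem IsTolerant.ae_finite_adj (h : IsTolerant q P)
    (hqt : ∀ x y : Site d, q s(x, y) = q s(0, y - x))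
    (hqs : Summable fun x : Site d => q s(0, x)) :
    ∀ᵐ ω ∂P, ∀ x, {y | (openGraph ω).Adj x y}.Finite := by
  rw [ae_all_iff]
  intro x
  refine ae_finite_setOfPred_mem (s := fun y => {ω : Config d | (openGraph ω).Adj x y}) ?_
  refine ne_top_of_le_ne_top ?_ (ENNReal.tsum_le_tsum fun y => h.measure_adj_le x y)
  exact (summable_coupling hqt hqs x).tsum_ofReal_ne_top

theorem IsTolerant.measure_connInfEvent (h : IsTolerant q P) (x : Site d) :
    P (connInfEvent x) = P (connInfEvent 0) := by
  have h1 : shiftConfig x ⁻¹' connInfEvent 0 = connInfEvent x := by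
    ext ω
    rw [Set.mem_preimage, shiftConfig_mem_connInfEvent, zero_add]
  rw [← h1, ← Measure.map_apply (measurable_shiftConfig x) (measurableSet_connInfEvent 0),
    h.map_shift]

theorem IsTolerant.measure_trifEvent_shift (h : IsTolerant q P) (S : Set (Site d)) (z : Site d) :
    P (trifEvent {v | v - z ∈ S}) = P (trifEvent S) := by
  have h1 : shiftConfig z ⁻¹' trifEvent S = trifEvent {v | v - z ∈ S} := by
    ext ω
    rw [Set.mem_preimage, shiftConfig_mem_trifEvent]
  rw [← h1, ← Measure.map_apply (measurable_shiftConfig z) (measurableSet_trifEvent S),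
    h.map_shift]

/-- The vertices outside of `Λ` with an open bond to `Λ`. -/
def boundaryVertices (Λ : Finset (Site d)) (ω : Config d) : Set (Site d) :=
  {y | y ∉ Λ ∧ ∃ x ∈ Λ, (openGraph ω).Adj x y}

/-- The cells of side `2 K + 1` centered in the box of radius `n`. -/
theorem cell_subset_box {K n : ℕ} {S : Set (Site d)} (hS : ∀ v ∈ S, v ∈ box d K) {z : Site d}
    (hz : z ∈ box d n) :
    {v | v - (2 * (K : ℤ) + 1) • z ∈ S} ⊆ (box d ((2 * K + 1) * n + K) : Set (Site d)) := by
  intro v hv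
  refine Finset.mem_coe.2 (mem_box.2 fun i => ?_)
  have h1 := mem_box.1 (hS _ hv) i
  have h2 := mem_box.1 hz i
  simp only [Pi.sub_apply, Pi.smul_apply, smul_eq_mul] at h1
  have h3 : |(2 * (K : ℤ) + 1) * z i| ≤ (2 * K + 1) * n := by
    rw [abs_mul, abs_of_nonneg (by positivity)]
    gcongr
  calc |v i| = |(2 * (K : ℤ) + 1) * z i + (v i - (2 * (K : ℤ) + 1) * z i)| := by ring_nf
    _ ≤ _ := (abs_add_le _ _).trans (add_le_add h3 h1)
    _ = _ := by push_cast; ring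

theorem disjoint_cell {K : ℕ} {S : Set (Site d)} (hS : ∀ v ∈ S, v ∈ box d K) {z z' : Site d}
    (hz : z ≠ z') : Disjoint {v | v - (2 * (K : ℤ) + 1) • z ∈ S}
      {v | v - (2 * (K : ℤ) + 1) • z' ∈ S} := by
  rw [Set.disjoint_left]
  intro v hv hv'
  refine hz (funext fun i => ?_)
  have h1 := mem_box.1 (hS _ hv) i
  have h2 := mem_box.1 (hS _ hv') i
  simp only [Pi.sub_apply, Pi.smul_apply, smul_eq_mul] at h1 h2
  by_contra hne
  rw [abs_le] at h1 h2
  rcases lt_or_gt_of_ne hne with hlt | hlt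
  · have : (2 * (K : ℤ) + 1) * (z i + 1) ≤ (2 * (K : ℤ) + 1) * z' i :=
      mul_le_mul_of_nonneg_left hlt (by positivity)
    linarith
  · have : (2 * (K : ℤ) + 1) * (z' i + 1) ≤ (2 * (K : ℤ) + 1) * z i :=
      mul_le_mul_of_nonneg_left hlt (by positivity)
    linarith

open Classical in
theorem card_trifEvent_le {K n : ℕ} {S : Set (Site d)} (hS : ∀ v ∈ S, v ∈ box d K)
    (ω : Config d) :
    (((box d n).filter fun z => ω ∈ trifEvent {v | v - (2 * (K : ℤ) + 1) • z ∈ S}).card : ENNReal) ≤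
      (boundaryVertices (box d ((2 * K + 1) * n + K)) ω).encard := by
  set Λ := box d ((2 * K + 1) * n + K)
  by_cases hfin : (boundaryVertices Λ ω).Finite
  · have := card_trifurcation_le (G := openGraph ω)
      (ι := {z // z ∈ (box d n).filter fun z => ω ∈ trifEvent {v | v - (2 * (K : ℤ) + 1) • z ∈ S}})
      (S := fun z => {v | v - (2 * (K : ℤ) + 1) • z.1 ∈ S})
      (fun z => (Finset.mem_filter.1 z.2).2)
      (fun i j hij => disjoint_cell hS fun h => hij (Subtype.ext h))
      (Λ := (Λ : Set (Site d))) Λ.finite_toSet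
      (fun z => cell_subset_box hS (Finset.mem_filter.1 z.2).1)
      (Y := hfin.toFinset) (fun y hy hadj => hfin.mem_toFinset.2 ⟨hy, hadj⟩)
      (fun y hy => (hfin.mem_toFinset.1 hy).1)
    rw [Fintype.card_coe] at this
    rw [hfin.encard_eq_coe_toFinset_card]
    exact_mod_cast this
  · rw [Set.encard_eq_top hfin]
    simp

theorem encard_boundaryVertices (L : ℕ) (ω : Config d) :
    ((boundaryVertices (box d L) ω).encard : ENNReal) = ∑' y : {y : Site d // y ∉ box d L},
      Set.indicator {ω : Config d | ∃ x ∈ box d L, (openGraph ω).Adj x y.1} 1 ω := by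
  classical
  rw [← ENNReal.tsum_set_one, tsum_subtype (boundaryVertices (box d L) ω) fun _ => (1 : ENNReal)]
  refine Eq.trans ?_ (tsum_subtype {y : Site d | y ∉ box d L} fun y =>
    Set.indicator {ω : Config d | ∃ x ∈ box d L, (openGraph ω).Adj x y} 1 ω).symm
  refine tsum_congr fun y => ?_
  by_cases hy : y ∈ box d L <;> simp [Set.indicator, boundaryVertices, hy]

theorem measurableSet_exists_adj (Λ : Finset (Site d)) (y : Site d) :
    MeasurableSet {ω : Config d | ∃ x ∈ Λ, (openGraph ω).Adj x y} := by
  rw [measurableSet_setOfPred]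
  exact Measurable.exists fun x => measurable_const.and
    (measurableSet_setOfPred.1 (measurableSet_adj x y))

theorem IsTolerant.measure_exists_adj_le (h : IsTolerant q P) (Λ : Finset (Site d)) (y : Site d) :
    P {ω : Config d | ∃ x ∈ Λ, (openGraph ω).Adj x y} ≤ ∑ x ∈ Λ, ENNReal.ofReal (q s(x, y)) := by
  have : {ω : Config d | ∃ x ∈ Λ, (openGraph ω).Adj x y} =
      ⋃ x ∈ Λ, {ω : Config d | (openGraph ω).Adj x y} := by
    ext ω; simp
  rw [this]
  exact (measure_biUnion_finset_le _ _).trans (Finset.sum_le_sum fun x _ => h.measure_adj_le x y)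

theorem IsTolerant.lintegral_boundaryVertices_le (h : IsTolerant q P)
    (hqt : ∀ x y : Site d, q s(x, y) = q s(0, y - x))
    (hq : ∀ x y : Site d, 0 ≤ q s(x, y)) (hqs : Summable fun x : Site d => q s(0, x)) (L : ℕ) :
    ∫⁻ ω, ((boundaryVertices (box d L) ω).encard : ENNReal) ∂P ≤
      ENNReal.ofReal (∑' z : Site d, q s(0, z) * exitCount L z) := by
  have hm : ∀ y : {y : Site d // y ∉ box d L}, AEMeasurable
      (Set.indicator {ω : Config d | ∃ x ∈ box d L, (openGraph ω).Adj x y.1} (1 : Config d → ENNReal))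
      P := fun y =>
    (Measurable.indicator measurable_one (measurableSet_exists_adj (box d L) y.1)).aemeasurable
  rw [← tsum_boundary_eq hqt hq hqs, lintegral_congr (encard_boundaryVertices L), lintegral_tsum hm]
  refine ENNReal.tsum_le_tsum fun y => ?_
  rw [lintegral_indicator_one (measurableSet_exists_adj (box d L) y.1)]
  exact h.measure_exists_adj_le (box d L) y.1

/-- Trifurcations do not occur, since there would be more of them than boundary vertices. -/
theorem IsTolerant.measure_trifEvent (h : IsTolerant q P)
    (hqt : ∀ x y : Site d, q s(x, y) = q s(0, y - x))
    (hq : ∀ x y : Site d, 0 ≤ q s(x, y)) (hqs : Summable fun x : Site d => q s(0, x))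
    (S : Finset (Site d)) : P (trifEvent (S : Set (Site d))) = 0 := by
  classical
  have := h.isProbabilityMeasure
  obtain ⟨K, hK⟩ := exists_subset_box S
  have hS : ∀ v ∈ (S : Set (Site d)), v ∈ box d K := fun v hv => hK hv
  set L : ℕ → ℕ := fun n => (2 * K + 1) * n + K with hL
  -- The translates of `S` by multiples of `2 K + 1` are disjoint, and those indexed by the box of
  -- radius `n` fit in the box of radius `L n`. Since `2 * L n + 1 = (2 K + 1) (2 n + 1)`, the
  -- volume of the latter is `(2 K + 1) ^ d` times the number of translates.
  have key : ∀ n, P.real (trifEvent (S : Set (Site d))) ≤ (2 * (K : ℝ) + 1) ^ d *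
      ∑' z : Site d, q s(0, z) * ((exitCount (L n) z : ℝ) / (box d (L n)).card) := by
    intro n
    have h1 : ((box d n).card : ENNReal) * P (trifEvent (S : Set (Site d))) ≤
        ENNReal.ofReal (∑' z : Site d, q s(0, z) * exitCount (L n) z) := by
      refine le_trans (le_of_eq ?_) ((lintegral_mono fun ω => card_trifEvent_le hS ω).trans
        (h.lintegral_boundaryVertices_le hqt hq hqs (L n)))
      have h2 : ∀ ω : Config d, (((box d n).filter fun z =>
          ω ∈ trifEvent {v | v - (2 * (K : ℤ) + 1) • z ∈ (S : Set (Site d))}).card : ENNReal) =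
          ∑ z ∈ box d n, Set.indicator
            (trifEvent {v | v - (2 * (K : ℤ) + 1) • z ∈ (S : Set (Site d))}) 1 ω := by
        intro ω
        rw [Finset.card_filter, Nat.cast_sum]
        refine Finset.sum_congr rfl fun z _ => ?_
        simp [Set.indicator]
      simp only [h2]
      rw [lintegral_finsetSum _ fun z _ => measurable_one.indicator (measurableSet_trifEvent _)]
      simp only [lintegral_indicator_one (measurableSet_trifEvent _), h.measure_trifEvent_shift,
        Finset.sum_const, nsmul_eq_mul]
    have h0 : 0 ≤ ∑' z : Site d, q s(0, z) * exitCount (L n) z :=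
      tsum_nonneg fun z => mul_nonneg (hq _ _) (Nat.cast_nonneg _)
    have h3 := ENNReal.toReal_mono ENNReal.ofReal_ne_top h1
    rw [ENNReal.toReal_mul, ENNReal.toReal_natCast, ENNReal.toReal_ofReal h0, ← measureReal_def]
      at h3
    have h4 : ((box d (L n)).card : ℝ) = (2 * K + 1) ^ d * (box d n).card := by
      rw [card_box, card_box, hL]
      push_cast
      rw [← mul_pow]
      ring
    have hpos : (0 : ℝ) < (box d n).card := by rw [card_box]; positivity
    have hK0 : (0 : ℝ) < (2 * K + 1) ^ d := by positivity
    have h5 : ∑' z : Site d, q s(0, z) * ((exitCount (L n) z : ℝ) / (box d (L n)).card) =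
        (∑' z : Site d, q s(0, z) * exitCount (L n) z) / (box d (L n)).card := by
      rw [← tsum_div_const]
      exact tsum_congr fun z => (mul_div_assoc _ _ _).symm
    rw [h5, h4, ← mul_div_assoc, mul_div_mul_left _ _ hK0.ne', le_div_iff₀ hpos, mul_comm]
    exact h3
  have hLtop : Tendsto L atTop atTop :=
    tendsto_atTop_mono (fun n => show n ≤ (2 * K + 1) * n + K by nlinarith) tendsto_id
  have hlim := ((tendsto_tsum_exitCount hq hqs).comp hLtop).const_mul ((2 * (K : ℝ) + 1) ^ d)
  rw [mul_zero] at hlim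
  have h6 : P.real (trifEvent (S : Set (Site d))) ≤ 0 := ge_of_tendsto' hlim key
  exact (measureReal_eq_zero_iff).1 (h6.antisymm measureReal_nonneg)

end Events

/-! ### Uniqueness of the infinite cluster and the second moment -/

section Uniqueness

variable {d : ℕ} {q : Sym2 (Site d) → ℝ} {P : Measure (Config d)}

/-- The event that the given sites have distinct infinite clusters. -/
def distinctInfEvent {ι : Type*} (x : ι → Site d) : Set (Config d) :=
  {ω | (∀ i, ω ∈ connInfEvent (x i)) ∧ ∀ i j, i ≠ j → ω ∉ connEvent (x i) (x j)}

/-- Opening `F` glues three infinite clusters along `S`. By local finiteness each keeps an infinite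
piece outside `S`, and these pieces are not joined off `S` because the clusters were distinct. -/
theorem openBonds_mem_trifEvent {x : Fin 3 → Site d} {S : Finset (Site d)}
    {F : Finset (Bond (Site d))} (h0 : 0 ∈ S) (hx : ∀ i, x i ∈ S) (hF : ∀ b ∈ F, ∀ v ∈ b.1, v ∈ S)
    (hS : ∀ G : SimpleGraph (Site d), (∀ b ∈ F, ∀ u v, b.1 = s(u, v) → G.Adj u v) →
        ∀ u ∈ S, (avoid G (S : Set (Site d))ᶜ).Reachable 0 u)
    {ω : Config d} (hfin : ∀ x, {y | (openGraph ω).Adj x y}.Finite)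
    (hω : ω ∈ distinctInfEvent x) : openBonds F ω ∈ trifEvent (S : Set (Site d)) := by
  have hS' := hS (openGraph (openBonds F ω)) fun b hb u v huv =>
    openGraph_openBonds_adj.2 (Or.inr ⟨b, hb, huv⟩)
  have hle := openGraph_le_openBonds F ω
  choose x' hx'S hx' hinf using fun i =>
    exists_infinite_avoid hfin S.finite_toSet (Finset.mem_coe.2 (hx i)) (hω.1 i)
  have hav := avoid_openBonds (F := F) (S := (S : Set (Site d))) hF ω
  refine ⟨⟨0, h0⟩, fun u hu v hv => (hS' u hu).symm.trans (hS' v hv), x', hx'S, ?_, ?_, ?_⟩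
  · intro i j hij hr
    rw [hav] at hr
    exact hω.2 i j hij ((hx' i).trans ((hr.mono (avoid_le _ _)).trans (hx' j).symm))
  · intro i
    rw [hav]
    exact hinf i
  · intro i s hs
    refine SimpleGraph.Reachable.trans ?_ ((hx' i).mono hle)
    exact ((hS' s hs).symm.trans (hS' (x i) (hx i))).mono (avoid_le _ _)

/-- There are no three infinite clusters. -/
theorem IsTolerant.measure_three (h : IsTolerant q P)
    (hqt : ∀ x y : Site d, q s(x, y) = q s(0, y - x))
    (hq : ∀ x y : Site d, 0 ≤ q s(x, y)) (hqs : Summable fun x : Site d => q s(0, x))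
    (hqa : ∀ x : Site d, Relation.ReflTransGen (fun u v => 0 < q s(u, v)) 0 x)
    (x : Fin 3 → Site d) : P (distinctInfEvent x) = 0 := by
  classical
  obtain ⟨S, F, h0, hX, hF, hS⟩ := exists_connecting_set hqa (Finset.univ.image x)
  obtain ⟨C, -, hC⟩ := h.map_openBonds_le F fun b hb => (hF b hb).1
  have h1 : P (openBonds F ⁻¹' trifEvent (S : Set (Site d))) = 0 := by
    rw [← Measure.map_apply (measurable_openBonds F) (measurableSet_trifEvent _)]
    refine le_antisymm ((hC _).trans ?_) zero_le
    rw [Measure.smul_apply, h.measure_trifEvent hqt hq hqs, smul_zero]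
  have h2 : ∀ᵐ ω ∂P, ω ∉ openBonds F ⁻¹' trifEvent (S : Set (Site d)) := measure_eq_zero_iff_ae_notMem.1 h1
  refine measure_eq_zero_iff_ae_notMem.2 ?_
  filter_upwards [h2, h.ae_finite_adj hqt hqs] with ω hω hfin hmem
  exact hω (openBonds_mem_trifEvent h0 (fun i => hX (Finset.mem_image_of_mem x (Finset.mem_univ i)))
    (fun b hb => (hF b hb).2) hS hfin hmem)

/-- The event that there are two distinct infinite clusters. -/
def twoInfEvent (d : ℕ) : Set (Config d) :=
  {ω | ∃ x y, ω ∈ connInfEvent x ∧ ω ∈ connInfEvent y ∧ ω ∉ connEvent x y}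

theorem measurableSet_twoInfEvent : MeasurableSet (twoInfEvent d) := by
  rw [twoInfEvent, measurableSet_setOfPred]
  exact Measurable.exists fun x => Measurable.exists fun y =>
    (measurable_mem.2 (measurableSet_connInfEvent x)).and
      ((measurable_mem.2 (measurableSet_connInfEvent y)).and
        (measurable_mem.2 (measurableSet_connEvent x y)).not)

theorem shiftConfig_preimage_twoInfEvent (z : Site d) :
    shiftConfig z ⁻¹' twoInfEvent d = twoInfEvent d := by
  ext ω
  constructor
  · rintro ⟨x, y, hx, hy, hxy⟩
    exact ⟨x + z, y + z, shiftConfig_mem_connInfEvent.1 hx, shiftConfig_mem_connInfEvent.1 hy,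
      fun h => hxy (shiftConfig_mem_connEvent.2 h)⟩
  · rintro ⟨x, y, hx, hy, hxy⟩
    refine ⟨x - z, y - z, ?_, ?_, fun h => hxy ?_⟩
    · rw [shiftConfig_mem_connInfEvent, sub_add_cancel]; exact hx
    · rw [shiftConfig_mem_connInfEvent, sub_add_cancel]; exact hy
    · simpa only [sub_add_cancel] using shiftConfig_mem_connEvent.1 h

/-- If two infinite clusters are merged and two are left, there have been three. -/
theorem exists_distinctInfEvent {F : Finset (Bond (Site d))} {ω : Config d} {x y : Site d}
    (hx : ω ∈ connInfEvent x) (hy : ω ∈ connInfEvent y) (hxy : ω ∉ connEvent x y)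
    (hF : openBonds F ω ∈ connEvent x y) (h2 : openBonds F ω ∈ twoInfEvent d) :
    ∃ z : Fin 3 → Site d, ω ∈ distinctInfEvent z := by
  set G := openGraph ω
  set G' := openGraph (openBonds F ω)
  have hle : G ≤ G' := openGraph_le_openBonds F ω
  obtain ⟨a, ha, hax⟩ : ∃ a, {v | G'.Reachable a v}.Infinite ∧ ¬ G'.Reachable x a := by
    obtain ⟨a, b, ha, hb, hab⟩ := h2
    by_cases hax : G'.Reachable x a
    · exact ⟨b, hb, fun hbx => hab (hax.symm.trans hbx)⟩
    · exact ⟨a, ha, hax⟩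
  have hW : {u : Site d | ∃ b ∈ F, u ∈ b.1}.Finite := by
    classical
    refine (F.biUnion fun b => b.1.toFinset).finite_toSet.subset ?_
    rintro u ⟨b, hb, hu⟩
    exact Finset.mem_coe.2 (Finset.mem_biUnion.2 ⟨b, hb, Sym2.mem_toFinset.2 hu⟩)
  obtain ⟨w, haw, hw⟩ := exists_infinite_of_le (G := G) hW (fun u v huv => by
    refine (openGraph_openBonds_adj.1 huv).imp_right ?_
    rintro ⟨b, hb, hbuv⟩
    exact ⟨b, hb, by rw [hbuv]; exact Sym2.mem_mk_left u v⟩) ha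
  have hxw : ¬ G.Reachable x w := fun h => hax ((h.mono hle).trans haw.symm)
  have hyw : ¬ G.Reachable y w := fun h => hax (hF.trans ((h.mono hle).trans haw.symm))
  refine ⟨![x, y, w], fun i => ?_, fun i j hij => ?_⟩
  · fin_cases i
    exacts [hx, hy, hw]
  · fin_cases i <;> fin_cases j
    exacts [absurd rfl hij, hxy, hxw, fun h => hxy (SimpleGraph.Reachable.symm h), absurd rfl hij,
      hyw, fun h => hxw (SimpleGraph.Reachable.symm h),
      fun h => hyw (SimpleGraph.Reachable.symm h), absurd rfl hij]

/-- The infinite cluster is unique. -/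
theorem IsTolerant.ae_connEvent (h : IsTolerant q P) (hd : 0 < d)
    (hqt : ∀ x y : Site d, q s(x, y) = q s(0, y - x))
    (hq : ∀ x y : Site d, 0 ≤ q s(x, y)) (hqs : Summable fun x : Site d => q s(0, x))
    (hqa : ∀ x : Site d, Relation.ReflTransGen (fun u v => 0 < q s(u, v)) 0 x) (x y : Site d) :
    ∀ᵐ ω ∂P, ω ∈ connInfEvent x → ω ∈ connInfEvent y → ω ∈ connEvent x y := by
  classical
  obtain ⟨S, F, -, hX, hF, hS⟩ := exists_connecting_set hqa {x, y}
  have h3 : ∀ᵐ ω ∂P, ∀ z : Fin 3 → Site d, ω ∉ distinctInfEvent z :=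
    ae_all_iff.2 fun z => measure_eq_zero_iff_ae_notMem.1 (h.measure_three hqt hq hqs hqa z)
  have h2 := measure_eq_zero_iff_ae_notMem.1 (h.measure_diff_preimage_openBonds hd
    measurableSet_twoInfEvent shiftConfig_preimage_twoInfEvent F fun b hb => (hF b hb).1)
  filter_upwards [h3, h2] with ω h3 h2 hx hy
  by_contra hxy
  -- Opening `F` joins `x` to `y`, yet by invariance of `twoInfEvent` two infinite clusters almost
  -- surely remain, so there were three beforehand.
  have hI : ω ∈ twoInfEvent d := ⟨x, y, hx, hy, hxy⟩
  have hS' := hS (openGraph (openBonds F ω)) fun b hb u v huv =>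
    openGraph_openBonds_adj.2 (Or.inr ⟨b, hb, huv⟩)
  have hconn : openBonds F ω ∈ connEvent x y :=
    ((hS' x (hX (by simp))).symm.trans (hS' y (hX (by simp)))).mono (avoid_le _ _)
  by_cases h2' : openBonds F ω ∈ twoInfEvent d
  · obtain ⟨z, hz⟩ := exists_distinctInfEvent hx hy hxy hconn h2'
    exact h3 z hz
  · exact h2 ⟨hI, h2'⟩

/-- The second moment bound for the number of sites in the infinite cluster. -/
theorem IsTolerant.sq_connInfEvent_le (h : IsTolerant q P)
    (hc : ∀ x y, ∀ᵐ ω ∂P, ω ∈ connInfEvent x → ω ∈ connInfEvent y → ω ∈ connEvent x y)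
    {B : Finset (Site d)} (hB : B.Nonempty) :
    P.real (connInfEvent 0) ^ 2 ≤
      (∑ x ∈ B, ∑ y ∈ B, P.real (connEvent x y)) / (B.card : ℝ) ^ 2 := by
  have := h.isProbabilityMeasure
  set f : Site d → Config d → ℝ := fun x => Set.indicator (connInfEvent x) 1 with hf
  have hm : ∀ x : Site d, MeasurableSet (connInfEvent x) := measurableSet_connInfEvent
  have hint : ∀ x, Integrable (f x) P := fun x => (integrable_const (1 : ℝ)).indicator (hm x)
  have hfx : ∀ x, ∫ ω, f x ω ∂P = P.real (connInfEvent 0) := fun x => by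
    rw [hf, integral_indicator_one (hm x), measureReal_def, h.measure_connInfEvent,
      ← measureReal_def]
  have hff : ∀ x y ω, f x ω * f y ω =
      Set.indicator (connInfEvent x ∩ connInfEvent y) (1 : Config d → ℝ) ω := fun x y ω => by
    rw [Set.inter_indicator_one]; rfl
  have hint2 : ∀ x y, Integrable (fun ω => f x ω * f y ω) P := fun x y => by
    simp only [hff]
    exact (integrable_const (1 : ℝ)).indicator ((hm x).inter (hm y))
  have hfxy : ∀ x y, ∫ ω, f x ω * f y ω ∂P ≤ P.real (connEvent x y) := fun x y => by
    simp only [hff]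
    rw [integral_indicator_one ((hm x).inter (hm y))]
    refine ENNReal.toReal_mono (measure_ne_top _ _) (measure_mono_ae ?_)
    filter_upwards [hc x y] with ω hω hmem
    exact hω hmem.1 hmem.2
  set θ := P.real (connInfEvent 0)
  have hpos : (0 : ℝ) < B.card := by exact_mod_cast hB.card_pos
  rw [le_div_iff₀ (by positivity)]
  have hsum : ∫ ω, ∑ x ∈ B, f x ω ∂P = B.card * θ := by
    rw [integral_finsetSum _ fun x _ => hint x]
    simp only [hfx, Finset.sum_const, nsmul_eq_mul]
  have hsq : ∀ ω, (∑ x ∈ B, f x ω) ^ 2 = ∑ x ∈ B, ∑ y ∈ B, f x ω * f y ω := fun ω => by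
    rw [sq, Finset.sum_mul_sum]
  have hint3 : Integrable (fun ω => (∑ x ∈ B, f x ω) ^ 2) P := by
    simp only [hsq]
    exact integrable_finsetSum _ fun x _ => integrable_finsetSum _ fun y _ => hint2 x y
  have h1 : ∫ ω, (∑ x ∈ B, f x ω) ^ 2 ∂P ≤ ∑ x ∈ B, ∑ y ∈ B, P.real (connEvent x y) := by
    simp only [hsq]
    rw [integral_finsetSum _ fun x _ => integrable_finsetSum _ fun y _ => hint2 x y]
    refine Finset.sum_le_sum fun x _ => ?_
    rw [integral_finsetSum _ fun y _ => hint2 x y]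
    exact Finset.sum_le_sum fun y _ => hfxy x y
  have hint4 : Integrable (fun ω => ∑ x ∈ B, f x ω) P := integrable_finsetSum _ fun x _ => hint x
  -- Nonnegativity of the variance of the number of sites of `B` in infinite clusters.
  have h2 : 0 ≤ ∫ ω, (∑ x ∈ B, f x ω - B.card * θ) ^ 2 ∂P :=
    integral_nonneg fun ω => sq_nonneg _
  have h3 : ∫ ω, (∑ x ∈ B, f x ω - B.card * θ) ^ 2 ∂P =
      ∫ ω, (∑ x ∈ B, f x ω) ^ 2 ∂P - (B.card * θ) ^ 2 := by
    have : ∀ ω, (∑ x ∈ B, f x ω - B.card * θ) ^ 2 =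
        ((∑ x ∈ B, f x ω) ^ 2 - (2 * (B.card * θ)) * ∑ x ∈ B, f x ω) + (B.card * θ) ^ 2 :=
      fun ω => by ring
    simp only [this]
    have hint5 : Integrable (fun ω => (2 * (B.card * θ)) * ∑ x ∈ B, f x ω) P := hint4.const_mul _
    have hint6 : Integrable (fun ω => (∑ x ∈ B, f x ω) ^ 2 -
        (2 * (B.card * θ)) * ∑ x ∈ B, f x ω) P := hint3.sub hint5
    rw [integral_add hint6 (integrable_const _), integral_sub hint3 hint5, integral_const_mul,
      hsum, integral_const]
    simp
    ring
  nlinarith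

/-- There is no infinite cluster if the bonds are almost surely closed. -/
theorem IsTolerant.measure_connInfEvent_eq_zero (h : IsTolerant q P) (hq : ∀ e, q e = 0)
    (x : Site d) : P (connInfEvent x) = 0 := by
  have h1 : ∀ᵐ ω ∂P, ∀ b : Bond (Site d), ¬ ω b = true := by
    rw [ae_all_iff]
    intro b
    have := h.bond_le b
    rw [hq, ENNReal.ofReal_zero] at this
    exact measure_eq_zero_iff_ae_notMem.1 (le_antisymm this zero_le)
  refine measure_eq_zero_iff_ae_notMem.2 ?_
  filter_upwards [h1] with ω hω hinf
  refine hinf ((Set.finite_singleton x).subset ?_)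
  rintro y ⟨p⟩
  cases p with
  | nil => rfl
  | cons hadj _ =>
    obtain ⟨b, -, hb⟩ := openGraph_adj.1 hadj
    exact absurd hb (hω b)

end Uniqueness

/-! ### The bound by the long range order parameter -/

section LongRangeOrder

variable {d : ℕ} {J : Sym2 (Site d) → ℝ} {β : ℝ}

theorem MtildeLRO_sq (hJ : ∀ x y : Site d, 0 ≤ J s(x, y)) (hβ : 0 ≤ β) :
    MtildeLRO J β ^ 2 = ⨅ B : {B : Finset (Site d) // B.Nonempty},
      (∑ x ∈ B.1, ∑ y ∈ B.1, freeCorr J β x y) / (B.1.card : ℝ) ^ 2 :=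
  Real.sq_sqrt (Real.iInf_nonneg fun _ => div_nonneg (Finset.sum_nonneg fun _ _ =>
    Finset.sum_nonneg fun _ _ => freeCorr_nonneg hJ hβ _ _) (sq_nonneg _))

/-- At `β = 0` the rates `2 β J` vanish and no longer connect the lattice, but then almost surely no
bond is open. For `β > 0` they inherit aperiodicity from `J`. -/
theorem ae_percLaw_connEvent (hd : 0 < d) (hJt : ∀ x y : Site d, J s(x, y) = J s(0, y - x))
    (hJ : ∀ x y : Site d, 0 ≤ J s(x, y)) (hJs : Summable fun x : Site d => J s(0, x))
    (hJa : ∀ x : Site d, Relation.ReflTransGen (fun u v => 0 < J s(u, v)) 0 x)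
    (hβ : 0 ≤ β) (x y : Site d) :
    ∀ᵐ ω ∂percLaw J β, ω ∈ connInfEvent x → ω ∈ connInfEvent y → ω ∈ connEvent x y := by
  have h := isTolerant_percLaw hJt hJ hJs hβ
  rcases hβ.eq_or_lt with rfl | hβ
  · have h0 := h.measure_connInfEvent_eq_zero (fun e => by simp) x
    filter_upwards [measure_eq_zero_iff_ae_notMem.1 h0] with ω hω hx
    exact absurd hx hω
  · refine h.ae_connEvent hd (fun x y => by rw [hJt]) (fun x y => ?_) ?_ (fun x => ?_) x y
    · have := hJ x y
      positivity
    · exact (hJs.mul_left β).mul_left 2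
    · exact Relation.ReflTransGen.mono (fun u v (huv : 0 < J s(u, v)) => by positivity) _ _ (hJa x)

theorem sq_percLaw_connInfEvent_le (hd : 0 < d)
    (hJt : ∀ x y : Site d, J s(x, y) = J s(0, y - x))
    (hJ : ∀ x y : Site d, 0 ≤ J s(x, y)) (hJs : Summable fun x : Site d => J s(0, x))
    (hJa : ∀ x : Site d, Relation.ReflTransGen (fun u v => 0 < J s(u, v)) 0 x) (hβ : 0 ≤ β) :
    (percLaw J β).real (connInfEvent (0 : Site d)) ^ 2 ≤ MtildeLRO J β ^ 2 := by
  have : Nonempty {B : Finset (Site d) // B.Nonempty} := ⟨⟨{0}, Finset.singleton_nonempty 0⟩⟩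
  rw [MtildeLRO_sq hJ hβ]
  refine le_ciInf fun B => ((isTolerant_percLaw hJt hJ hJs hβ).sq_connInfEvent_le
    (ae_percLaw_connEvent hd hJt hJ hJs hJa hβ) B.2).trans ?_
  exact div_le_div_of_nonneg_right (Finset.sum_le_sum fun x _ => Finset.sum_le_sum fun y _ =>
    percLaw_connEvent_le hJt hJ hJs hβ x y) (sq_nonneg _)

end LongRangeOrder

end IsingCurrent

end

open IsingCurrent
theorem theorem3p1 {d : ℕ} (hd : 0 < d) (J : Sym2 (Site d) → ℝ)
    (hJ_transl : ∀ x y : Site d, J s(x, y) = J s(0, y - x))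
    (hJ_ferro : ∀ x y : Site d, 0 ≤ J s(x, y))
    (hJ_summable : Summable fun x : Site d => J s(0, x))
    (hJ_aperiodic : ∀ x : Site d, Relation.ReflTransGen (fun u v => 0 < J s(u, v)) 0 x)
    (β : ℝ) (hβ : 0 ≤ β) :
    -- the infinite-volume objects exist as limits along the boxes
    (∀ x y : Site d,
      Tendsto (fun L : ℕ => freeCorrIn J β (box d L) x y) atTop (𝓝 (freeCorr J β x y))) ∧
    IsLocalLimit (fun L => freeLawIn J β (box d L)) (freeLaw J β) ∧
    IsLocalLimit (fun L => plusLawIn J β (box d L)) (plusLaw J β) ∧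
    -- the bounds
    (∀ x y : Site d, (percLaw J β).real (connEvent x y) ≤ freeCorr J β x y) ∧
    (percLaw J β).real (connInfEvent (0 : Site d)) ^ 2 ≤ MtildeLRO J β ^ 2 ∧
    (MtildeLRO J β = 0 → percLaw J β (connInfEvent (0 : Site d)) = 0) := by
  have hsq := sq_percLaw_connInfEvent_le hd hJ_transl hJ_ferro hJ_summable hJ_aperiodic hβ
  have := isProbabilityMeasure_percLaw hJ_transl hJ_ferro hJ_summable hβ
  refine ⟨tendsto_freeCorrIn hJ_ferro hβ, (freeLaw_spec hJ_transl hJ_ferro hβ).1,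
    (plusLaw_spec hJ_transl hJ_ferro hJ_summable hβ).1,
    percLaw_connEvent_le hJ_transl hJ_ferro hJ_summable hβ, hsq, fun hM => ?_⟩
  rw [hM, zero_pow two_ne_zero] at hsq
  exact (measureReal_eq_zero_iff).1 (pow_eq_zero_iff two_ne_zero |>.1 (hsq.antisymm (sq_nonneg _)))
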